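/- Let $(\Omega,\mathcal F,P)$ be a probability space with a filtration $(\mathcal F_t)_{0\le t\le T}$ such that $\mathcal F_0$ contains all $P$-null events, and let $(S_t)_{0\le t\le T}$ be an $\mathbb R^d$-valued adapted process; put $\Delta S_t=S_t-S_{t-1}$. Let $\Xi_t$ be the set of $\mathcal F_t$-measurable $\mathbb R^d$-valued random variables. A strategy is a family $\phi=(\phi_t)_{1\le t\le T}$ with $\phi_t\in\Xi_{t-1}$; its value from initial capital $c\in\mathbb R$ is $V^{c,\phi}_t=c+\sum_{i=1}^t\langle\phi_i,\Delta S_i\rangle$. Expectations and conditional expectations are generalized ones, $E(X\mid\mathcal G)=E(X^+\mid\mathcal G)-E(X^-\mid\mathcal G)$, and are well defined when (a.s.) at least one of the two terms is finite. Let $U:\mathbb R\to\mathbb R$ be concave and nondecreasing with $U(0)=0$, and assume: (a) either there are $\tilde x>0$ and $0<\gamma<1$ with $U(\lambda x)\le\lambda^{\gamma}U(x)$ for all $x\ge\tilde x$ and $\lambda\ge1$, or there are $\alpha>0$ and $\tilde x\le0$ with $U(\lambda x)\le\lambda^{1+\alpha}U(x)$ for all $x\le\tilde x$ and $\lambda\ge1$;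 (b) (no arbitrage) for every strategy $\phi$, if $V^{0,\phi}_T\ge0$ a.s. then $V^{0,\phi}_T=0$ a.s.; (c) with $U_T(x):=U(x)$ and, for $0\le t<T$ and $x\in\mathbb R$, $$U_t(x):=\operatorname*{ess\,sup}_{\xi\in\Xi_t}E\bigl(U_{t+1}(x+\langle\xi,\Delta S_{t+1}\rangle)\mid\mathcal F_t\bigr),$$ where random functions are evaluated at random points through their regular (in $x$) versions, given by left limits along the rationals, all these conditional expectations are well defined, $U_t(x)<\infty$ a.s. for all $0\le t<T$ and $x\in\mathbb R$, and $EU_0(x)$ is well defined with $EU_0(x)<\infty$ for all $x\in\mathbb R$. For $c\in\mathbb R$ let $\Phi(U,c)$ be the set of strategies $\phi$ for which $EU(V_T^{c,\phi})$ is well defined, and let $u(c)=\sup_{\phi\in\Phi(U,c)}EU(V_T^{c,\phi})$. A strategy $\phi\in\Phi(U,c)$ is called optimal if $EU(V_T^{c,\phi})=u(c)<\infty$. For $1\le t\le T$ let $D_t(\omega)$ be the smallest affine subspace of $\mathbb R^d$ containing the support of the regular conditional distribution of $\Delta S_t$ given $\mathcal F_{t-1}$. If moreover $U$ is strictly concave,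 then for every $c\in\mathbb R$ there is an optimal strategy $\phi^*$ with $\phi^*_t\in D_t$ a.s. for all $1\le t\le T$, and it is unique: any two optimal strategies $\phi,\psi$ with $\phi_t\in D_t$ and $\psi_t\in D_t$ a.s. for all $1\le t\le T$ satisfy $\phi_t=\psi_t$ a.s. for all $1\le t\le T$. -/

import Mathlib

open MeasureTheory ProbabilityTheory Set Filter
open scoped ENNReal InnerProductSpace

namespace DiscreteMarket

/-! ### Generalized (conditional) expectations -/

section Expectations

variable {Ω : Type*}

/-- The positive part of an extended real valued function. -/
noncomputable def positivePart (X : Ω → EReal) : Ω → ℝ≥0∞ := fun ω => (X ω).toENNReal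

/-- The negative part of an extended real valued function. -/
noncomputable def negativePart (X : Ω → EReal) : Ω → ℝ≥0∞ := fun ω => (-X ω).toENNReal

/-- The expectation `E X = E X⁺ - E X⁻` is well defined: one of the two terms is finite. -/
def ExpWellDefined {mΩ : MeasurableSpace Ω} (P : Measure Ω) (X : Ω → EReal) : Prop :=
  ∫⁻ ω, positivePart X ω ∂P < ⊤ ∨ ∫⁻ ω, negativePart X ω ∂P < ⊤

/-- The expectation `E X = E X⁺ - E X⁻`, with values in `[-∞, ∞]`
(meaningful when `ExpWellDefined P X`). -/
noncomputable def gExp {mΩ : MeasurableSpace Ω} (P : Measure Ω) (X : Ω → EReal) : EReal :=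
  ((∫⁻ ω, positivePart X ω ∂P : ℝ≥0∞) : EReal) - ((∫⁻ ω, negativePart X ω ∂P : ℝ≥0∞) : EReal)

/-- The generalized conditional expectation `E(X | m) = E(X⁺ | m) - E(X⁻ | m)` is well defined:
almost surely one of the two terms is finite. -/
def CondExpWellDefined (m : MeasurableSpace Ω) {mΩ : MeasurableSpace Ω} (P : Measure Ω) (X : Ω → EReal) : Prop :=
  ∀ᵐ ω ∂P, condLExp m P (positivePart X) ω < ⊤ ∨ condLExp m P (negativePart X) ω < ⊤

/-- The generalized conditional expectation `E(X | m) = E(X⁺ | m) - E(X⁻ | m)`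
(meaningful when `CondExpWellDefined m P X`). -/
noncomputable def gCondExp (m : MeasurableSpace Ω) {mΩ : MeasurableSpace Ω} (P : Measure Ω) (X : Ω → EReal) :
    Ω → EReal :=
  fun ω => ((condLExp m P (positivePart X) ω : ℝ≥0∞) : EReal)
    - ((condLExp m P (negativePart X) ω : ℝ≥0∞) : EReal)

lemma measurable_gCondExp (m : MeasurableSpace Ω) {mΩ : MeasurableSpace Ω} (P : Measure Ω) (X : Ω → EReal) :
    Measurable[m] (gCondExp m P X) := by
  unfold gCondExp
  exact (measurable_condLExp m P _).coe_ereal_ennreal.sub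
    (measurable_condLExp m P _).coe_ereal_ennreal

end Expectations

/-! ### Essential suprema of families -/

section EssSup

variable {Ω ι : Type*}

/-- `Z` is an `m`-measurable version of the essential supremum of the family `F`: it dominates
every member almost surely, and is almost surely below any random variable that does so. -/
def IsEssSup (m : MeasurableSpace Ω) {mΩ : MeasurableSpace Ω} (P : Measure Ω) (F : ι → Ω → EReal) (Z : Ω → EReal) : Prop :=
  Measurable[m] Z ∧ (∀ i, F i ≤ᵐ[P] Z) ∧
    ∀ Z' : Ω → EReal, Measurable Z' → (∀ i, F i ≤ᵐ[P] Z') → Z ≤ᵐ[P] Z'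

open Classical in
/-- An `m`-measurable version of the essential supremum of the family `F`; it exists and is
almost surely unique when the members of `F` are `m`-measurable, see `isEssSup_essSupFamily`. -/
noncomputable def essSupFamily (m : MeasurableSpace Ω) {mΩ : MeasurableSpace Ω} (P : Measure Ω) (F : ι → Ω → EReal) :
    Ω → EReal :=
  if h : ∃ Z, IsEssSup m P F Z then h.choose else fun _ => ⊤

lemma exists_countable_essUnion {mΩ : MeasurableSpace Ω} (P : Measure Ω) [IsFiniteMeasure P] (A : ι → Set Ω)
    (hA : ∀ i, MeasurableSet (A i)) :
    ∃ J : Set ι, J.Countable ∧ ∀ i, P (A i \ ⋃ j ∈ J, A j) = 0 := by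
  classical
  let f : {J : Set ι // J.Countable} → ℝ≥0∞ := fun J => P (⋃ j ∈ J.1, A j)
  have : Nonempty {J : Set ι // J.Countable} := ⟨⟨∅, countable_empty⟩⟩
  obtain ⟨u, -, hu, hmem⟩ := exists_seq_tendsto_sSup (range_nonempty f) (OrderTop.bddAbove _)
  choose J hJ using hmem
  have hc : (⋃ n, (J n).1).Countable := countable_iUnion fun n => (J n).2
  refine ⟨⋃ n, (J n).1, hc, fun i => ?_⟩
  have hle : sSup (range f) ≤ P (⋃ j ∈ ⋃ n, (J n).1, A j) := by
    refine le_of_tendsto' hu fun n => ?_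
    rw [← hJ n]
    exact measure_mono (biUnion_subset_biUnion_left (subset_iUnion (fun n => (J n).1) n))
  have hins : P (⋃ j ∈ insert i (⋃ n, (J n).1), A j) ≤ sSup (range f) :=
    le_sSup ⟨⟨_, hc.insert i⟩, rfl⟩
  have hm : MeasurableSet (⋃ j ∈ ⋃ n, (J n).1, A j) := MeasurableSet.biUnion hc fun j _ => hA j
  have hsub : (A i \ ⋃ j ∈ ⋃ n, (J n).1, A j) ⊆
      (⋃ j ∈ insert i (⋃ n, (J n).1), A j) \ ⋃ j ∈ ⋃ n, (J n).1, A j :=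
    sdiff_subset_sdiff_left (subset_biUnion_of_mem (u := A) (mem_insert i _))
  refine measure_mono_null hsub ?_
  rw [measure_sdiff (biUnion_subset_biUnion_left (subset_insert _ _)) hm.nullMeasurableSet
    (measure_ne_top _ _)]
  exact tsub_eq_zero_of_le (hins.trans hle)

lemma exists_isEssSup (m : MeasurableSpace Ω) {mΩ : MeasurableSpace Ω} (hm : m ≤ mΩ) (P : Measure Ω) [IsFiniteMeasure P]
    (F : ι → Ω → EReal) (hF : ∀ i, Measurable[m] (F i)) : ∃ Z, IsEssSup m P F Z := by
  have key : ∀ r : ℚ, ∃ J : Set ι, J.Countable ∧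
      ∀ i, P ({ω | ((r : ℝ) : EReal) < F i ω} \ ⋃ j ∈ J, {ω | ((r : ℝ) : EReal) < F j ω}) = 0 :=
    fun r => exists_countable_essUnion P _ fun i =>
      measurableSet_lt measurable_const ((hF i).mono hm le_rfl)
  choose J hJc hJ using key
  have hc : (⋃ r, J r).Countable := countable_iUnion hJc
  refine ⟨fun ω => ⨆ j ∈ ⋃ r, J r, F j ω, ?_, fun i => ?_, fun Z' _ hZ' => ?_⟩
  · exact Measurable.biSup _ hc fun j _ => hF j
  · have hnull : ∀ᵐ ω ∂P, ∀ r : ℚ,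
        ω ∉ {ω | ((r : ℝ) : EReal) < F i ω} \ ⋃ j ∈ J r, {ω | ((r : ℝ) : EReal) < F j ω} :=
      ae_all_iff.2 fun r => measure_eq_zero_iff_ae_notMem.1 (hJ r i)
    filter_upwards [hnull] with ω hω
    by_contra hlt
    obtain ⟨r, h1, h2⟩ := EReal.exists_rat_btwn_of_lt (not_le.1 hlt)
    refine hω r ⟨h2, fun hmem => ?_⟩
    simp only [mem_iUnion, mem_ofPred_eq] at hmem
    obtain ⟨j, hj, hlt'⟩ := hmem
    exact absurd (h1.trans hlt')
      (not_lt.2 (le_biSup (fun j => F j ω) (mem_iUnion.2 ⟨r, hj⟩)))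
  · have := (ae_ball_iff hc).2 fun j _ => hZ' j
    filter_upwards [this] with ω hω
    exact iSup₂_le hω

lemma isEssSup_essSupFamily (m : MeasurableSpace Ω) {mΩ : MeasurableSpace Ω} (hm : m ≤ mΩ) (P : Measure Ω)
    [IsFiniteMeasure P] (F : ι → Ω → EReal) (hF : ∀ i, Measurable[m] (F i)) :
    IsEssSup m P F (essSupFamily m P F) := by
  have h := exists_isEssSup m hm P F hF
  unfold essSupFamily
  rw [dif_pos h]
  exact h.choose_spec

end EssSup

/-! ### The market -/

section Market

variable {Ω : Type*} {mΩ : MeasurableSpace Ω} {d : ℕ}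

/-- The price increment `ΔS_{t+1} = S_{t+1} - S_t`. -/
noncomputable def increment (S : ℕ → Ω → EuclideanSpace ℝ (Fin d)) (t : ℕ) :
    Ω → EuclideanSpace ℝ (Fin d) :=
  fun ω => S (t + 1) ω - S t ω

/-- `φ` is a trading strategy with horizon `T`: the portfolio `φ_{t+1}`, held between the times
`t` and `t + 1`, is `ℱ_t`-measurable. Only the values `φ_1, …, φ_T` matter. -/
def IsStrategy (ℱ : Filtration ℕ mΩ) (T : ℕ) (φ : ℕ → Ω → EuclideanSpace ℝ (Fin d)) : Prop :=
  ∀ t < T, Measurable[ℱ t] (φ (t + 1))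

/-- The portfolio value `V_t^{c,φ} = c + ∑_{i=1}^t ⟨φ_i, ΔS_i⟩`. -/
noncomputable def wealth (S : ℕ → Ω → EuclideanSpace ℝ (Fin d)) (c : ℝ)
    (φ : ℕ → Ω → EuclideanSpace ℝ (Fin d)) (t : ℕ) : Ω → ℝ :=
  fun ω => c + ∑ i ∈ Finset.range t, ⟪φ (i + 1) ω, increment S i ω⟫_ℝ

/-- Absence of arbitrage. -/
def NoArbitrage (ℱ : Filtration ℕ mΩ) (P : Measure Ω) (T : ℕ)
    (S : ℕ → Ω → EuclideanSpace ℝ (Fin d)) : Prop :=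
  ∀ φ : ℕ → Ω → EuclideanSpace ℝ (Fin d), IsStrategy ℱ T φ →
    (∀ᵐ ω ∂P, 0 ≤ wealth S 0 φ T ω) → ∀ᵐ ω ∂P, wealth S 0 φ T ω = 0

/-- Terminal utility `U(V_T^{c,φ})`. -/
noncomputable def terminalUtility (T : ℕ) (S : ℕ → Ω → EuclideanSpace ℝ (Fin d)) (U : ℝ → ℝ)
    (c : ℝ) (φ : ℕ → Ω → EuclideanSpace ℝ (Fin d)) : Ω → EReal :=
  fun ω => ((U (wealth S c φ T ω) : ℝ) : EReal)

/-- The class `Φ(U, c)` of strategies whose expected terminal utility is well defined. -/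
def IsAdmissible (ℱ : Filtration ℕ mΩ) (P : Measure Ω) (T : ℕ)
    (S : ℕ → Ω → EuclideanSpace ℝ (Fin d)) (U : ℝ → ℝ) (c : ℝ)
    (φ : ℕ → Ω → EuclideanSpace ℝ (Fin d)) : Prop :=
  IsStrategy ℱ T φ ∧ ExpWellDefined P (terminalUtility T S U c φ)

/-- The optimal value `u(c) = sup_{φ ∈ Φ(U, c)} E U(V_T^{c,φ})`. -/
noncomputable def optimalValue (ℱ : Filtration ℕ mΩ) (P : Measure Ω) (T : ℕ)
    (S : ℕ → Ω → EuclideanSpace ℝ (Fin d)) (U : ℝ → ℝ) (c : ℝ) : EReal :=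
  ⨆ (φ : ℕ → Ω → EuclideanSpace ℝ (Fin d)) (_ : IsAdmissible ℱ P T S U c φ),
    gExp P (terminalUtility T S U c φ)

/-- `φ` is an optimal strategy: `φ ∈ Φ(U, c)` and `E U(V_T^{c,φ}) = u(c) < ∞`. -/
def IsOptimal (ℱ : Filtration ℕ mΩ) (P : Measure Ω) (T : ℕ)
    (S : ℕ → Ω → EuclideanSpace ℝ (Fin d)) (U : ℝ → ℝ) (c : ℝ)
    (φ : ℕ → Ω → EuclideanSpace ℝ (Fin d)) : Prop :=
  IsAdmissible ℱ P T S U c φ ∧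
    gExp P (terminalUtility T S U c φ) = optimalValue ℱ P T S U c ∧
    optimalValue ℱ P T S U c < ⊤

/-- The random affine subspace `D_{t+1}(ω)`: the smallest affine subspace of `ℝ^d` containing the
support of the regular conditional distribution of `ΔS_{t+1}` given `ℱ_t`. (Conditioning on the
σ-algebra `ℱ_t` is conditioning on the identity map from `Ω` to `(Ω, ℱ_t)`.) -/
noncomputable def supportSpan (ℱ : Filtration ℕ mΩ) (P : Measure Ω) [IsFiniteMeasure P]
    (S : ℕ → Ω → EuclideanSpace ℝ (Fin d)) (t : ℕ) (ω : Ω) :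
    AffineSubspace ℝ (EuclideanSpace ℝ (Fin d)) :=
  affineSpan ℝ
    ((@condDistrib Ω Ω (EuclideanSpace ℝ (Fin d)) _ _ _ mΩ (ℱ t) (increment S t) id P _) ω).support

/-- For a random function `V` the family
`E(V(x + ⟨ξ, ΔS_{t+1}⟩) | ℱ_t)`, indexed by the `ℱ_t`-measurable random vectors `ξ`. -/
noncomputable def stepFamily (ℱ : Filtration ℕ mΩ) (P : Measure Ω)
    (S : ℕ → Ω → EuclideanSpace ℝ (Fin d)) (t : ℕ) (V : ℝ → Ω → EReal) (x : ℝ)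
    (ξ : {ξ : Ω → EuclideanSpace ℝ (Fin d) // Measurable[ℱ t] ξ}) : Ω → EReal :=
  gCondExp (ℱ t) P (fun ω => V (x + ⟪ξ.1 ω, increment S t ω⟫_ℝ) ω)

/-- `ess sup_ξ E(V(x + ⟨ξ, ΔS_{t+1}⟩) | ℱ_t)`, for each real `x` some version. -/
noncomputable def stepEssSup (ℱ : Filtration ℕ mΩ) (P : Measure Ω)
    (S : ℕ → Ω → EuclideanSpace ℝ (Fin d)) (t : ℕ) (V : ℝ → Ω → EReal) (x : ℝ) : Ω → EReal :=
  essSupFamily (ℱ t) P (stepFamily ℱ P S t V x)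

lemma isEssSup_stepEssSup (ℱ : Filtration ℕ mΩ) (P : Measure Ω) [IsFiniteMeasure P]
    (S : ℕ → Ω → EuclideanSpace ℝ (Fin d)) (t : ℕ) (V : ℝ → Ω → EReal) (x : ℝ) :
    IsEssSup (ℱ t) P (stepFamily ℱ P S t V x) (stepEssSup ℱ P S t V x) :=
  isEssSup_essSupFamily _ (ℱ.le t) P _ fun _ => measurable_gCondExp _ _ _

/-- Regularization of a family of random variables indexed by `x ∈ ℝ` to a random function with
nondecreasing left-continuous paths: the left limit along the rationals. It only uses the countably
many random variables `G q`, so changing each `G q` on a null set changes the random function,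
simultaneously for all `x`, on a null set only. -/
noncomputable def leftRegularization (G : ℝ → Ω → EReal) : ℝ → Ω → EReal :=
  fun x ω => ⨆ (q : ℚ) (_ : (q : ℝ) < x), G (q : ℝ) ω

/-- The random function `U_{T-k}`, by recursion on the number `k` of remaining periods. -/
noncomputable def valueFnAux (ℱ : Filtration ℕ mΩ) (P : Measure Ω) (T : ℕ)
    (S : ℕ → Ω → EuclideanSpace ℝ (Fin d)) (U : ℝ → ℝ) : ℕ → ℝ → Ω → EReal
  | 0 => fun x _ => ((U x : ℝ) : EReal)
  | k + 1 => leftRegularization (stepEssSup ℱ P S (T - (k + 1)) (valueFnAux ℱ P T S U k))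

/-- The random function `U_t`, `0 ≤ t ≤ T`: `U_T = U`, and `U_t` is the regular version (in `x`) of
`ess sup_ξ E(U_{t+1}(x + ⟨ξ, ΔS_{t+1}⟩) | ℱ_t)`, see `valueFn_terminal` and `valueFn_of_lt`. -/
noncomputable def valueFn (ℱ : Filtration ℕ mΩ) (P : Measure Ω) (T : ℕ)
    (S : ℕ → Ω → EuclideanSpace ℝ (Fin d)) (U : ℝ → ℝ) (t : ℕ) : ℝ → Ω → EReal :=
  valueFnAux ℱ P T S U (T - t)

lemma valueFn_terminal (ℱ : Filtration ℕ mΩ) (P : Measure Ω) (T : ℕ)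
    (S : ℕ → Ω → EuclideanSpace ℝ (Fin d)) (U : ℝ → ℝ) (x : ℝ) (ω : Ω) :
    valueFn ℱ P T S U T x ω = ((U x : ℝ) : EReal) := by
  simp [valueFn, valueFnAux]

lemma valueFn_of_lt (ℱ : Filtration ℕ mΩ) (P : Measure Ω) (T : ℕ)
    (S : ℕ → Ω → EuclideanSpace ℝ (Fin d)) (U : ℝ → ℝ) {t : ℕ} (ht : t < T) :
    valueFn ℱ P T S U t = leftRegularization (stepEssSup ℱ P S t (valueFn ℱ P T S U (t + 1))) := by
  obtain ⟨k, hk⟩ : ∃ k, T - t = k + 1 := ⟨T - t - 1, by omega⟩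
  have h1 : T - (t + 1) = k := by omega
  have h2 : T - (k + 1) = t := by omega
  simp only [valueFn, hk, h1, valueFnAux, h2]

/-- The dynamic programming values are well defined and finite: for `0 ≤ t < T` and `x ∈ ℝ` all
the conditional expectations `E(U_{t+1}(x + ⟨ξ, ΔS_{t+1}⟩) | ℱ_t)` are well defined,
`U_t(x) = ess sup_ξ E(U_{t+1}(x + ⟨ξ, ΔS_{t+1}⟩) | ℱ_t) < ∞` almost surely, and
`E U_0(x) < ∞`. -/
structure FiniteValues (ℱ : Filtration ℕ mΩ) (P : Measure Ω) (T : ℕ)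
    (S : ℕ → Ω → EuclideanSpace ℝ (Fin d)) (U : ℝ → ℝ) : Prop where
  wellDefined : ∀ t < T, ∀ x : ℝ, ∀ ξ : Ω → EuclideanSpace ℝ (Fin d), Measurable[ℱ t] ξ →
    CondExpWellDefined (ℱ t) P
      (fun ω => valueFn ℱ P T S U (t + 1) (x + ⟪ξ ω, increment S t ω⟫_ℝ) ω)
  finite : ∀ t < T, ∀ x : ℝ,
    ∀ᵐ ω ∂P, stepEssSup ℱ P S t (valueFn ℱ P T S U (t + 1)) x ω < ⊤
  initial : ∀ x : ℝ,
    ExpWellDefined P (valueFn ℱ P T S U 0 x) ∧ gExp P (valueFn ℱ P T S U 0 x) < ⊤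

end Market

/-! ### Conditions on the utility function -/

/-- `U` is concave, nondecreasing, `U 0 = 0`, and `U (l * x) ≤ l ^ γ * U x` for all `x ≥ x₀` and
`l ≥ 1`, for some `x₀ > 0` and `0 < γ < 1`. -/
def ElasticityAtTop (U : ℝ → ℝ) : Prop :=
  ConcaveOn ℝ univ U ∧ Monotone U ∧ U 0 = 0 ∧
    ∃ x₀ : ℝ, 0 < x₀ ∧ ∃ γ : ℝ, 0 < γ ∧ γ < 1 ∧
      ∀ x : ℝ, x₀ ≤ x → ∀ l : ℝ, 1 ≤ l → U (l * x) ≤ l ^ γ * U x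

/-- `U` is concave, nondecreasing, `U 0 = 0`, and `U (l * x) ≤ l ^ (1 + α) * U x` for all `x ≤ x₀`
and `l ≥ 1`, for some `x₀ ≤ 0` and `α > 0`. -/
def ElasticityAtBot (U : ℝ → ℝ) : Prop :=
  ConcaveOn ℝ univ U ∧ Monotone U ∧ U 0 = 0 ∧
    ∃ α : ℝ, 0 < α ∧ ∃ x₀ : ℝ, x₀ ≤ 0 ∧
      ∀ x : ℝ, x ≤ x₀ → ∀ l : ℝ, 1 ≤ l → U (l * x) ≤ l ^ (1 + α) * U x

end DiscreteMarket

open DiscreteMarket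

open scoped Topology

/-! Dynamic programming reduces the problem to single periods: a strategy that attains the essential
supremum defining U_t in every period is optimal. Two things have to be carried backwards in time:
attainment, and a property of U that survives conditioning and suprema and that makes attainment
possible.

The property is the scaling inequality a f(x) + k |f(x)| - C ≤ f(x/2) with k > 0 and a + k ≥ 1/2.
Either elasticity condition implies it (`exists_scaling`), and it passes from U_{t+1} to U_t by
halving an optimal position and using |E X| ≤ E|X| (`IsOneStep.isRatPath`).

Attainment is a compactness argument (`IsOneStep.exists_limit`). If near-optimal positions were
unbounded, concavity and a reverse Fatou lemma would produce a unit limit direction all of whose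
large multiples have nonnegative expected utility. Under doubling of the position the expected
losses at least double, and the scaling inequality removes a further multiple of them each time, so
the expectation turns negative unless the direction never loses (`IsRegularLaw.direction_nonneg`).
No arbitrage then makes the direction orthogonal to the increment. As all positions have been
projected on the linear span of the conditional law, the direction is 0, which is absurd. That span
lies in D_t because no arbitrage puts 0 into D_t (`ae_inEssSpan_cons`). Measurable choices come from
random subsequences and from Gram-Schmidt projections.

Along any strategy the value process is a generalized supermartingale, while its mean does not drop
along the constructed strategy, where the scaling inequality also supplies the integrability
(`IsOneStep.integrable_and_le_integral`).

For uniqueness, the midpoint of two optimal strategies and strict concavity force equal terminal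
wealth. By no arbitrage the one-period gains agree too, so the difference of two positions in D_t is
orthogonal to D_t, hence to itself. -/

namespace DiscreteMarket

/-! ### Utility paths and their restrictions to the rationals -/

section Paths

/-- The class of functions preserved by dynamic programming: concave, strictly increasing functions
above `U` that satisfy a scaling inequality expressing the elasticity condition. -/
structure IsUtilityPath (U : ℝ → ℝ) (a k C : ℝ) (f : ℝ → ℝ) : Prop where
  concave : ConcaveOn ℝ univ f
  strictMono : StrictMono f
  lower : ∀ x, U x ≤ f x
  scaling : ∀ x, a * f x + k * |f x| - C ≤ f (x / 2)

/-- The analogue of `IsUtilityPath` for functions on the rationals. -/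
structure IsRatPath (U : ℝ → ℝ) (a k C : ℝ) (e : ℚ → ℝ) : Prop where
  concave : ∀ p q s : ℚ, 0 ≤ s → s ≤ 1 → (s : ℝ) * e p + (1 - s : ℝ) * e q ≤ e (s * p + (1 - s) * q)
  strictMono : ∀ p q : ℚ, p < q → e p < e q
  lower : ∀ q : ℚ, U q ≤ e q
  scaling : ∀ q : ℚ, a * e q + k * |e q| - C ≤ e (q / 2)

/-- The left-continuous extension to `ℝ` of a function on `ℚ`. -/
noncomputable def ratExt (e : ℚ → ℝ) (x : ℝ) : ℝ :=
  (⨆ (q : ℚ) (_ : (q : ℝ) < x), ((e q : ℝ) : EReal)).toReal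

/-- By monotonicity the supremum lies between two real values, so `toReal` does not fall back to its
default 0. -/
lemma coe_ratExt {e : ℚ → ℝ} (he : Monotone e) (x : ℝ) :
    ((ratExt e x : ℝ) : EReal) = ⨆ (q : ℚ) (_ : (q : ℝ) < x), ((e q : ℝ) : EReal) := by
  obtain ⟨p, hp⟩ := exists_rat_lt x
  obtain ⟨r, hr⟩ := exists_rat_gt x
  refine EReal.coe_toReal (ne_of_lt ?_) (ne_of_gt ?_)
  · refine lt_of_le_of_lt (iSup₂_le fun q hq => ?_) (EReal.coe_lt_top (e r))
    exact EReal.coe_le_coe_iff.2 (he (by exact_mod_cast (hq.trans hr).le))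
  · exact lt_of_lt_of_le (EReal.bot_lt_coe (e p)) (le_iSup₂ (f := fun (q : ℚ) (_ : (q : ℝ) < x) =>
      ((e q : ℝ) : EReal)) p hp)

lemma le_ratExt {e : ℚ → ℝ} (he : Monotone e) {x : ℝ} {q : ℚ} (hq : (q : ℝ) < x) :
    e q ≤ ratExt e x := by
  rw [← EReal.coe_le_coe_iff, coe_ratExt he]
  exact le_iSup₂ (f := fun (q : ℚ) (_ : (q : ℝ) < x) => ((e q : ℝ) : EReal)) q hq

lemma ratExt_le {e : ℚ → ℝ} (he : Monotone e) {x b : ℝ} (h : ∀ q : ℚ, (q : ℝ) < x → e q ≤ b) :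
    ratExt e x ≤ b := by
  rw [← EReal.coe_le_coe_iff, coe_ratExt he]
  exact iSup₂_le fun q hq => EReal.coe_le_coe_iff.2 (h q hq)

lemma measurable_ratExt : Measurable fun z : (ℚ → ℝ) × ℝ => ratExt z.1 z.2 := by
  unfold ratExt
  refine Measurable.ereal_toReal (Measurable.iSup fun q => ?_)
  have h : (fun z : (ℚ → ℝ) × ℝ => ⨆ (_ : (q : ℝ) < z.2), ((z.1 q : ℝ) : EReal)) =
      fun z => if (q : ℝ) < z.2 then ((z.1 q : ℝ) : EReal) else ⊥ := by
    ext z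
    split_ifs with h <;> simp [h]
  rw [h]
  refine Measurable.ite (measurableSet_lt measurable_const measurable_snd) ?_ measurable_const
  exact measurable_coe_real_ereal.comp ((measurable_pi_apply q).comp measurable_fst)

attribute [irreducible] ratExt

variable {U : ℝ → ℝ} {a k C : ℝ} {e : ℚ → ℝ} {f : ℝ → ℝ}

lemma IsRatPath.monotone (he : IsRatPath U a k C e) : Monotone e :=
  (show StrictMono e from fun p q h => he.strictMono p q h).monotone

lemma IsUtilityPath.continuous (hf : IsUtilityPath U a k C f) : Continuous f :=
  continuousOn_univ.1 (hf.concave.continuousOn isOpen_univ)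

/-- The suprema run over strictly smaller rationals, so s p + (1 - s) q stays strictly below the
target point; this slack lets a real weight s be replaced by rational ones. -/
lemma concaveOn_ratExt (he : Monotone e)
    (hc : ∀ p q s : ℚ, 0 ≤ s → s ≤ 1 →
      (s : ℝ) * e p + (1 - s : ℝ) * e q ≤ e (s * p + (1 - s) * q)) :
    ConcaveOn ℝ univ (ratExt e) := by
  have key : ∀ (x y s : ℝ), 0 < s → s < 1 → ∀ p q : ℚ, (p : ℝ) < x → (q : ℝ) < y →
      s * e p + (1 - s) * e q ≤ ratExt e (s * x + (1 - s) * y) := by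
    intro x y s hs0 hs1 p q hp hq
    have hlt : s * p + (1 - s) * q < s * x + (1 - s) * y := by
      have h1 : s * p < s * x := mul_lt_mul_of_pos_left hp hs0
      have h2 : (1 - s) * q < (1 - s) * y := mul_lt_mul_of_pos_left hq (by linarith)
      linarith
    obtain ⟨u, hu⟩ : ∃ u : ℕ → ℚ, Tendsto (fun n => (u n : ℝ)) atTop (𝓝 s) := by
      have hd : DenseRange ((↑) : ℚ → ℝ) := Rat.denseRange_cast
      obtain ⟨v, hv, hlim⟩ := mem_closure_iff_seq_limit.1 (hd s)
      choose u hu using hv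
      exact ⟨u, by simpa [hu] using hlim⟩
    have h1 : ∀ᶠ n in atTop, (u n : ℝ) * p + (1 - u n) * q < s * x + (1 - s) * y := by
      have : Tendsto (fun n => (u n : ℝ) * p + (1 - u n) * q) atTop (𝓝 (s * p + (1 - s) * q)) :=
        (hu.mul_const _).add ((hu.const_sub 1).mul_const _)
      exact this.eventually_lt_const hlt
    have h2 : Tendsto (fun n => (u n : ℝ) * e p + (1 - u n) * e q) atTop
        (𝓝 (s * e p + (1 - s) * e q)) := (hu.mul_const _).add ((hu.const_sub 1).mul_const _)
    refine le_of_tendsto h2 ?_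
    filter_upwards [h1, hu.eventually_lt_const hs1, hu.eventually_const_lt hs0] with n hn h1n h0n
    refine (hc p q (u n) (by exact_mod_cast h0n.le) (by exact_mod_cast h1n.le)).trans ?_
    exact le_ratExt he (by push_cast; exact hn)
  refine concaveOn_iff_forall_pos.2 ⟨convex_univ, fun x _ y _ s t hs ht hst => ?_⟩
  obtain rfl : t = 1 - s := by linarith
  have hs1 : s < 1 := by linarith
  simp only [smul_eq_mul]
  have h1 : ∀ q : ℚ, (q : ℝ) < y → s * ratExt e x + (1 - s) * e q
      ≤ ratExt e (s * x + (1 - s) * y) := by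
    intro q hq
    have : ratExt e x ≤ (ratExt e (s * x + (1 - s) * y) - (1 - s) * e q) / s := by
      refine ratExt_le he fun p hp => ?_
      rw [le_div_iff₀ hs]
      linarith [key x y s hs hs1 p q hp hq]
    rw [le_div_iff₀ hs] at this
    linarith
  have : ratExt e y ≤ (ratExt e (s * x + (1 - s) * y) - s * ratExt e x) / (1 - s) := by
    refine ratExt_le he fun q hq => ?_
    rw [le_div_iff₀ ht]
    linarith [h1 q hq]
  rw [le_div_iff₀ ht] at this
  linarith

/-- A finite concave function on the line is continuous, so the left limit at q equals the right
limit, which is at least e q. -/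
lemma IsRatPath.ratExt_cast (he : IsRatPath U a k C e) (q : ℚ) : ratExt e q = e q := by
  refine le_antisymm (ratExt_le he.monotone fun p hp => he.monotone (by exact_mod_cast hp.le)) ?_
  have hc : Continuous (ratExt e) :=
    continuousOn_univ.1 ((concaveOn_ratExt he.monotone he.concave).continuousOn isOpen_univ)
  have ht : Tendsto (ratExt e) (𝓝[>] (q : ℝ)) (𝓝 (ratExt e q)) :=
    hc.continuousAt.tendsto.mono_left nhdsWithin_le_nhds
  exact ge_of_tendsto ht (eventually_mem_nhdsWithin.mono fun x hx => le_ratExt he.monotone hx)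

lemma IsRatPath.isUtilityPath (he : IsRatPath U a k C e) (hU : Continuous U) :
    IsUtilityPath U a k C (ratExt e) := by
  have hconc := concaveOn_ratExt he.monotone he.concave
  have hc : Continuous (ratExt e) := continuousOn_univ.1 (hconc.continuousOn isOpen_univ)
  have hd : DenseRange ((↑) : ℚ → ℝ) := Rat.denseRange_cast
  refine ⟨hconc, fun x y hxy => ?_, fun x => ?_, fun x => ?_⟩
  · obtain ⟨p, hxp, hpy⟩ := exists_rat_btwn hxy
    obtain ⟨q, hpq, hqy⟩ := exists_rat_btwn hpy
    calc ratExt e x ≤ e p := ratExt_le he.monotone fun r hr =>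
          he.monotone (by exact_mod_cast (hr.trans hxp).le)
      _ < e q := he.strictMono p q (by exact_mod_cast hpq)
      _ ≤ ratExt e y := le_ratExt he.monotone hqy
  · refine hd.induction_on x (isClosed_le hU hc) fun q => ?_
    rw [he.ratExt_cast]
    exact he.lower q
  · refine hd.induction_on x (isClosed_le (by fun_prop) (by fun_prop)) fun q => ?_
    have h2 : ((q : ℝ) / 2) = ((q / 2 : ℚ) : ℝ) := by push_cast; rfl
    rw [h2, he.ratExt_cast, he.ratExt_cast]
    exact he.scaling q

lemma IsUtilityPath.isRatPath (hf : IsUtilityPath U a k C f) :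
    IsRatPath U a k C fun q : ℚ => f q := by
  refine ⟨fun p q s h0 h1 => ?_, fun p q hpq => hf.strictMono (by exact_mod_cast hpq),
    fun q => hf.lower q, fun q => ?_⟩
  · have := hf.concave.2 (mem_univ (p : ℝ)) (mem_univ (q : ℝ))
      (show (0 : ℝ) ≤ s by exact_mod_cast h0)
      (show (0 : ℝ) ≤ 1 - s by rw [sub_nonneg]; exact_mod_cast h1) (by ring)
    simpa using this
  · simpa using hf.scaling q

lemma IsUtilityPath.ratExt_eq (hf : IsUtilityPath U a k C f) (x : ℝ) :
    ratExt (fun q : ℚ => f q) x = f x := by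
  have hm := hf.isRatPath.monotone
  refine le_antisymm (ratExt_le hm fun q hq => hf.strictMono.monotone hq.le) ?_
  have ht : Tendsto f (𝓝[<] x) (𝓝 (f x)) :=
    hf.continuous.continuousAt.tendsto.mono_left nhdsWithin_le_nhds
  refine le_of_tendsto ht (eventually_mem_nhdsWithin.mono fun y hy => ?_)
  obtain ⟨q, hyq, hqx⟩ := exists_rat_btwn (show y < x from hy)
  exact (hf.strictMono.monotone hyq.le).trans (le_ratExt hm hqx)

/-- This is why paths are stored on the rationals: the class is cut out by countably many
inequalities, so almost sure membership can be transferred to conditional laws. -/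
lemma measurableSet_isRatPath (U : ℝ → ℝ) (a k C : ℝ) :
    MeasurableSet {e : ℚ → ℝ | IsRatPath U a k C e} := by
  have h : {e : ℚ → ℝ | IsRatPath U a k C e} =
      (⋂ (p : ℚ) (q : ℚ) (s : ℚ) (_ : 0 ≤ s) (_ : s ≤ 1),
        {e | (s : ℝ) * e p + (1 - s : ℝ) * e q ≤ e (s * p + (1 - s) * q)}) ∩
      (⋂ (p : ℚ) (q : ℚ) (_ : p < q), {e | e p < e q}) ∩ (⋂ q : ℚ, {e | U q ≤ e q}) ∩
      ⋂ q : ℚ, {e | a * e q + k * |e q| - C ≤ e (q / 2)} := by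
    ext e
    simp only [mem_inter_iff, mem_iInter, mem_ofPred_eq]
    exact ⟨fun h => ⟨⟨⟨h.concave, h.strictMono⟩, h.lower⟩, h.scaling⟩,
      fun h => ⟨h.1.1.1, h.1.1.2, h.1.2, h.2⟩⟩
  rw [h]
  refine ((MeasurableSet.inter ?_ ?_).inter ?_).inter ?_
  · refine MeasurableSet.iInter fun p => MeasurableSet.iInter fun q => MeasurableSet.iInter fun s =>
      MeasurableSet.iInter fun _ => MeasurableSet.iInter fun _ => measurableSet_le ?_ ?_ <;> fun_prop
  · refine MeasurableSet.iInter fun p => MeasurableSet.iInter fun q =>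
      MeasurableSet.iInter fun _ => measurableSet_lt ?_ ?_ <;> fun_prop
  · refine MeasurableSet.iInter fun q => measurableSet_le ?_ ?_ <;> fun_prop
  · refine MeasurableSet.iInter fun q => measurableSet_le ?_ ?_ <;> fun_prop

lemma IsUtilityPath.zero_le (hf : IsUtilityPath U a k C f) (hU0 : U 0 = 0) : 0 ≤ f 0 :=
  hU0.ge.trans (hf.lower 0)

/-- Concavity and `0 ≤ f 0` give `f (l x) ≤ l f x` for `l ≥ 1`. -/
lemma concaveOn_apply_mul_le (hf : ConcaveOn ℝ univ f) (h0 : 0 ≤ f 0) {l : ℝ} (hl : 1 ≤ l)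
    (x : ℝ) : f (l * x) ≤ l * f x := by
  have hl0 : 0 < l := by linarith
  have h := hf.2 (mem_univ (l * x)) (mem_univ (0 : ℝ))
    (show 0 ≤ l⁻¹ by positivity) (sub_nonneg.2 (inv_le_one_of_one_le₀ hl)) (by ring)
  have hx : l⁻¹ • (l * x) + (1 - l⁻¹) • (0 : ℝ) = x := by
    simp only [smul_eq_mul]; field_simp; ring
  rw [hx] at h
  simp only [smul_eq_mul] at h
  have h1 : 0 ≤ (1 - l⁻¹) * f 0 := mul_nonneg (sub_nonneg.2 (inv_le_one_of_one_le₀ hl)) h0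
  calc f (l * x) = l * (l⁻¹ * f (l * x)) := by field_simp
    _ ≤ l * f x := mul_le_mul_of_nonneg_left (by linarith) hl0.le

/-- The concave function f - f 0 vanishes at 0, so dilating z by 2^j multiplies its strictly
negative value at z by at least 2^j, which eventually outweighs f 0. -/
lemma IsUtilityPath.exists_neg (hf : IsUtilityPath U a k C f) {z : ℝ} (hz : z < 0) :
    ∃ j : ℕ, f (2 ^ j * z) < 0 := by
  have hs : 0 < f 0 - f z := sub_pos.2 (hf.strictMono hz)
  obtain ⟨j, hj⟩ := pow_unbounded_of_one_lt (|f 0| / (f 0 - f z) + 1) (one_lt_two : (1 : ℝ) < 2)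
  refine ⟨j, ?_⟩
  have hl : (1 : ℝ) ≤ 2 ^ j := one_le_pow₀ one_le_two
  have hg : ConcaveOn ℝ univ fun x => f x - f 0 := hf.concave.sub (convexOn_const _ convex_univ)
  have h := concaveOn_apply_mul_le hg (by simp) hl z
  have h2 : |f 0| < 2 ^ j * (f 0 - f z) := by
    rw [← div_lt_iff₀ hs]; linarith
  have := le_abs_self (f 0)
  nlinarith

end Paths

/-! ### The one-period problem under a fixed law -/

section OnePeriod

/-- A reverse Fatou lemma for functions dominated from above by an integrable function. -/
lemma integrable_and_le_integral_of_tendsto {E : Type*} [MeasurableSpace E] {Q : Measure E}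
    {D f : E → ℝ} {g : ℕ → E → ℝ} {z : ℕ → ℝ} {z₀ : ℝ} (hD : Integrable D Q)
    (hgi : ∀ n, Integrable (g n) Q) (hgD : ∀ n, ∀ᵐ e ∂Q, g n e ≤ D e)
    (hlim : ∀ᵐ e ∂Q, Tendsto (fun n => g n e) atTop (𝓝 (f e)))
    (hz : ∀ n, z n ≤ ∫ e, g n e ∂Q) (hz₀ : Tendsto z atTop (𝓝 z₀)) :
    Integrable f Q ∧ z₀ ≤ ∫ e, f e ∂Q := by
  have hfm : AEStronglyMeasurable f Q :=
    aestronglyMeasurable_of_tendsto_ae atTop (fun n => (hgi n).aestronglyMeasurable) hlim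
  have hfD : ∀ᵐ e ∂Q, f e ≤ D e := by
    filter_upwards [hlim, ae_all_iff.2 hgD] with e h1 h2
    exact le_of_tendsto' h1 h2
  have hDz : ∀ n, z n ≤ ∫ e, D e ∂Q := fun n =>
    (hz n).trans (integral_mono_ae (hgi n) hD (hgD n))
  have hDz₀ : z₀ ≤ ∫ e, D e ∂Q := le_of_tendsto' hz₀ hDz
  -- Fatou for the nonnegative functions D - g n. The bound yields both the integrability of f and,
  -- below, the inequality for its integral.
  have hle : ∫⁻ e, ENNReal.ofReal (D e - f e) ∂Q ≤ ENNReal.ofReal ((∫ e, D e ∂Q) - z₀) := by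
    calc ∫⁻ e, ENNReal.ofReal (D e - f e) ∂Q
        = ∫⁻ e, liminf (fun n => ENNReal.ofReal (D e - g n e)) atTop ∂Q := by
          refine lintegral_congr_ae ?_
          filter_upwards [hlim] with e he
          exact (((ENNReal.continuous_ofReal.tendsto _).comp
            (he.const_sub (D e))).liminf_eq).symm
      _ ≤ liminf (fun n => ∫⁻ e, ENNReal.ofReal (D e - g n e) ∂Q) atTop :=
          lintegral_liminf_le' fun n =>
            (hD.sub (hgi n)).aestronglyMeasurable.aemeasurable.ennreal_ofReal
      _ ≤ liminf (fun n => ENNReal.ofReal ((∫ e, D e ∂Q) - z n)) atTop := by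
          refine liminf_le_liminf (Eventually.of_forall fun n => ?_)
          rw [← ofReal_integral_eq_lintegral_ofReal (f := fun e => D e - g n e) (hD.sub (hgi n))
            ((hgD n).mono fun e he => sub_nonneg.2 he), integral_sub hD (hgi n)]
          exact ENNReal.ofReal_le_ofReal (by linarith [hz n])
      _ = ENNReal.ofReal ((∫ e, D e ∂Q) - z₀) :=
          ((ENNReal.continuous_ofReal.tendsto _).comp (hz₀.const_sub _)).liminf_eq
  have hint : Integrable (fun e => D e - f e) Q := by
    refine ⟨hD.aestronglyMeasurable.sub hfm, ?_⟩
    rw [hasFiniteIntegral_iff_ofReal (hfD.mono fun e he => sub_nonneg.2 he)]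
    exact hle.trans_lt ENNReal.ofReal_lt_top
  have hf : Integrable f Q := by
    have := hD.sub hint
    refine this.congr (Eventually.of_forall fun e => ?_)
    simp
  refine ⟨hf, ?_⟩
  rw [← ofReal_integral_eq_lintegral_ofReal hint (hfD.mono fun e he => sub_nonneg.2 he),
    ENNReal.ofReal_le_ofReal_iff (sub_nonneg.2 hDz₀), integral_sub hD hf] at hle
  linarith

variable {E : Type*} [MeasurableSpace E] {d : ℕ} {U : ℝ → ℝ} {a k C : ℝ}

/-- The joint law of a random utility path `F` and a price increment `y`, such that every position
in the market has finite expected positive utility. -/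
structure IsRegularLaw (U : ℝ → ℝ) (a k C : ℝ) (Q : Measure E) (y : E → EuclideanSpace ℝ (Fin d))
    (F : E → ℝ → ℝ) : Prop where
  measurable_y : Measurable y
  measurable_F : Measurable (Function.uncurry F)
  path : ∀ᵐ e ∂Q, IsUtilityPath U a k C (F e)
  dom : ∀ n : ℕ, ∫⁻ e, ENNReal.ofReal (F e (n + n * ‖y e‖)) ∂Q < ⊤

variable {Q : Measure E} {y : E → EuclideanSpace ℝ (Fin d)}
  {F : E → ℝ → ℝ}

lemma IsRegularLaw.measurable_comp (h : IsRegularLaw U a k C Q y F) {w : E → ℝ}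
    (hw : Measurable w) : Measurable fun e => F e (w e) :=
  h.measurable_F.comp (measurable_id.prodMk hw)

lemma IsRegularLaw.integrable_dom (h : IsRegularLaw U a k C Q y F) (n : ℕ) :
    Integrable (fun e => max (F e (n + n * ‖y e‖)) 0) Q := by
  have hm : Measurable fun e => max (F e (n + n * ‖y e‖)) 0 :=
    (h.measurable_comp (by have := h.measurable_y; fun_prop)).max measurable_const
  refine ⟨hm.aestronglyMeasurable, ?_⟩
  rw [hasFiniteIntegral_iff_ofReal (f := fun e => max (F e (n + n * ‖y e‖)) 0)
    (Eventually.of_forall fun e => le_max_right _ _)]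
  refine lt_of_eq_of_lt (lintegral_congr fun e => ?_) (h.dom n)
  rcases le_total (F e (n + n * ‖y e‖)) 0 with h0 | h0
  · simp [h0, ENNReal.ofReal_of_nonpos h0]
  · rw [max_eq_left h0]

/-- Monotonicity and Cauchy-Schwarz give one integrable bound for all positions of size at most n,
as the reverse Fatou lemma requires along convergent sequences. -/
lemma IsRegularLaw.le_dom (h : IsRegularLaw U a k C Q y F) {n : ℕ} {x : ℝ}
    {ξ : EuclideanSpace ℝ (Fin d)} (hx : |x| ≤ n) (hξ : ‖ξ‖ ≤ n) :
    ∀ᵐ e ∂Q, F e (x + ⟪ξ, y e⟫_ℝ) ≤ max (F e (n + n * ‖y e‖)) 0 := by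
  filter_upwards [h.path] with e he
  refine le_max_of_le_left (he.strictMono.monotone (add_le_add ((le_abs_self x).trans hx) ?_))
  exact (real_inner_le_norm _ _).trans (mul_le_mul_of_nonneg_right hξ (norm_nonneg _))

/-- Upper semicontinuity of expected utility in the position. -/
lemma IsRegularLaw.integrable_and_le_of_tendsto (h : IsRegularLaw U a k C Q y F)
    {x : ℕ → ℝ} {x₀ : ℝ} {ξ : ℕ → EuclideanSpace ℝ (Fin d)} {ξ₀ : EuclideanSpace ℝ (Fin d)}
    {z : ℕ → ℝ} {z₀ : ℝ} (hx : Tendsto x atTop (𝓝 x₀)) (hξ : Tendsto ξ atTop (𝓝 ξ₀))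
    (hz : Tendsto z atTop (𝓝 z₀))
    (hint : ∀ n, Integrable (fun e => F e (x n + ⟪ξ n, y e⟫_ℝ)) Q)
    (hle : ∀ n, z n ≤ ∫ e, F e (x n + ⟪ξ n, y e⟫_ℝ) ∂Q) :
    Integrable (fun e => F e (x₀ + ⟪ξ₀, y e⟫_ℝ)) Q ∧ z₀ ≤ ∫ e, F e (x₀ + ⟪ξ₀, y e⟫_ℝ) ∂Q := by
  obtain ⟨Bx, hBx⟩ := hx.norm.bddAbove_range
  obtain ⟨Bξ, hBξ⟩ := hξ.norm.bddAbove_range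
  obtain ⟨N, hN⟩ := exists_nat_ge (max Bx Bξ)
  refine integrable_and_le_integral_of_tendsto (h.integrable_dom N) hint (fun n => ?_) ?_ hle hz
  · exact h.le_dom ((hBx ⟨n, rfl⟩).trans ((le_max_left _ _).trans hN))
      ((hBξ ⟨n, rfl⟩).trans ((le_max_right _ _).trans hN))
  · filter_upwards [h.path] with e he
    have := hx.add (hξ.inner (𝕜 := ℝ) (tendsto_const_nhds (x := y e)))
    exact (he.continuous.tendsto _).comp this

/-- Below an integrable function the utility of a position is integrable. -/
lemma IsRegularLaw.integrable_of_ge (h : IsRegularLaw U a k C Q y F) {g : E → ℝ}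
    (hg : Integrable g Q) {x : ℝ} {ξ : EuclideanSpace ℝ (Fin d)}
    (hle : ∀ᵐ e ∂Q, g e ≤ F e (x + ⟪ξ, y e⟫_ℝ)) :
    Integrable (fun e => F e (x + ⟪ξ, y e⟫_ℝ)) Q := by
  obtain ⟨N, hN⟩ := exists_nat_ge (max |x| ‖ξ‖)
  have hm : Measurable fun e => F e (x + ⟪ξ, y e⟫_ℝ) :=
    h.measurable_comp (by have := h.measurable_y; fun_prop)
  exact integrable_of_le_of_le hm.aestronglyMeasurable hle
    (h.le_dom ((le_max_left _ _).trans hN) ((le_max_right _ _).trans hN)) hg (h.integrable_dom N)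

/-- If arbitrarily large positions with directions converging to `η` have expected utility bounded
from below, then all large multiples of `η` have nonnegative expected utility. -/
lemma IsRegularLaw.direction_utility_nonneg (h : IsRegularLaw U a k C Q y F) (hU0 : U 0 = 0)
    {x z : ℝ} {ξ : ℕ → EuclideanSpace ℝ (Fin d)} {η : EuclideanSpace ℝ (Fin d)}
    (hξ : Tendsto (fun n => ‖ξ n‖) atTop atTop)
    (hη : Tendsto (fun n => ‖ξ n‖⁻¹ • ξ n) atTop (𝓝 η))
    (hint : ∀ n, Integrable (fun e => F e (x + ⟪ξ n, y e⟫_ℝ)) Q)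
    (hle : ∀ n, z ≤ ∫ e, F e (x + ⟪ξ n, y e⟫_ℝ) ∂Q) {m : ℝ} (hm : 1 ≤ m) :
    Integrable (fun e => F e (m * ⟪η, y e⟫_ℝ)) Q ∧ 0 ≤ ∫ e, F e (m * ⟪η, y e⟫_ℝ) ∂Q := by
  obtain ⟨N, hN⟩ := eventually_atTop.1 (hξ.eventually_ge_atTop m)
  have hm0 : 0 < m := by linarith
  -- Multiplying by r turns the positions into ones converging to m η, while endowment and lower
  -- bound shrink to 0. From N on r ≤ 1, so concavity applies with the factor r⁻¹ ≥ 1.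
  set r : ℕ → ℝ := fun n => m * ‖ξ (n + N)‖⁻¹ with hr
  have hpos : ∀ n, 0 < ‖ξ (n + N)‖ := fun n => hm0.trans_le (hN _ (Nat.le_add_left _ _))
  have hr0 : ∀ n, 0 < r n := fun n => mul_pos hm0 (inv_pos.2 (hpos n))
  have hr1 : ∀ n, 1 ≤ (r n)⁻¹ := fun n => by
    refine one_le_inv_iff₀.2 ⟨hr0 n, ?_⟩
    change m * ‖ξ (n + N)‖⁻¹ ≤ 1
    rw [← div_eq_mul_inv, div_le_one (hpos n)]
    exact hN _ (Nat.le_add_left _ _)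
  have hshift : Tendsto (fun n : ℕ => n + N) atTop atTop := tendsto_add_atTop_nat N
  have hrlim : Tendsto r atTop (𝓝 0) := by
    have := ((tendsto_inv_atTop_zero.comp (hξ.comp hshift)).const_mul m)
    simpa [hr, Function.comp_def] using this
  have hbd : ∀ n, ∀ᵐ e ∂Q, r n * F e (x + ⟪ξ (n + N), y e⟫_ℝ)
      ≤ F e (r n * x + ⟪r n • ξ (n + N), y e⟫_ℝ) := fun n => by
    filter_upwards [h.path] with e he
    have h1 := concaveOn_apply_mul_le he.concave (he.zero_le hU0) (hr1 n)
      (r n * x + ⟪r n • ξ (n + N), y e⟫_ℝ)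
    have h2 : (r n)⁻¹ * (r n * x + ⟪r n • ξ (n + N), y e⟫_ℝ) = x + ⟪ξ (n + N), y e⟫_ℝ := by
      rw [real_inner_smul_left]
      have := (hr0 n).ne'
      field_simp
    rw [h2, inv_mul_eq_div, le_div_iff₀ (hr0 n)] at h1
    linarith
  have hi : ∀ n, Integrable (fun e => F e (r n * x + ⟪r n • ξ (n + N), y e⟫_ℝ)) Q := fun n =>
    h.integrable_of_ge ((hint (n + N)).const_mul (r n)) (hbd n)
  have key := h.integrable_and_le_of_tendsto (x := fun n => r n * x) (x₀ := 0)
    (ξ := fun n => r n • ξ (n + N)) (ξ₀ := m • η) (z := fun n => r n * z) (z₀ := 0)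
    (by simpa using hrlim.mul_const x)
    (by simpa [hr, mul_smul, Function.comp_def] using (hη.comp hshift).const_smul m)
    (by simpa using hrlim.mul_const z) hi (fun n => ?_)
  · simpa [real_inner_smul_left] using key
  · calc r n * z ≤ r n * ∫ e, F e (x + ⟪ξ (n + N), y e⟫_ℝ) ∂Q :=
          mul_le_mul_of_nonneg_left (hle _) (hr0 n).le
      _ = ∫ e, r n * F e (x + ⟪ξ (n + N), y e⟫_ℝ) ∂Q := (integral_const_mul _ _).symm
      _ ≤ _ := integral_mono_ae ((hint (n + N)).const_mul (r n)) (hi n) (hbd n)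

/-- The scaling inequality is incompatible with nonnegative expected utility of all multiples of a
direction that may lose money. -/
lemma IsRegularLaw.direction_nonneg [IsProbabilityMeasure Q] (h : IsRegularLaw U a k C Q y F) (hU0 : U 0 = 0)
    (hk : 0 < k) (hak : 1 / 2 ≤ a + k) {η : EuclideanSpace ℝ (Fin d)}
    (hη : ∀ m : ℝ, 1 ≤ m → Integrable (fun e => F e (m * ⟪η, y e⟫_ℝ)) Q ∧
      0 ≤ ∫ e, F e (m * ⟪η, y e⟫_ℝ) ∂Q) :
    ∀ᵐ e ∂Q, 0 ≤ ⟪η, y e⟫_ℝ := by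
  set f : ℕ → E → ℝ := fun j e => F e (2 ^ j * ⟪η, y e⟫_ℝ) with hf
  have hone : ∀ j : ℕ, (1 : ℝ) ≤ 2 ^ j := fun j => one_le_pow₀ one_le_two
  have hfi : ∀ j, Integrable (f j) Q := fun j => (hη _ (hone j)).1
  have hA : ∀ j, 0 ≤ ∫ e, f j e ∂Q := fun j => (hη _ (hone j)).2
  have hni : ∀ j, Integrable (fun e => max (-f j e) 0) Q := fun j => (hfi j).neg_part
  by_contra hcon
  -- Otherwise every f j is almost surely nonnegative, while a strictly increasing concave path
  -- becomes negative along the dilations of a loss.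
  obtain ⟨j₀, hj₀⟩ : ∃ j, 0 < ∫ e, max (-f j e) 0 ∂Q := by
    by_contra! hall
    refine hcon ?_
    have hz : ∀ j, ∀ᵐ e ∂Q, max (-f j e) 0 = 0 := fun j =>
      (integral_eq_zero_iff_of_nonneg (fun e => le_max_right _ _) (hni j)).1
        (le_antisymm (hall j) (integral_nonneg fun e => le_max_right _ _))
    filter_upwards [ae_all_iff.2 hz, h.path] with e he hp
    by_contra! hneg
    obtain ⟨j, hj⟩ := hp.exists_neg hneg
    have := he j
    rw [max_eq_left (by simp only [hf]; linarith)] at this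
    simp only [hf] at this
    linarith
  set ν := ∫ e, max (-f j₀ e) 0 ∂Q with hν
  have hscale : ∀ j, ∀ᵐ e ∂Q, f (j + 1) e ≤ 2 * f j e := fun j => by
    filter_upwards [h.path] with e he
    have := concaveOn_apply_mul_le he.concave (he.zero_le hU0) one_le_two (2 ^ j * ⟪η, y e⟫_ℝ)
    rwa [← mul_assoc, ← pow_succ'] at this
  have hN : ∀ i, 2 ^ i * ν ≤ ∫ e, max (-f (j₀ + i) e) 0 ∂Q := by
    intro i
    induction i with
    | zero => simp [hν]
    | succ i ih =>
      calc 2 ^ (i + 1) * ν = 2 * (2 ^ i * ν) := by ring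
        _ ≤ 2 * ∫ e, max (-f (j₀ + i) e) 0 ∂Q := by linarith
        _ = ∫ e, 2 * max (-f (j₀ + i) e) 0 ∂Q := (integral_const_mul _ _).symm
        _ ≤ ∫ e, max (-f (j₀ + (i + 1)) e) 0 ∂Q := by
          refine integral_mono_ae ((hni _).const_mul 2) (hni _) ?_
          filter_upwards [hscale (j₀ + i)] with e he
          rw [mul_max_of_nonneg _ _ zero_le_two, mul_zero, ← add_assoc]
          exact max_le_max (by linarith) le_rfl
  -- Since |f| = f + 2 f⁻, the scaling inequality reads (a + k) f + 2k f⁻ - C ≤ f at half the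
  -- position. The factor a + k may be lowered to 1/2 after integration because the mean is
  -- nonnegative.
  have hstep : ∀ j, (1 / 2) * (∫ e, f (j + 1) e ∂Q) + 2 * k * (∫ e, max (-f (j + 1) e) 0 ∂Q) - |C|
      ≤ ∫ e, f j e ∂Q := by
    intro j
    have h1 : ∀ᵐ e ∂Q, (a + k) * f (j + 1) e + 2 * k * max (-f (j + 1) e) 0 - |C| ≤ f j e := by
      filter_upwards [h.path] with e he
      have hs := he.scaling (2 ^ (j + 1) * ⟪η, y e⟫_ℝ)
      have hd : 2 ^ (j + 1) * ⟪η, y e⟫_ℝ / 2 = 2 ^ j * ⟪η, y e⟫_ℝ := by ring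
      rw [hd] at hs
      have hC := le_abs_self C
      simp only [hf]
      rcases le_total (F e (2 ^ (j + 1) * ⟪η, y e⟫_ℝ)) 0 with h0 | h0
      · rw [max_eq_left (by linarith)]
        rw [abs_of_nonpos h0] at hs
        linarith
      · rw [max_eq_right (by linarith)]
        rw [abs_of_nonneg h0] at hs
        linarith
    have i1 : Integrable (fun e => (a + k) * f (j + 1) e) Q := (hfi _).const_mul _
    have i2 : Integrable (fun e => 2 * k * max (-f (j + 1) e) 0) Q := (hni _).const_mul _
    have h2 := integral_mono_ae ((i1.add i2).sub (integrable_const |C|)) (hfi j) h1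
    rw [integral_sub' (i1.add i2) (integrable_const _), integral_add' i1 i2, integral_const_mul,
      integral_const_mul] at h2
    simp only [integral_const, probReal_univ, smul_eq_mul, one_mul] at h2
    have := mul_le_mul_of_nonneg_right hak (hA (j + 1))
    linarith
  -- This solves A_{i+1} ≤ 2 A_i - 4k 2^{i+1} ν + 2|C|: the accumulated losses grow like i 2^i,
  -- everything else only like 2^i.
  have hind : ∀ i : ℕ, (∫ e, f (j₀ + i) e ∂Q) ≤
      2 ^ i * ((∫ e, f j₀ e ∂Q) - 4 * k * ν * i + 2 * |C|) - 2 * |C| := by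
    intro i
    induction i with
    | zero => simp
    | succ i ih =>
      have h1 := hstep (j₀ + i)
      have h2 := mul_le_mul_of_nonneg_left (hN (i + 1)) (by linarith : 0 ≤ 2 * k)
      rw [← add_assoc] at h2
      rw [← add_assoc]
      push_cast
      rw [pow_succ] at h2 ⊢
      have e1 : 2 * k * (2 ^ i * 2 * ν) = 4 * (2 ^ i * k * ν) := by ring
      have e2 : (2 : ℝ) ^ i * 2 * ((∫ e, f j₀ e ∂Q) - 4 * k * ν * (i + 1) + 2 * |C|) - 2 * |C| =
        2 * (2 ^ i * ((∫ e, f j₀ e ∂Q) - 4 * k * ν * i + 2 * |C|) - 2 * |C|)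
          - 8 * (2 ^ i * k * ν) + 2 * |C| := by ring
      rw [e2]
      rw [e1] at h2
      linarith
  obtain ⟨i, hi⟩ := exists_nat_gt (((∫ e, f j₀ e ∂Q) + 2 * |C|) / (4 * k * ν))
  have hkν : 0 < 4 * k * ν := by positivity
  rw [div_lt_iff₀ hkν] at hi
  have h1 := hind i
  have h2 : (2 : ℝ) ^ i * ((∫ e, f j₀ e ∂Q) - 4 * k * ν * i + 2 * |C|) < 0 :=
    mul_neg_of_pos_of_neg (by positivity) (by linarith)
  linarith [hA (j₀ + i), abs_nonneg C]

/-- Limit directions of unbounded positions with expected utility bounded from below never lose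
money. -/
lemma IsRegularLaw.limit_direction_nonneg [IsProbabilityMeasure Q]
    (h : IsRegularLaw U a k C Q y F) (hU0 : U 0 = 0)
    (hk : 0 < k) (hak : 1 / 2 ≤ a + k)
    {x z : ℝ} {ξ : ℕ → EuclideanSpace ℝ (Fin d)} {η : EuclideanSpace ℝ (Fin d)}
    (hξ : Tendsto (fun n => ‖ξ n‖) atTop atTop)
    (hη : Tendsto (fun n => ‖ξ n‖⁻¹ • ξ n) atTop (𝓝 η))
    (hint : ∀ n, Integrable (fun e => F e (x + ⟪ξ n, y e⟫_ℝ)) Q)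
    (hle : ∀ n, z ≤ ∫ e, F e (x + ⟪ξ n, y e⟫_ℝ) ∂Q) :
    ∀ᵐ e ∂Q, 0 ≤ ⟪η, y e⟫_ℝ :=
  h.direction_nonneg hU0 hk hak fun _ hm => h.direction_utility_nonneg hU0 hξ hη hint hle hm

end OnePeriod

/-! ### Random subsequences -/

section RandomSubsequence

variable {Ω X : Type*} {mΩ : MeasurableSpace Ω}

/-- A sequence evaluated at a random index is measurable. -/
lemma measurable_apply_nat [MeasurableSpace X] {f : ℕ → Ω → X} (hf : ∀ n, Measurable (f n))
    {τ : Ω → ℕ} (hτ : Measurable τ) : Measurable fun ω => f (τ ω) ω := by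
  have h : Measurable (Function.uncurry f) := measurable_from_prod_countable_right hf
  exact h.comp (hτ.prodMk measurable_id)

lemma measurableSet_frequently {A : Ω → ℕ → Prop} (hA : ∀ n, MeasurableSet {ω | A ω n}) :
    MeasurableSet {ω | ∃ᶠ n in atTop, A ω n} := by
  have h : {ω | ∃ᶠ n in atTop, A ω n} = ⋂ N : ℕ, ⋃ (n : ℕ) (_ : N ≤ n), {ω | A ω n} := by
    ext ω
    simp only [frequently_atTop, mem_iInter, mem_iUnion, mem_ofPred_eq, exists_prop]
  rw [h]
  exact MeasurableSet.iInter fun _ => MeasurableSet.iUnion fun n => MeasurableSet.iUnion fun _ => hA n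

/-- A random infinite set of indices. -/
def IsRandomInfinite {Ω : Type*} [MeasurableSpace Ω] (A : Ω → ℕ → Prop) : Prop :=
  (∀ n, MeasurableSet {ω | A ω n}) ∧ ∀ ω, ∃ᶠ n in atTop, A ω n

/-- Along a convergent subsequence some ball of radius ε/2 about a point of a dense sequence is
visited infinitely often. Taking the first such centre keeps the choice measurable. -/
lemma exists_refinement [PseudoMetricSpace X] [SecondCountableTopology X] [ProperSpace X]
    [MeasurableSpace X] [BorelSpace X] {f : ℕ → Ω → X} (hf : ∀ n, Measurable (f n))
    (hb : ∀ ω, Bornology.IsBounded (range fun n => f n ω)) {A : Ω → ℕ → Prop}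
    (hA : IsRandomInfinite A) {ε : ℝ} (hε : 0 < ε) :
    ∃ A' : Ω → ℕ → Prop, IsRandomInfinite A' ∧ (∀ ω n, A' ω n → A ω n) ∧
      ∀ ω n m, A' ω n → A' ω m → dist (f n ω) (f m ω) < ε := by
  classical
  rcases isEmpty_or_nonempty Ω with hΩ | ⟨⟨ω₀⟩⟩
  · exact ⟨A, hA, fun _ _ h => h, fun ω => hΩ.elim ω⟩
  have : Nonempty X := ⟨f 0 ω₀⟩
  let e := TopologicalSpace.denseSeq X
  let B : ℕ → Ω → ℕ → Prop := fun j ω n => A ω n ∧ dist (f n ω) (e j) < ε / 2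
  have hBm : ∀ j n, MeasurableSet {ω | B j ω n} := fun j n =>
    (hA.1 n).inter (measurableSet_lt ((hf n).dist measurable_const) measurable_const)
  have hex : ∀ ω, ∃ j, ∃ᶠ n in atTop, B j ω n := by
    intro ω
    obtain ⟨ψ, hψ, hψA⟩ := extraction_of_frequently_atTop (hA.2 ω)
    obtain ⟨x, -, φ, hφ, hlim⟩ := tendsto_subseq_of_bounded (hb ω) (x := fun n => f (ψ n) ω)
      fun n => mem_range_self (ψ n)
    obtain ⟨j, hj⟩ := (TopologicalSpace.denseRange_denseSeq X).exists_dist_lt x (half_pos hε)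
    refine ⟨j, (hψ.comp hφ).tendsto_atTop.frequently (Eventually.frequently ?_)⟩
    have h : Tendsto (fun n => dist (f (ψ (φ n)) ω) (e j)) atTop (𝓝 (dist x (e j))) :=
      hlim.dist tendsto_const_nhds
    filter_upwards [h.eventually_lt_const hj] with n hn
    exact ⟨hψA _, hn⟩
  refine ⟨fun ω => B (Nat.find (hex ω)) ω, ⟨fun n => ?_, fun ω => Nat.find_spec (hex ω)⟩,
    fun ω n h => h.1, fun ω n m hn hm => ?_⟩
  · have hfind : Measurable fun ω => Nat.find (hex ω) :=
      measurable_find hex fun j => measurableSet_frequently (hBm j)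
    have h : {ω | B (Nat.find (hex ω)) ω n} =
        ⋃ j, {ω | Nat.find (hex ω) = j} ∩ {ω | B j ω n} := by
      ext ω; simp
    rw [h]
    exact MeasurableSet.iUnion fun j => (hfind (measurableSet_singleton j)).inter (hBm j n)
  · calc dist (f n ω) (f m ω) ≤ dist (f n ω) (e (Nat.find (hex ω))) +
          dist (f m ω) (e (Nat.find (hex ω))) := dist_triangle_right _ _ _
      _ < ε := by linarith [hn.2, hm.2]

/-- A bounded sequence of random points of a proper metric space converges along a random
subsequence. -/
lemma exists_random_subsequence [MetricSpace X] [SecondCountableTopology X] [ProperSpace X]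
    [MeasurableSpace X] [BorelSpace X] {f : ℕ → Ω → X} (hf : ∀ n, Measurable (f n))
    (hb : ∀ ω, Bornology.IsBounded (range fun n => f n ω)) :
    ∃ (σ : ℕ → Ω → ℕ) (g : Ω → X), (∀ i, Measurable (σ i)) ∧ Measurable g ∧
      (∀ ω, StrictMono fun i => σ i ω) ∧ ∀ ω, Tendsto (fun i => f (σ i ω) ω) atTop (𝓝 (g ω)) := by
  classical
  have h0 : IsRandomInfinite fun (_ : Ω) (_ : ℕ) => True :=
    ⟨fun n => by simp, fun ω => Frequently.of_forall fun _ => trivial⟩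
  have hstep : ∀ (i : ℕ) (A : {A : Ω → ℕ → Prop // IsRandomInfinite A}),
      ∃ A' : {A : Ω → ℕ → Prop // IsRandomInfinite A}, (∀ ω n, A'.1 ω n → A.1 ω n) ∧
        ∀ ω n m, A'.1 ω n → A'.1 ω m → dist (f n ω) (f m ω) < (1 / 2 : ℝ) ^ i := fun i A => by
    obtain ⟨A', h1, h2, h3⟩ := exists_refinement hf hb A.2 (ε := (1 / 2 : ℝ) ^ i) (by positivity)
    exact ⟨⟨A', h1⟩, h2, h3⟩
  choose next hnext1 hnext2 using hstep
  let A : ℕ → {A : Ω → ℕ → Prop // IsRandomInfinite A} := fun i => Nat.rec ⟨_, h0⟩ next i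
  have hanti : ∀ ω n i j, i ≤ j → (A j).1 ω n → (A i).1 ω n := by
    intro ω n i j hij
    induction hij with
    | refl => exact id
    | step _ ih => exact fun h => ih (hnext1 _ _ _ _ h)
  have hex : ∀ i ω N, ∃ n, N < n ∧ (A i).1 ω n := fun i ω N => by
    obtain ⟨n, hn, h⟩ := frequently_atTop.1 ((A i).2.2 ω) (N + 1)
    exact ⟨n, hn, h⟩
  -- The index σ i is drawn from A (i + 1), whose points lie within (1/2)^i of each other. As the
  -- sets are nested, consecutive points satisfy a geometric Cauchy bound.
  let σ : ℕ → Ω → ℕ := fun i ω => Nat.rec (Nat.find (hex 1 ω 0))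
    (fun i N => Nat.find (hex (i + 2) ω N)) i
  have hσA : ∀ i ω, (A (i + 1)).1 ω (σ i ω) := fun i ω => by
    cases i with
    | zero => exact (Nat.find_spec (hex 1 ω 0)).2
    | succ i => exact (Nat.find_spec (hex (i + 2) ω (σ i ω))).2
  have hσ : ∀ ω, StrictMono fun i => σ i ω := fun ω => strictMono_nat_of_lt_succ fun i => by
    have h := Nat.find_spec (hex (i + 2) ω (σ i ω))
    exact h.1
  have hfm : ∀ i N, Measurable fun ω => Nat.find (hex i ω N) := fun i N =>
    measurable_find _ fun n => (MeasurableSet.const (N < n)).inter ((A i).2.1 n)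
  have hσm : ∀ i, Measurable (σ i) := by
    intro i
    induction i with
    | zero => exact hfm 1 0
    | succ i ih =>
      exact measurable_apply_nat (f := fun N ω => Nat.find (hex (i + 2) ω N)) (hfm (i + 2)) ih
  have hcau : ∀ ω, CauchySeq fun i => f (σ i ω) ω := fun ω => by
    refine cauchySeq_of_le_geometric (1 / 2) 1 (by norm_num) fun i => ?_
    rw [one_mul]
    exact (hnext2 i (A i) ω _ _ (hσA i ω)
      (hanti ω _ (i + 1) (i + 2) (Nat.le_succ _) (hσA (i + 1) ω))).le
  choose g hg using fun ω => cauchySeq_tendsto_of_complete (hcau ω)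
  refine ⟨σ, g, hσm, ?_, hσ, hg⟩
  exact measurable_of_tendsto_metrizable (fun i => measurable_apply_nat hf (hσm i))
    (tendsto_pi_nhds.2 hg)

end RandomSubsequence

/-! ### Measurable projections on the linear span of a random law -/

section Projection

variable {n : ℕ}

/-- The orthogonal projection on the span of `b`, computed by the Gram-Schmidt process. -/
noncomputable def gramProj (b : Fin n → EuclideanSpace ℝ (Fin n)) (v : EuclideanSpace ℝ (Fin n)) :
    EuclideanSpace ℝ (Fin n) :=
  ∑ i, (⟪InnerProductSpace.gramSchmidt ℝ b i, v⟫_ℝ / ‖InnerProductSpace.gramSchmidt ℝ b i‖ ^ 2) •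
    InnerProductSpace.gramSchmidt ℝ b i

lemma gramProj_mem_span (b : Fin n → EuclideanSpace ℝ (Fin n)) (v : EuclideanSpace ℝ (Fin n)) :
    gramProj b v ∈ Submodule.span ℝ (range b) := by
  rw [← InnerProductSpace.span_gramSchmidt]
  exact Submodule.sum_mem _ fun i _ => Submodule.smul_mem _ _ (Submodule.subset_span ⟨i, rfl⟩)

lemma inner_sub_gramProj_eq_zero (b : Fin n → EuclideanSpace ℝ (Fin n))
    (v : EuclideanSpace ℝ (Fin n)) (i : Fin n) : ⟪v - gramProj b v, b i⟫_ℝ = 0 := by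
  have hgs : ∀ j, ⟪v - gramProj b v, InnerProductSpace.gramSchmidt ℝ b j⟫_ℝ = 0 := by
    intro j
    rw [inner_sub_left, gramProj, sum_inner, Finset.sum_eq_single j]
    · rw [real_inner_smul_left, real_inner_self_eq_norm_sq, real_inner_comm]
      by_cases h : InnerProductSpace.gramSchmidt ℝ b j = 0
      · simp [h]
      · have : ‖InnerProductSpace.gramSchmidt ℝ b j‖ ≠ 0 := norm_ne_zero_iff.2 h
        field_simp
        ring
    · intro i _ hij
      rw [real_inner_smul_left, InnerProductSpace.gramSchmidt_orthogonal ℝ b hij, mul_zero]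
    · simp
  have hmem : b i ∈ Submodule.span ℝ (range (InnerProductSpace.gramSchmidt ℝ b)) := by
    rw [InnerProductSpace.span_gramSchmidt]
    exact Submodule.subset_span ⟨i, rfl⟩
  refine Submodule.span_induction (p := fun w _ => ⟪v - gramProj b v, w⟫_ℝ = 0) ?_ (by simp) ?_ ?_ hmem
  · rintro _ ⟨j, rfl⟩; exact hgs j
  · intro x y _ _ hx hy; rw [inner_add_right, hx, hy, add_zero]
  · intro c x _ hx; rw [real_inner_smul_right, hx, mul_zero]

/-- Gram-Schmidt is explicit arithmetic, and division by a zero norm gives 0, so the projection is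
measurable even where the rank of b changes. -/
lemma measurable_gramProj {Ω : Type*} {mΩ : MeasurableSpace Ω}
    {b : Ω → Fin n → EuclideanSpace ℝ (Fin n)} {v : Ω → EuclideanSpace ℝ (Fin n)}
    (hb : ∀ i, Measurable fun ω => b ω i) (hv : Measurable v) :
    Measurable fun ω => gramProj (b ω) (v ω) := by
  have hgs : ∀ i, Measurable fun ω => InnerProductSpace.gramSchmidt ℝ (b ω) i := by
    intro i
    induction i using WellFoundedLT.induction with
    | _ i ih =>
    have h : (fun ω => InnerProductSpace.gramSchmidt ℝ (b ω) i) = fun ω => b ω i -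
        ∑ j ∈ Finset.Iio i, (⟪InnerProductSpace.gramSchmidt ℝ (b ω) j, b ω i⟫_ℝ /
          ‖InnerProductSpace.gramSchmidt ℝ (b ω) j‖ ^ 2) •
          InnerProductSpace.gramSchmidt ℝ (b ω) j := by
      ext1 ω
      exact eq_sub_of_add_eq (InnerProductSpace.gramSchmidt_def'' ℝ (b ω) i).symm
    rw [h]
    refine (hb i).sub (Finset.measurable_fun_sum _ fun j hj => ?_)
    have := ih j (Finset.mem_Iio.1 hj)
    exact (((this.inner (hb i)).div (this.norm.pow_const 2))).smul this
  refine Finset.measurable_fun_sum _ fun i _ => ?_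
  exact ((((hgs i).inner hv).div ((hgs i).norm.pow_const 2))).smul (hgs i)

/-- `v` is orthogonal to all vectors that are orthogonal to the random vector `y`; in other words
`v` lies in the linear span of the support of the law of `y`. -/
def InEssSpan {E : Type*} [MeasurableSpace E] (Q : Measure E) (y : E → EuclideanSpace ℝ (Fin n))
    (v : EuclideanSpace ℝ (Fin n)) : Prop :=
  ∀ u, (∀ᵐ e ∂Q, ⟪u, y e⟫_ℝ = 0) → ⟪u, v⟫_ℝ = 0

lemma isClosed_inEssSpan {E : Type*} [MeasurableSpace E] (Q : Measure E)
    (y : E → EuclideanSpace ℝ (Fin n)) : IsClosed {v | InEssSpan Q y v} := by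
  have h : {v | InEssSpan Q y v} =
      ⋂ (u) (_ : ∀ᵐ e ∂Q, ⟪u, y e⟫_ℝ = 0), {v | ⟪u, v⟫_ℝ = 0} := by
    ext v
    simp only [mem_iInter, mem_ofPred_eq]
    rfl
  rw [h]
  exact isClosed_iInter fun u => isClosed_iInter fun _ =>
    isClosed_eq (by fun_prop) continuous_const

lemma InEssSpan.smul {E : Type*} [MeasurableSpace E] {Q : Measure E}
    {y : E → EuclideanSpace ℝ (Fin n)} {v : EuclideanSpace ℝ (Fin n)} (h : InEssSpan Q y v)
    (c : ℝ) : InEssSpan Q y (c • v) := fun u hu => by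
  rw [real_inner_smul_right, h u hu, mul_zero]

/-- The weighted second moment matrix applied to a basis vector. -/
noncomputable def momentVec {E : Type*} [MeasurableSpace E] (Q : Measure E)
    (y : E → EuclideanSpace ℝ (Fin n)) (i : Fin n) : EuclideanSpace ℝ (Fin n) :=
  ∫ e, (y e i / (1 + ‖y e‖ ^ 2)) • y e ∂Q

section

variable {E : Type*} [MeasurableSpace E] {Q : Measure E} [IsFiniteMeasure Q]
  {y : E → EuclideanSpace ℝ (Fin n)}

/-- The weight 1 / (1 + ‖y‖²) bounds the integrand by 1, so no moments of y are needed. -/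
lemma integrable_momentVec (hy : Measurable y) (i : Fin n) :
    Integrable (fun e => (y e i / (1 + ‖y e‖ ^ 2)) • y e) Q := by
  refine (integrable_const (1 : ℝ)).mono' ?_ (Eventually.of_forall fun e => ?_)
  · have : Measurable fun e => (y e i / (1 + ‖y e‖ ^ 2)) • y e := by fun_prop
    exact this.aestronglyMeasurable
  · have h1 : ‖y e i‖ ≤ ‖y e‖ := PiLp.norm_apply_le (y e) i
    have h2 : (0 : ℝ) < 1 + ‖y e‖ ^ 2 := by positivity
    rw [norm_smul, norm_div, Real.norm_of_nonneg h2.le, div_mul_eq_mul_div, div_le_one h2]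
    nlinarith [norm_nonneg (y e)]

lemma inner_momentVec (hy : Measurable y) (u : EuclideanSpace ℝ (Fin n)) (i : Fin n) :
    ⟪u, momentVec Q y i⟫_ℝ = ∫ e, (y e i / (1 + ‖y e‖ ^ 2)) * ⟪u, y e⟫_ℝ ∂Q := by
  rw [momentVec, ← integral_inner (integrable_momentVec hy i)]
  simp_rw [real_inner_smul_right]

/-- Pairing the weighted second moment matrix twice with u gives the integral of ⟪u, y⟫² / (1 +
‖y‖²), which therefore vanishes. -/
lemma ae_inner_eq_zero_of_momentVec (hy : Measurable y) {u : EuclideanSpace ℝ (Fin n)}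
    (hu : ∀ i, ⟪u, momentVec Q y i⟫_ℝ = 0) : ∀ᵐ e ∂Q, ⟪u, y e⟫_ℝ = 0 := by
  have hint : ∀ i, Integrable (fun e => (y e i / (1 + ‖y e‖ ^ 2)) * ⟪u, y e⟫_ℝ) Q := fun i => by
    have := (integrable_momentVec (Q := Q) hy i).const_inner (𝕜 := ℝ) u
    simpa only [real_inner_smul_right] using this
  have hsum : ∀ e, ∑ i, u i * ((y e i / (1 + ‖y e‖ ^ 2)) * ⟪u, y e⟫_ℝ) =
      ⟪u, y e⟫_ℝ ^ 2 / (1 + ‖y e‖ ^ 2) := fun e => by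
    have h : ⟪u, y e⟫_ℝ = ∑ i, u i * y e i := by
      rw [PiLp.inner_apply]
      exact Finset.sum_congr rfl fun i _ => by simp [mul_comm]
    calc ∑ i, u i * ((y e i / (1 + ‖y e‖ ^ 2)) * ⟪u, y e⟫_ℝ)
        = ∑ i, (u i * y e i) * (⟪u, y e⟫_ℝ / (1 + ‖y e‖ ^ 2)) :=
          Finset.sum_congr rfl fun i _ => by ring
      _ = ⟪u, y e⟫_ℝ ^ 2 / (1 + ‖y e‖ ^ 2) := by rw [← Finset.sum_mul, ← h]; ring
  have hzero : ∫ e, ⟪u, y e⟫_ℝ ^ 2 / (1 + ‖y e‖ ^ 2) ∂Q = 0 := by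
    simp_rw [← hsum]
    rw [integral_finsetSum _ fun i _ => (hint i).const_mul _]
    refine Finset.sum_eq_zero fun i _ => ?_
    rw [integral_const_mul, ← inner_momentVec hy, hu, mul_zero]
  have hi : Integrable (fun e => ⟪u, y e⟫_ℝ ^ 2 / (1 + ‖y e‖ ^ 2)) Q := by
    simp_rw [← hsum]
    exact integrable_finsetSum _ fun i _ => (hint i).const_mul _
  rw [integral_eq_zero_iff_of_nonneg (fun e => by positivity) hi] at hzero
  filter_upwards [hzero] with e he
  have h2 : (0 : ℝ) < 1 + ‖y e‖ ^ 2 := by positivity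
  simpa [h2.ne'] using he

lemma inEssSpan_of_mem_span_momentVec (hy : Measurable y) {v : EuclideanSpace ℝ (Fin n)}
    (hv : v ∈ Submodule.span ℝ (range (momentVec Q y))) : InEssSpan Q y v := by
  intro u hu
  refine Submodule.span_induction (p := fun w _ => ⟪u, w⟫_ℝ = 0) ?_ (by simp) ?_ ?_ hv
  · rintro _ ⟨i, rfl⟩
    rw [inner_momentVec hy]
    refine integral_eq_zero_of_ae ?_
    filter_upwards [hu] with e he
    simp [he]
  · intro x y _ _ hx hy; rw [inner_add_right, hx, hy, add_zero]
  · intro c x _ hx; rw [real_inner_smul_right, hx, mul_zero]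

end

/-- A random vector can be projected measurably on the linear span of the support of a random
law. -/
lemma exists_measurable_projection {Ω E : Type*} {mΩ : MeasurableSpace Ω} [MeasurableSpace E]
    (κ : Kernel Ω E) [IsMarkovKernel κ] {y : E → EuclideanSpace ℝ (Fin n)} (hy : Measurable y)
    {v : Ω → EuclideanSpace ℝ (Fin n)} (hv : Measurable v) :
    ∃ p : Ω → EuclideanSpace ℝ (Fin n), Measurable p ∧ (∀ ω, InEssSpan (κ ω) y (p ω)) ∧
      ∀ ω, ∀ᵐ e ∂κ ω, ⟪v ω - p ω, y e⟫_ℝ = 0 := by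
  refine ⟨fun ω => gramProj (momentVec (κ ω) y) (v ω), measurable_gramProj (fun i => ?_) hv,
    fun ω => inEssSpan_of_mem_span_momentVec hy (gramProj_mem_span _ _),
    fun ω => ae_inner_eq_zero_of_momentVec hy (inner_sub_gramProj_eq_zero _ _)⟩
  have hm : Measurable fun e => (y e i / (1 + ‖y e‖ ^ 2)) • y e := by fun_prop
  exact (StronglyMeasurable.integral_kernel_prod_right' (κ := κ)
    (hm.stronglyMeasurable.comp_measurable measurable_snd)).measurable

/-- If `(1, 0)` lies in the linear span of the law of `(1, y)`, then the affine span of the support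
of the law of `y` is its linear span. -/
lemma mem_affineSpan_support {ν : Measure (EuclideanSpace ℝ (Fin n))} [IsProbabilityMeasure ν]
    (h1 : InEssSpan ν (fun y => (WithLp.toLp 2 (Fin.cons 1 y.ofLp) : EuclideanSpace ℝ (Fin (n + 1))))
      (EuclideanSpace.single 0 1)) {v : EuclideanSpace ℝ (Fin n)} (hv : InEssSpan ν id v) :
    v ∈ affineSpan ℝ ν.support := by
  have hsupp : ∀ᵐ y ∂ν, y ∈ ν.support := Measure.support_mem_ae
  have hne : ν.support.Nonempty := Measure.nonempty_support (IsProbabilityMeasure.ne_zero ν)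
  have hnaff : Nonempty (affineSpan ℝ ν.support) := ((affineSpan_nonempty ℝ).2 hne).to_subtype
  -- Let m be the point of the affine span nearest to 0. Then ⟪m, y⟫ = ‖m‖² on the support, so
  -- (-‖m‖², m) is orthogonal to (1, y), hence by assumption to (1, 0), and m = 0.
  have hzero : (0 : EuclideanSpace ℝ (Fin n)) ∈ affineSpan ℝ ν.support := by
    set m : EuclideanSpace ℝ (Fin n) :=
      (EuclideanGeometry.orthogonalProjection (affineSpan ℝ ν.support) 0 :) with hm
    have hmem : m ∈ affineSpan ℝ ν.support := EuclideanGeometry.orthogonalProjection_mem _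
    have horth : ∀ y ∈ ν.support, ⟪m, y⟫_ℝ = ‖m‖ ^ 2 := fun y hy => by
      have hd : y -ᵥ m ∈ (affineSpan ℝ ν.support).direction :=
        AffineSubspace.vsub_mem_direction (subset_affineSpan ℝ _ hy) hmem
      have := EuclideanGeometry.vsub_orthogonalProjection_mem_direction_orthogonal
        (affineSpan ℝ ν.support) (0 : EuclideanSpace ℝ (Fin n))
      have h2 := (Submodule.mem_orthogonal _ _).1 this _ hd
      rw [← hm, vsub_eq_sub, vsub_eq_sub, zero_sub, inner_neg_right, inner_sub_left,
        real_inner_self_eq_norm_sq, real_inner_comm] at h2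
      linarith
    have h2 := h1 (WithLp.toLp 2 (Fin.cons (-‖m‖ ^ 2) m.ofLp)) (by
      filter_upwards [hsupp] with y hy
      have h3 := horth y hy
      rw [PiLp.inner_apply] at h3 ⊢
      simp only [Fin.sum_univ_succ, Fin.cons_zero, Fin.cons_succ]
      rw [h3]
      simp)
    have h4 : m = 0 := by
      rw [PiLp.inner_apply] at h2
      simpa [Fin.sum_univ_succ] using h2
    rwa [h4] at hmem
  have hspan : v ∈ Submodule.span ℝ ν.support := by
    rw [← Submodule.orthogonal_orthogonal (Submodule.span ℝ ν.support)]
    refine (Submodule.mem_orthogonal _ _).2 fun u hu => hv u ?_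
    filter_upwards [hsupp] with y hy
    rw [real_inner_comm]
    exact (Submodule.mem_orthogonal _ _).1 hu y (Submodule.subset_span hy)
  rw [← affineSpan_insert_eq_affineSpan ℝ hzero, ← SetLike.mem_coe, affineSpan_insert_zero]
  exact hspan

/-- A vector that is orthogonal to the increment vanishes on the affine span of the support. -/
lemma inner_eq_zero_of_mem_affineSpan_support {ν : Measure (EuclideanSpace ℝ (Fin n))}
    {u v : EuclideanSpace ℝ (Fin n)} (hu : ∀ᵐ y ∂ν, ⟪u, y⟫_ℝ = 0)
    (hv : v ∈ affineSpan ℝ ν.support) : ⟪u, v⟫_ℝ = 0 := by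
  have hsub : ν.support ⊆ {y | ⟪u, y⟫_ℝ = 0} :=
    Measure.support_subset_of_isClosed (isClosed_eq (by fun_prop) continuous_const) hu
  have hspan : v ∈ Submodule.span ℝ ν.support := affineSpan_subset_span hv
  refine Submodule.span_induction (p := fun w _ => ⟪u, w⟫_ℝ = 0) hsub (by simp) ?_ ?_ hspan
  · intro x y _ _ hx hy; rw [inner_add_right, hx, hy, add_zero]
  · intro c x _ hx; rw [real_inner_smul_right, hx, mul_zero]

end Projection

/-! ### Generalized expectations of real functions -/

section GExp

variable {E : Type*} [MeasurableSpace E] {Q : Measure E} {f : E → ℝ}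

lemma gExp_coe (Q : Measure E) (f : E → ℝ) : gExp Q (fun e => ((f e : ℝ) : EReal)) =
    ((∫⁻ e, ENNReal.ofReal (f e) ∂Q : ℝ≥0∞) : EReal)
      - ((∫⁻ e, ENNReal.ofReal (-f e) ∂Q : ℝ≥0∞) : EReal) := rfl

lemma coe_toReal_sub {p q : ℝ≥0∞} (hp : p ≠ ⊤) (hq : q ≠ ⊤) :
    ((p : EReal) - (q : EReal)) = ((p.toReal - q.toReal : ℝ) : EReal) := by
  rw [EReal.coe_sub, EReal.coe_ennreal_toReal hp, EReal.coe_ennreal_toReal hq]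

lemma lintegral_ofReal_ne_top (hf : Integrable f Q) : ∫⁻ e, ENNReal.ofReal (f e) ∂Q ≠ ⊤ :=
  (hf.lintegral_lt_top).ne

lemma gExp_of_integrable (hf : Integrable f Q) :
    gExp Q (fun e => ((f e : ℝ) : EReal)) = ((∫ e, f e ∂Q : ℝ) : EReal) := by
  rw [gExp_coe, coe_toReal_sub (lintegral_ofReal_ne_top hf)
    (lintegral_ofReal_ne_top (f := fun e => -f e) hf.neg), integral_eq_lintegral_pos_part_sub_lintegral_neg_part hf]

lemma integrable_of_lintegral_ofReal (hf : AEStronglyMeasurable f Q)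
    (hp : ∫⁻ e, ENNReal.ofReal (f e) ∂Q ≠ ⊤) (hn : ∫⁻ e, ENNReal.ofReal (-f e) ∂Q ≠ ⊤) :
    Integrable f Q := by
  refine ⟨hf, ?_⟩
  have h : ∀ e, ‖f e‖ₑ = ENNReal.ofReal (f e) + ENNReal.ofReal (-f e) := fun e => by
    rw [← ofReal_norm, Real.norm_eq_abs]
    rcases le_total 0 (f e) with h | h
    · rw [abs_of_nonneg h, ENNReal.ofReal_of_nonpos (neg_nonpos.2 h), add_zero]
    · rw [abs_of_nonpos h, ENNReal.ofReal_of_nonpos h, zero_add]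
  rw [hasFiniteIntegral_iff_enorm]
  simp_rw [h]
  rw [lintegral_add_left' hf.aemeasurable.ennreal_ofReal]
  exact ENNReal.add_lt_top.2 ⟨hp.lt_top, hn.lt_top⟩

/-- A generalized expectation that is bounded from below, of a function with finite positive part,
is an ordinary expectation. -/
lemma integrable_and_le_of_le_gExp (hf : AEStronglyMeasurable f Q)
    (hp : ∫⁻ e, ENNReal.ofReal (f e) ∂Q < ⊤) {z : ℝ}
    (hz : (z : EReal) ≤ gExp Q (fun e => ((f e : ℝ) : EReal))) :
    Integrable f Q ∧ z ≤ ∫ e, f e ∂Q := by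
  have hn : ∫⁻ e, ENNReal.ofReal (-f e) ∂Q ≠ ⊤ := by
    intro hn
    rw [gExp_coe, hn, EReal.coe_ennreal_top] at hz
    simp at hz
  have hi := integrable_of_lintegral_ofReal hf hp.ne hn
  exact ⟨hi, by rwa [gExp_of_integrable hi, EReal.coe_le_coe_iff] at hz⟩

/-- In `EReal` the difference ⊤ - ⊤ is ⊥, so an upper bound on p - q bounds p only when the
difference is well defined. -/
lemma lt_top_of_coe_sub_lt_top {p q : ℝ≥0∞} (h : p < ⊤ ∨ q < ⊤)
    (hlt : (p : EReal) - (q : EReal) < ⊤) : p < ⊤ := by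
  by_contra hp
  rw [not_lt, top_le_iff] at hp
  have hq : q < ⊤ := h.resolve_left (by simp [hp])
  rw [hp, EReal.coe_ennreal_top, ← EReal.coe_ennreal_toReal hq.ne, EReal.top_sub_coe] at hlt
  exact lt_irrefl _ hlt

/-- A cross-multiplied form of `p - q ≤ r - s`. -/
lemma coe_sub_le_coe_sub {p q r s : ℝ≥0∞} (hq : q ≠ ⊤) (hs : s ≠ ⊤) (h : p + s ≤ r + q) :
    (p : EReal) - (q : EReal) ≤ (r : EReal) - (s : EReal) := by
  rcases eq_or_ne r ⊤ with rfl | hr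
  · rw [EReal.coe_ennreal_top, ← EReal.coe_ennreal_toReal hs, EReal.top_sub_coe]
    exact le_top
  · have hp : p ≠ ⊤ := fun hp => by
      rw [hp, top_add, top_le_iff, ENNReal.add_eq_top] at h
      exact h.elim hr hq
    rw [coe_toReal_sub hp hq, coe_toReal_sub hr hs, EReal.coe_le_coe_iff]
    have := ENNReal.toReal_mono (ENNReal.add_ne_top.2 ⟨hr, hq⟩) h
    rw [ENNReal.toReal_add hp hs, ENNReal.toReal_add hr hq] at this
    linarith

end GExp

/-! ### Regular conditional laws -/

section CondLaw

variable {Ω E : Type*} {m mΩ : MeasurableSpace Ω} [mE : MeasurableSpace E] {P : Measure[mΩ] Ω}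
  {Θ : Ω → E} {κ : Kernel[m] Ω E}

/-- `κ` is a regular conditional law of `Θ` given the sub-σ-algebra `m`. -/
structure IsCondLaw (m : MeasurableSpace Ω) {mΩ : MeasurableSpace Ω} (P : Measure[mΩ] Ω)
    (Θ : Ω → E) (κ : Kernel[m] Ω E) : Prop where
  le : m ≤ mΩ
  measurable : Measurable[mΩ] Θ
  lintegral_eq : ∀ g : Ω × E → ℝ≥0∞, Measurable[m.prod mE] g →
    ∫⁻ ω, g (ω, Θ ω) ∂P = ∫⁻ ω, ∫⁻ e, g (ω, e) ∂κ ω ∂P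

lemma measurable_graph (hm : m ≤ mΩ) (hΘ : Measurable[mΩ] Θ) :
    @Measurable Ω (Ω × E) mΩ (m.prod mE) fun ω => (ω, Θ ω) :=
  Measurable.prodMk (measurable_id'' hm) hΘ

/-- Conditioning on m is conditioning on the identity from (Ω, mΩ) to (Ω, m); the claim is the
disintegration of the joint law of the identity and Θ. -/
lemma isCondLaw_condDistrib [StandardBorelSpace E] [Nonempty E] [IsFiniteMeasure P] (hm : m ≤ mΩ)
    (hΘ : Measurable[mΩ] Θ) :
    IsCondLaw m P Θ (@condDistrib Ω Ω E _ _ _ mΩ m Θ id P _) := by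
  refine ⟨hm, hΘ, fun g hg => ?_⟩
  have hid : @Measurable Ω Ω mΩ m id := measurable_id'' hm
  have h := @compProd_map_condDistrib Ω Ω E _ _ _ mΩ P _ id Θ m hΘ.aemeasurable
  have h1 : ∫⁻ ω, g (ω, Θ ω) ∂P =
      @lintegral _ (m.prod mE) (@Measure.map _ _ mΩ (m.prod mE) (fun ω => (id ω, Θ ω)) P) g :=
    (@lintegral_map _ _ mΩ (m.prod mE) _ g _ hg (measurable_graph hm hΘ)).symm
  rw [h1, ← h, @Measure.lintegral_compProd Ω E m mE _ _ inferInstance inferInstance g hg]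
  exact @lintegral_map _ _ mΩ m P _ id
    (@Measurable.lintegral_kernel_prod_right' Ω E m mE _ inferInstance g hg) hid

variable [IsSFiniteKernel κ]

/-- The disintegration of the indicator of the complement: one side is null iff the other is. It
moves almost sure statements between the market and the conditional laws. -/
lemma IsCondLaw.ae_iff (h : IsCondLaw m P Θ κ) {B : Set (Ω × E)}
    (hB : MeasurableSet[m.prod mE] B) :
    (∀ᵐ ω ∂P, (ω, Θ ω) ∈ B) ↔ ∀ᵐ ω ∂P, ∀ᵐ e ∂κ ω, (ω, e) ∈ B := by
  have hBc : MeasurableSet[m.prod mE] Bᶜ := hB.compl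
  have hg : Measurable[m.prod mE] (Bᶜ.indicator fun _ => (1 : ℝ≥0∞)) :=
    Measurable.indicator (@measurable_const _ _ _ (m.prod mE) _) hBc
  have hm1 : Measurable[m] fun ω => ∫⁻ e, Bᶜ.indicator (fun _ => (1 : ℝ≥0∞)) (ω, e) ∂κ ω :=
    hg.lintegral_kernel_prod_right'
  have hm2 : Measurable[mΩ] fun ω => Bᶜ.indicator (fun _ => (1 : ℝ≥0∞)) (ω, Θ ω) :=
    hg.comp (measurable_graph h.le h.measurable)
  have h2 : (∀ᵐ ω ∂P, (ω, Θ ω) ∈ B) ↔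
      ∫⁻ ω, Bᶜ.indicator (fun _ => (1 : ℝ≥0∞)) (ω, Θ ω) ∂P = 0 := by
    rw [lintegral_eq_zero_iff hm2]
    refine eventually_congr (Eventually.of_forall fun ω => ?_)
    by_cases hω : (ω, Θ ω) ∈ B <;> simp [hω]
  rw [h2, h.lintegral_eq _ hg, lintegral_eq_zero_iff (hm1.mono h.le le_rfl)]
  refine eventually_congr (Eventually.of_forall fun ω => ?_)
  have hs : Measurable fun e => Bᶜ.indicator (fun _ => (1 : ℝ≥0∞)) (ω, e) :=
    hg.comp (@measurable_prodMk_left Ω E m mE ω)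
  rw [Pi.zero_apply, lintegral_eq_zero_iff hs]
  refine eventually_congr (Eventually.of_forall fun e => ?_)
  by_cases hω : (ω, e) ∈ B <;> simp [hω]

lemma IsCondLaw.condLExp_ae_eq [IsFiniteMeasure P] (h : IsCondLaw m P Θ κ)
    {g : Ω × E → ℝ≥0∞} (hg : Measurable[m.prod mE] g) :
    condLExp m P (fun ω => g (ω, Θ ω)) =ᵐ[P] fun ω => ∫⁻ e, g (ω, e) ∂κ ω := by
  refine (ae_eq_condLExp h.le P _ hg.lintegral_kernel_prod_right' fun s hs => ?_).symm
  have hs' : MeasurableSet[m.prod mE] (Prod.fst ⁻¹' s : Set (Ω × E)) :=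
    (@measurable_fst Ω E m mE) hs
  have h1 := h.lintegral_eq _ (hg.indicator hs')
  rw [← lintegral_indicator (h.le s hs), ← lintegral_indicator (h.le s hs)]
  convert h1.symm using 3 with ω ω
  · by_cases hω : ω ∈ s <;> simp [hω, indicator]
  · by_cases hω : ω ∈ s <;> simp [hω, indicator]

/-- The generalized conditional expectation is the expectation under the conditional law. -/
lemma IsCondLaw.gCondExp_ae_eq [IsFiniteMeasure P] (h : IsCondLaw m P Θ κ)
    {f : Ω × E → ℝ} (hf : Measurable[m.prod mE] f) {X : Ω → EReal}
    (hX : ∀ᵐ ω ∂P, X ω = ((f (ω, Θ ω) : ℝ) : EReal)) :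
    (condLExp m P (positivePart X) =ᵐ[P] fun ω => ∫⁻ e, ENNReal.ofReal (f (ω, e)) ∂κ ω) ∧
      gCondExp m P X =ᵐ[P] fun ω => gExp (κ ω) (fun e => ((f (ω, e) : ℝ) : EReal)) := by
  have hp : condLExp m P (positivePart X) =ᵐ[P] fun ω => ∫⁻ e, ENNReal.ofReal (f (ω, e)) ∂κ ω :=
    (condLExp_congr_ae (by
      filter_upwards [hX] with ω hω
      simp [positivePart, hω])).trans (h.condLExp_ae_eq hf.ennreal_ofReal)
  have hn : condLExp m P (negativePart X) =ᵐ[P] fun ω => ∫⁻ e, ENNReal.ofReal (-f (ω, e)) ∂κ ω :=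
    (condLExp_congr_ae (by
      filter_upwards [hX] with ω hω
      simp [negativePart, hω, ← EReal.coe_neg])).trans (h.condLExp_ae_eq hf.neg.ennreal_ofReal)
  refine ⟨hp, ?_⟩
  filter_upwards [hp, hn] with ω h1 h2
  rw [gCondExp, h1, h2, gExp_coe]

end CondLaw

/-! ### The one-period problem given the past -/

section OneStep

variable {Ω : Type*} {m mΩ : MeasurableSpace Ω} {P : Measure[mΩ] Ω} {d : ℕ}

/-- Utility of the position `ξ` and endowment `x`, when the increment is `z.1` and the utility path
is the extension of `z.2`. -/
noncomputable def posUtil (x : ℝ) (ξ : EuclideanSpace ℝ (Fin d))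
    (z : EuclideanSpace ℝ (Fin d) × (ℚ → ℝ)) : ℝ :=
  ratExt z.2 (x + ⟪ξ, z.1⟫_ℝ)

lemma measurable_posUtil {m : MeasurableSpace Ω} {H : Ω → ℝ} {ξ : Ω → EuclideanSpace ℝ (Fin d)}
    (hH : Measurable[m] H) (hξ : Measurable[m] ξ) :
    Measurable fun z : Ω × (EuclideanSpace ℝ (Fin d) × (ℚ → ℝ)) =>
      posUtil (H z.1) (ξ z.1) z.2 := by
  have h1 : Measurable fun z : Ω × (EuclideanSpace ℝ (Fin d) × (ℚ → ℝ)) => H z.1 :=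
    hH.comp measurable_fst
  have h2 : Measurable fun z : Ω × (EuclideanSpace ℝ (Fin d) × (ℚ → ℝ)) => ξ z.1 :=
    hξ.comp measurable_fst
  have h3 : Measurable fun z : Ω × (EuclideanSpace ℝ (Fin d) × (ℚ → ℝ)) => z.2.1 :=
    measurable_fst.comp measurable_snd
  have h4 : Measurable fun z : Ω × (EuclideanSpace ℝ (Fin d) × (ℚ → ℝ)) => z.2.2 :=
    measurable_snd.comp measurable_snd
  exact measurable_ratExt.comp (h4.prodMk (h1.add (h2.inner h3)))

lemma measurableSet_ereal_lt {m : MeasurableSpace Ω} {f g : Ω → EReal} (hf : Measurable[m] f)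
    (hg : Measurable[m] g) : MeasurableSet {ω | f ω < g ω} :=
  measurableSet_lt hf hg

lemma measurable_gExp_kernel {E : Type*} [mE : MeasurableSpace E] {m : MeasurableSpace Ω}
    {κ : Kernel[m] Ω E} [IsSFiniteKernel κ] {f : Ω × E → ℝ} (hf : Measurable f) :
    Measurable fun ω => gExp (κ ω) (fun e => ((f (ω, e) : ℝ) : EReal)) := by
  simp_rw [gExp_coe]
  exact (hf.ennreal_ofReal.lintegral_kernel_prod_right'.coe_ereal_ennreal).sub
    (hf.neg.ennreal_ofReal.lintegral_kernel_prod_right'.coe_ereal_ennreal)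

/-- The first index at which p holds. Admitting the alternative that p never holds makes the search
end at every ω. -/
lemma exists_measurable_index {m : MeasurableSpace Ω} {p : Ω → ℕ → Prop}
    (hp : ∀ i, MeasurableSet {ω | p ω i}) :
    ∃ τ : Ω → ℕ, Measurable τ ∧ ∀ ω, (∃ i, p ω i) → p ω (τ ω) := by
  classical
  have hex : ∀ ω, ∃ i, p ω i ∨ ∀ j, ¬ p ω j := fun ω => by
    by_cases hω : ∃ i, p ω i
    · exact ⟨hω.choose, Or.inl hω.choose_spec⟩
    · exact ⟨0, Or.inr (not_exists.1 hω)⟩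
  refine ⟨fun ω => Nat.find (hex ω), measurable_find _ fun i => (hp i).union ?_, fun ω hω => ?_⟩
  · have : {ω | ∀ j, ¬ p ω j} = ⋂ j, {ω | p ω j}ᶜ := by ext ω; simp
    change MeasurableSet {ω | ∀ j, ¬ p ω j}
    rw [this]
    exact MeasurableSet.iInter fun j => (hp j).compl
  · exact (Nat.find_spec (hex ω)).resolve_right fun h => hω.elim h

lemma measurableSet_forall_exists {m : MeasurableSpace Ω} {p : ℕ → ℕ → Ω → Prop}
    (hp : ∀ N n, MeasurableSet {ω | p N n ω}) : MeasurableSet {ω | ∀ N, ∃ n, p N n ω} := by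
  have : {ω | ∀ N, ∃ n, p N n ω} = ⋂ N, ⋃ n, {ω | p N n ω} := by ext ω; simp
  rw [this]
  exact MeasurableSet.iInter fun N => MeasurableSet.iUnion fun n => hp N n

lemma measurable_normalize {m : MeasurableSpace Ω} {ξ : Ω → EuclideanSpace ℝ (Fin d)}
    (hξ : Measurable ξ) : Measurable fun ω => ‖ξ ω‖⁻¹ • ξ ω :=
  hξ.norm.inv.smul hξ

/-- The data of a one-period problem: `κ` is the conditional law of the increment `Y` and the
utility path `e`, `ν` is the conditional law of the increment, there is no arbitrage, and the
conditional laws are regular. -/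
structure IsOneStep (m : MeasurableSpace Ω) {mΩ : MeasurableSpace Ω} (P : Measure[mΩ] Ω)
    (U : ℝ → ℝ) (a k C : ℝ) (Y : Ω → EuclideanSpace ℝ (Fin d)) (e : Ω → ℚ → ℝ)
    (κ : Kernel[m] Ω (EuclideanSpace ℝ (Fin d) × (ℚ → ℝ)))
    (ν : Kernel[m] Ω (EuclideanSpace ℝ (Fin d))) : Prop where
  law : IsCondLaw m P (fun ω => (Y ω, e ω)) κ
  lawY : IsCondLaw m P Y ν
  noArb : ∀ ξ : Ω → EuclideanSpace ℝ (Fin d), Measurable[m] ξ → (∀ᵐ ω ∂P, 0 ≤ ⟪ξ ω, Y ω⟫_ℝ) →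
    ∀ᵐ ω ∂P, ⟪ξ ω, Y ω⟫_ℝ = 0
  regular : ∀ᵐ ω ∂P, IsRegularLaw U a k C (κ ω) Prod.fst (fun z x => ratExt z.2 x)
  continuous : Continuous U
  zero : U 0 = 0
  k_pos : 0 < k
  half_le : 1 / 2 ≤ a + k

variable {U : ℝ → ℝ} {a k C : ℝ} {Y : Ω → EuclideanSpace ℝ (Fin d)} {e : Ω → ℚ → ℝ}
  {κ : Kernel[m] Ω (EuclideanSpace ℝ (Fin d) × (ℚ → ℝ))}
  {ν : Kernel[m] Ω (EuclideanSpace ℝ (Fin d))} [IsMarkovKernel κ] [IsMarkovKernel ν]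

lemma measurableSet_inner_fst {m : MeasurableSpace Ω} {E : Type*} [MeasurableSpace E]
    {ξ : Ω → EuclideanSpace ℝ (Fin d)} (hξ : Measurable[m] ξ)
    {y : E → EuclideanSpace ℝ (Fin d)} (hy : Measurable y) {s : Set ℝ} (hs : MeasurableSet s) :
    MeasurableSet {z : Ω × E | ⟪ξ z.1, y z.2⟫_ℝ ∈ s} :=
  ((hξ.comp measurable_fst).inner (hy.comp measurable_snd)) hs

/-- Predictable positions along which the increment is orthogonal vanish on the essential span. -/
lemma IsOneStep.eq_zero_of_nonneg (h : IsOneStep m P U a k C Y e κ ν)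
    {η : Ω → EuclideanSpace ℝ (Fin d)} (hη : Measurable[m] η)
    (hspan : ∀ᵐ ω ∂P, InEssSpan (ν ω) id (η ω))
    (hpos : ∀ᵐ ω ∂P, ∀ᵐ z ∂κ ω, 0 ≤ ⟪η ω, z.1⟫_ℝ) : ∀ᵐ ω ∂P, η ω = 0 := by
  have h1 : ∀ᵐ ω ∂P, 0 ≤ ⟪η ω, Y ω⟫_ℝ :=
    (h.law.ae_iff (measurableSet_inner_fst hη measurable_fst measurableSet_Ici)).2 hpos
  have h2 := (h.lawY.ae_iff (measurableSet_inner_fst hη measurable_id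
    (measurableSet_singleton 0))).1 (h.noArb η hη h1)
  filter_upwards [h2, hspan] with ω h3 h4
  -- The direction η ω serves as its own test vector in `InEssSpan`.
  exact inner_self_eq_zero.1 (h4 (η ω) h3)

/-- Compactness: a sequence of positions in the essential span, whose conditional expected
utilities are bounded from below by a convergent sequence, can be replaced by a single position. -/
lemma IsOneStep.exists_limit (h : IsOneStep m P U a k C Y e κ ν) {H : Ω → ℝ}
    {ξ : ℕ → Ω → EuclideanSpace ℝ (Fin d)} (hξ : ∀ n, Measurable[m] (ξ n))
    (hspan : ∀ n, ∀ᵐ ω ∂P, InEssSpan (ν ω) id (ξ n ω)) {z : ℕ → Ω → ℝ} {z₀ : Ω → ℝ}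
    (hz : ∀ᵐ ω ∂P, Tendsto (fun n => z n ω) atTop (𝓝 (z₀ ω)))
    (hle : ∀ n, ∀ᵐ ω ∂P, Integrable (posUtil (H ω) (ξ n ω)) (κ ω) ∧
      z n ω ≤ ∫ e, posUtil (H ω) (ξ n ω) e ∂κ ω) :
    ∃ ξ₀ : Ω → EuclideanSpace ℝ (Fin d), Measurable[m] ξ₀ ∧
      (∀ᵐ ω ∂P, InEssSpan (ν ω) id (ξ₀ ω)) ∧
      ∀ᵐ ω ∂P, Integrable (posUtil (H ω) (ξ₀ ω)) (κ ω) ∧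
        z₀ ω ≤ ∫ e, posUtil (H ω) (ξ₀ ω) e ∂κ ω := by
  classical
  have hspan' := ae_all_iff.2 hspan
  have hle' := ae_all_iff.2 hle
  set A : Set Ω := {ω | ∀ N : ℕ, ∃ n, (N : ℝ) ≤ ‖ξ n ω‖} with hA
  have hnm : ∀ (N : ℕ) n, MeasurableSet[m] {ω | (N : ℝ) ≤ ‖ξ n ω‖} := fun N n =>
    (measurable_norm.comp (hξ n)) measurableSet_Ici
  have hAm : MeasurableSet[m] A := measurableSet_forall_exists hnm
  -- On A the positions are unbounded. Their normalized directions converge along a random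
  -- subsequence to a unit vector that never loses money and lies in the essential span, which no
  -- arbitrage excludes.
  have hAnull : ∀ᵐ ω ∂P, ω ∉ A := by
    choose τ hτ hτs using fun N : ℕ => exists_measurable_index (hnm N)
    have hτA : ∀ (N : ℕ) ω, ω ∈ A → (N : ℝ) ≤ ‖ξ (τ N ω) ω‖ := fun N ω hω => hτs N ω (hω N)
    have hζ : ∀ N, Measurable[m] fun ω => ξ (τ N ω) ω := fun N => measurable_apply_nat hξ (hτ N)
    obtain ⟨σ, η, -, hη, hσ, hlim⟩ := exists_random_subsequence
      (f := fun N ω => ‖ξ (τ N ω) ω‖⁻¹ • ξ (τ N ω) ω)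
      (fun N => measurable_normalize (hζ N)) fun ω => by
        refine (Metric.isBounded_closedBall (x := 0) (r := 1)).subset ?_
        rintro _ ⟨N, rfl⟩
        rw [mem_closedBall_zero_iff, norm_smul, norm_inv, norm_norm]
        exact inv_mul_le_one
    have hnorm : ∀ ω ∈ A, Tendsto (fun i => ‖ξ (τ (σ i ω) ω) ω‖) atTop atTop := fun ω hω =>
      tendsto_atTop_mono (fun i => hτA _ ω hω)
        (tendsto_natCast_atTop_atTop.comp (hσ ω).tendsto_atTop)
    -- Nothing is known about η off A. Setting it to 0 there gives a position to which no arbitrage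
    -- applies on all of Ω.
    have hη' : Measurable[m] (A.indicator η) := hη.indicator hAm
    have hzero := h.eq_zero_of_nonneg hη' (by
      filter_upwards [hspan'] with ω hω
      by_cases hωA : ω ∈ A
      · rw [indicator_of_mem hωA]
        exact (isClosed_inEssSpan _ _).mem_of_tendsto (hlim ω)
          (Eventually.of_forall fun i => (hω _).smul _)
      · rw [indicator_of_notMem hωA]
        exact fun u _ => inner_zero_right _) (by
      filter_upwards [h.regular, hle', hz] with ω hr hω hzω
      by_cases hωA : ω ∈ A
      · rw [indicator_of_mem hωA]
        obtain ⟨b, hb⟩ := hzω.bddBelow_range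
        exact hr.limit_direction_nonneg h.zero h.k_pos h.half_le (x := H ω) (z := b)
          (ξ := fun i => ξ (τ (σ i ω) ω) ω) (hnorm ω hωA) (hlim ω) (fun i => (hω _).1)
          fun i => (hb ⟨_, rfl⟩).trans (hω _).2
      · simp [indicator_of_notMem hωA])
    filter_upwards [hzero] with ω hω hωA
    rw [indicator_of_mem hωA] at hω
    have h1 : Tendsto (fun i => ‖‖ξ (τ (σ i ω) ω) ω‖⁻¹ • ξ (τ (σ i ω) ω) ω‖) atTop (𝓝 ‖η ω‖) :=
      (hlim ω).norm
    rw [hω, norm_zero] at h1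
    have h2 : ∀ᶠ i in atTop, ‖‖ξ (τ (σ i ω) ω) ω‖⁻¹ • ξ (τ (σ i ω) ω) ω‖ = 1 := by
      filter_upwards [(hnorm ω hωA).eventually_gt_atTop 0] with i hi
      rw [norm_smul, norm_inv, norm_norm, inv_mul_cancel₀ hi.ne']
    exact zero_ne_one (tendsto_nhds_unique h1 ((tendsto_congr' h2).2 tendsto_const_nhds))
  -- Now the positions themselves are extracted; they are set to 0 on the null event A, because
  -- boundedness is required at every ω.
  obtain ⟨σ, ξ₀, -, hξ₀, hσ, hlim⟩ := exists_random_subsequence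
    (f := fun n => Aᶜ.indicator (ξ n)) (fun n => (hξ n).indicator hAm.compl) fun ω => by
      by_cases hωA : ω ∈ A
      · refine (Metric.isBounded_closedBall (x := 0) (r := 0)).subset ?_
        rintro _ ⟨n, rfl⟩
        simp [hωA]
      · have : ∃ N : ℕ, ∀ n, ‖ξ n ω‖ < N := by simpa [hA] using hωA
        obtain ⟨N, hN⟩ := this
        refine (Metric.isBounded_closedBall (x := 0) (r := N)).subset ?_
        rintro _ ⟨n, rfl⟩
        change Aᶜ.indicator (ξ n) ω ∈ _
        rw [indicator_of_mem (show ω ∈ Aᶜ from hωA), mem_closedBall_zero_iff]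
        exact (hN n).le
  refine ⟨ξ₀, hξ₀, ?_, ?_⟩
  · filter_upwards [hspan', hAnull] with ω hω hωA
    refine (isClosed_inEssSpan _ _).mem_of_tendsto (hlim ω) (Eventually.of_forall fun i => ?_)
    rw [indicator_of_mem (by exact hωA)]
    exact hω _
  · filter_upwards [hle', hAnull, hz, h.regular] with ω hω hωA hzω hr
    have hlim' : Tendsto (fun i => ξ (σ i ω) ω) atTop (𝓝 (ξ₀ ω)) := by
      simpa [indicator_of_mem (show ω ∈ Aᶜ from hωA)] using hlim ω
    exact hr.integrable_and_le_of_tendsto (x := fun _ => H ω) (tendsto_const_nhds) hlim'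
      (hzω.comp (hσ ω).tendsto_atTop) (fun i => (hω _).1) fun i => (hω _).2

/-- Positions can be projected on the essential span of the increment. -/
lemma IsOneStep.exists_projection (h : IsOneStep m P U a k C Y e κ ν)
    {ξ : Ω → EuclideanSpace ℝ (Fin d)} (hξ : Measurable[m] ξ) :
    ∃ p : Ω → EuclideanSpace ℝ (Fin d), Measurable[m] p ∧ (∀ ω, InEssSpan (ν ω) id (p ω)) ∧
      ∀ᵐ ω ∂P, ∀ᵐ z ∂κ ω, ∀ x, posUtil x (p ω) z = posUtil x (ξ ω) z := by
  obtain ⟨p, hp, hspan, hort⟩ := exists_measurable_projection ν measurable_id hξ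
  refine ⟨p, hp, hspan, ?_⟩
  have h1 : ∀ᵐ ω ∂P, ⟪ξ ω - p ω, Y ω⟫_ℝ = 0 :=
    (h.lawY.ae_iff (measurableSet_inner_fst (hξ.sub hp) measurable_id
      (measurableSet_singleton 0))).2 (Eventually.of_forall hort)
  have h2 : ∀ᵐ ω ∂P, ∀ᵐ z ∂κ ω, ⟪ξ ω - p ω, z.1⟫_ℝ = 0 :=
    (h.law.ae_iff (measurableSet_inner_fst (hξ.sub hp) measurable_fst
      (measurableSet_singleton 0))).1 h1
  filter_upwards [h2] with ω hω
  filter_upwards [hω] with z hz x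
  rw [inner_sub_left, sub_eq_zero] at hz
  rw [posUtil, posUtil, hz]

/-- `v` is the path of the value function at the rationals: it dominates the conditional expected
utilities of all positions, and they come arbitrarily close to it. -/
structure IsValuePath (m : MeasurableSpace Ω) {mΩ : MeasurableSpace Ω} (P : Measure[mΩ] Ω)
    (κ : Kernel[m] Ω (EuclideanSpace ℝ (Fin d) × (ℚ → ℝ))) (v : Ω → ℚ → ℝ) : Prop where
  measurable : ∀ q, Measurable[m] fun ω => v ω q
  dominates : ∀ ξ : Ω → EuclideanSpace ℝ (Fin d), Measurable[m] ξ → ∀ q : ℚ, ∀ᵐ ω ∂P,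
    gExp (κ ω) (fun e => ((posUtil q (ξ ω) e : ℝ) : EReal)) ≤ ((v ω q : ℝ) : EReal)
  approx : ∀ q : ℚ, ∃ ξ : ℕ → Ω → EuclideanSpace ℝ (Fin d), (∀ n, Measurable[m] (ξ n)) ∧
    ∀ᵐ ω ∂P, ((v ω q : ℝ) : EReal) ≤
      ⨆ n, gExp (κ ω) (fun e => ((posUtil q (ξ n ω) e : ℝ) : EReal))

variable {v : Ω → ℚ → ℝ}

/-- Regularity makes the positive part finite, so a real lower bound on the generalized expectation
forces the negative part to be finite as well. -/
lemma IsRegularLaw.integrable_of_le_gExp {Q : Measure (EuclideanSpace ℝ (Fin d) × (ℚ → ℝ))}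
    (h : IsRegularLaw U a k C Q Prod.fst (fun z x => ratExt z.2 x))
    {x z : ℝ} {ξ : EuclideanSpace ℝ (Fin d)}
    (hz : (z : EReal) ≤ gExp Q (fun e => ((posUtil x ξ e : ℝ) : EReal))) :
    Integrable (posUtil x ξ) Q ∧ z ≤ ∫ e, posUtil x ξ e ∂Q := by
  have hm : Measurable (posUtil x ξ : EuclideanSpace ℝ (Fin d) × (ℚ → ℝ) → ℝ) :=
    h.measurable_comp (by fun_prop)
  obtain ⟨N, hN⟩ := exists_nat_ge (max |x| ‖ξ‖)
  refine integrable_and_le_of_le_gExp hm.aestronglyMeasurable ?_ hz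
  refine lt_of_le_of_lt (lintegral_mono_ae ?_) (h.integrable_dom N).lintegral_lt_top
  filter_upwards [h.le_dom (x := x) (ξ := ξ) ((le_max_left _ _).trans hN)
    ((le_max_right _ _).trans hN)] with e he
  exact ENNReal.ofReal_le_ofReal he

/-- The value is attained at rational endowments. -/
lemma IsOneStep.exists_optimal_rat (h : IsOneStep m P U a k C Y e κ ν)
    (hv : IsValuePath m P κ v) (q : ℚ) :
    ∃ ξ : Ω → EuclideanSpace ℝ (Fin d), Measurable[m] ξ ∧ (∀ᵐ ω ∂P, InEssSpan (ν ω) id (ξ ω)) ∧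
      ∀ᵐ ω ∂P, Integrable (posUtil q (ξ ω)) (κ ω) ∧ v ω q ≤ ∫ e, posUtil q (ξ ω) e ∂κ ω := by
  classical
  obtain ⟨ξ, hξ, hsup⟩ := hv.approx q
  -- The slack 1 / (n + 1) puts z n strictly below the supremum, so some index beats it and can be
  -- chosen measurably.
  let z : ℕ → Ω → ℝ := fun n ω => v ω q - 1 / ((n : ℝ) + 1)
  let p : ℕ → Ω → ℕ → Prop := fun n ω i => ((z n ω : ℝ) : EReal) <
    gExp (κ ω) (fun e => ((posUtil q (ξ i ω) e : ℝ) : EReal))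
  have hgm : ∀ i, Measurable[m] fun ω =>
      gExp (κ ω) (fun e => ((posUtil q (ξ i ω) e : ℝ) : EReal)) := fun i =>
    measurable_gExp_kernel (f := fun z => posUtil q (ξ i z.1) z.2)
      (measurable_posUtil (H := fun _ => (q : ℝ)) (@measurable_const _ _ _ m _) (hξ i))
  have hzm : ∀ n, Measurable[m] fun ω => ((z n ω : ℝ) : EReal) := fun n =>
    measurable_coe_real_ereal.comp ((measurable_id.sub_const (1 / ((n : ℝ) + 1))).comp
      (hv.measurable q))
  have hpm : ∀ n i, MeasurableSet[m] {ω | p n ω i} := fun n i =>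
    measurableSet_ereal_lt (hzm n) (hgm i)
  choose τ hτ hτs using fun n => exists_measurable_index (hpm n)
  have hζ : ∀ n, Measurable[m] fun ω => ξ (τ n ω) ω := fun n =>
    measurable_apply_nat hξ (hτ n)
  choose π hπ hspan hproj using fun n => h.exists_projection (hζ n)
  refine h.exists_limit (H := fun _ => (q : ℝ)) hπ (fun n => Eventually.of_forall (hspan n))
    (z := z) (Eventually.of_forall fun ω => ?_) fun n => ?_
  · simpa [z] using tendsto_one_div_add_atTop_nhds_zero_nat.const_sub (v ω q)
  · filter_upwards [hsup, hproj n, h.regular] with ω h1 h2 hr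
    have hzv : z n ω < v ω q := by
      have : (0 : ℝ) < 1 / ((n : ℝ) + 1) := by positivity
      simp only [z]
      linarith
    have hlt : ((z n ω : ℝ) : EReal) <
        ⨆ i, gExp (κ ω) (fun e => ((posUtil q (ξ i ω) e : ℝ) : EReal)) :=
      lt_of_lt_of_le (EReal.coe_lt_coe_iff.2 hzv) h1
    obtain ⟨i, hi⟩ := lt_iSup_iff.1 hlt
    have h3 : p n ω (τ n ω) := hτs n ω ⟨i, hi⟩
    have h4 := hr.integrable_of_le_gExp (le_of_lt h3)
    have h5 : posUtil (q : ℝ) (π n ω) =ᵐ[κ ω] posUtil q (ξ (τ n ω) ω) :=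
      h2.mono fun z hz => hz q
    exact ⟨h4.1.congr h5.symm, by rw [integral_congr_ae h5]; exact h4.2⟩

/-- The value function inherits the properties of the utility paths. -/
lemma IsOneStep.isRatPath (h : IsOneStep m P U a k C Y e κ ν) (hv : IsValuePath m P κ v) :
    ∀ᵐ ω ∂P, IsRatPath U a k C (v ω) := by
  choose ξ hξ _ hopt using h.exists_optimal_rat hv
  have hdom : ∀ {ζ : Ω → EuclideanSpace ℝ (Fin d)} (_ : Measurable[m] ζ) (q : ℚ), ∀ᵐ ω ∂P,
      Integrable (posUtil q (ζ ω)) (κ ω) → ∫ e, posUtil q (ζ ω) e ∂κ ω ≤ v ω q := by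
    intro ζ hζ q
    filter_upwards [hv.dominates ζ hζ q] with ω hω hi
    rwa [gExp_of_integrable hi, EReal.coe_le_coe_iff] at hω
  have heq : ∀ᵐ ω ∂P, ∀ q : ℚ, ∫ e, posUtil q (ξ q ω) e ∂κ ω = v ω q := ae_all_iff.2 fun q => by
    filter_upwards [hopt q, hdom (hξ q) q] with ω h1 h2
    exact le_antisymm (h2 h1.1) h1.2
  have hint : ∀ᵐ ω ∂P, ∀ q : ℚ, Integrable (posUtil q (ξ q ω)) (κ ω) :=
    ae_all_iff.2 fun q => (hopt q).mono fun ω hω => hω.1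
  -- Each property of v is tested on one competitor: a convex combination of optimizers for
  -- concavity, the same optimizer with more capital for monotonicity, the zero position for the
  -- lower bound, the halved optimizer for scaling.
  have hc : ∀ᵐ ω ∂P, ∀ p q s : ℚ,
      Integrable (posUtil ((s * p + (1 - s) * q : ℚ) : ℝ)
        ((s : ℝ) • ξ p ω + (1 - s : ℝ) • ξ q ω)) (κ ω) →
      ∫ e, posUtil ((s * p + (1 - s) * q : ℚ) : ℝ)
        ((s : ℝ) • ξ p ω + (1 - s : ℝ) • ξ q ω) e ∂κ ω ≤ v ω (s * p + (1 - s) * q) :=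
    ae_all_iff.2 fun p => ae_all_iff.2 fun q => ae_all_iff.2 fun s =>
      hdom (((hξ p).const_smul (s : ℝ)).add ((hξ q).const_smul (1 - s : ℝ))) _
  have hmono : ∀ᵐ ω ∂P, ∀ p q : ℚ, Integrable (posUtil q (ξ p ω)) (κ ω) →
      ∫ e, posUtil q (ξ p ω) e ∂κ ω ≤ v ω q :=
    ae_all_iff.2 fun p => ae_all_iff.2 fun q => hdom (hξ p) q
  have hlow : ∀ᵐ ω ∂P, ∀ q : ℚ, Integrable (posUtil q (0 : EuclideanSpace ℝ (Fin d))) (κ ω) →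
      ∫ e, posUtil q 0 e ∂κ ω ≤ v ω q :=
    ae_all_iff.2 fun q => hdom (@measurable_const _ _ _ m 0) q
  have hhalf : ∀ᵐ ω ∂P, ∀ q : ℚ, Integrable (posUtil ((q / 2 : ℚ) : ℝ)
      ((1 / 2 : ℝ) • ξ q ω)) (κ ω) →
      ∫ e, posUtil ((q / 2 : ℚ) : ℝ) ((1 / 2 : ℝ) • ξ q ω) e ∂κ ω ≤ v ω (q / 2) :=
    ae_all_iff.2 fun q => hdom ((hξ q).const_smul (1 / 2 : ℝ)) _
  filter_upwards [heq, hint, hc, hmono, hlow, hhalf, h.regular] with ω heq hint hc hmono hlow hhalf hr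
  refine ⟨fun p q s hs0 hs1 => ?_, fun p q hpq => ?_, fun q => ?_, fun q => ?_⟩
  · have hi := ((hint p).const_mul (s : ℝ)).add ((hint q).const_mul (1 - s : ℝ))
    have hle : ∀ᵐ e ∂κ ω, s * posUtil p (ξ p ω) e + (1 - s) * posUtil q (ξ q ω) e ≤
        posUtil ((s * p + (1 - s) * q : ℚ) : ℝ) ((s : ℝ) • ξ p ω + (1 - s : ℝ) • ξ q ω) e := by
      filter_upwards [hr.path] with e he
      have := he.concave.2 (mem_univ (p + ⟪ξ p ω, e.1⟫_ℝ)) (mem_univ (q + ⟪ξ q ω, e.1⟫_ℝ))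
        (show (0 : ℝ) ≤ s by exact_mod_cast hs0)
        (show (0 : ℝ) ≤ 1 - s by rw [sub_nonneg]; exact_mod_cast hs1) (by ring)
      refine this.trans (le_of_eq ?_)
      simp only [posUtil, inner_add_left, real_inner_smul_left, smul_eq_mul]
      push_cast
      ring_nf
    have hi' := hr.integrable_of_ge hi hle
    refine le_trans ?_ (hc p q s hi')
    rw [← heq p, ← heq q, ← integral_const_mul, ← integral_const_mul,
      ← integral_add ((hint p).const_mul _) ((hint q).const_mul _)]
    exact integral_mono_ae hi hi' hle
  · have hlt : ∀ᵐ e ∂κ ω, posUtil p (ξ p ω) e < posUtil q (ξ p ω) e := by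
      filter_upwards [hr.path] with e he
      exact he.strictMono (by simpa using hpq)
    have hle := hlt.mono fun e he => he.le
    have hi := hr.integrable_of_ge (hint p) hle
    refine lt_of_lt_of_le ?_ (hmono p q hi)
    rw [← heq p]
    refine lt_of_le_of_ne (integral_mono_ae (hint p) hi hle) fun hEq => ?_
    have := (integral_eq_iff_of_ae_le (hint p) hi hle).1 hEq
    obtain ⟨e, h1, h2⟩ := (hlt.and this).exists
    exact absurd h2 (ne_of_lt h1)
  · have hle : ∀ᵐ e ∂κ ω, U q ≤ posUtil q (0 : EuclideanSpace ℝ (Fin d)) e := by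
      filter_upwards [hr.path] with e he
      simpa [posUtil] using he.lower q
    have hi := hr.integrable_of_ge (integrable_const (U q)) hle
    refine le_trans ?_ (hlow q hi)
    have h1 := integral_mono_ae (integrable_const (U q)) hi hle
    rwa [integral_const, probReal_univ, one_smul] at h1
  · have hi := (((hint q).const_mul a).add ((hint q).abs.const_mul k)).sub (integrable_const C)
    have hle : ∀ᵐ e ∂κ ω, a * posUtil q (ξ q ω) e + k * |posUtil q (ξ q ω) e| - C ≤
        posUtil ((q / 2 : ℚ) : ℝ) ((1 / 2 : ℝ) • ξ q ω) e := by
      filter_upwards [hr.path] with e he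
      refine (he.scaling (q + ⟪ξ q ω, e.1⟫_ℝ)).trans (le_of_eq ?_)
      simp only [posUtil, real_inner_smul_left]
      push_cast
      ring_nf
    have hi' := hr.integrable_of_ge hi hle
    refine le_trans ?_ (hhalf q hi')
    have h1 := integral_mono_ae hi hi' hle
    rw [integral_sub' (((hint q).const_mul a).add ((hint q).abs.const_mul k)) (integrable_const C),
      integral_add' ((hint q).const_mul a) ((hint q).abs.const_mul k), integral_const_mul,
      integral_const_mul, heq q] at h1
    -- The nonlinear term of the scaling inequality survives expectation because |E X| ≤ E|X| and k
    -- > 0.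
    have h2 : |v ω q| ≤ ∫ e, |posUtil q (ξ q ω) e| ∂κ ω := by
      rw [← heq q]; exact abs_integral_le_integral_abs
    have h3 := mul_le_mul_of_nonneg_left h2 h.k_pos.le
    simp only [integral_const, probReal_univ, smul_eq_mul, one_mul] at h1
    change _ ≤ ∫ e, posUtil ((q / 2 : ℚ) : ℝ) ((1 / 2 : ℝ) • ξ q ω) e ∂κ ω at h1
    linarith

end OneStep

/-! ### The one-period problem with random endowment, and regularity of the conditional laws -/

section OneStepValue

variable {Ω : Type*} {m mΩ : MeasurableSpace Ω} {P : Measure[mΩ] Ω} {d : ℕ}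
  {U : ℝ → ℝ} {a k C : ℝ} {Y : Ω → EuclideanSpace ℝ (Fin d)} {e : Ω → ℚ → ℝ}
  {κ : Kernel[m] Ω (EuclideanSpace ℝ (Fin d) × (ℚ → ℝ))}
  {ν : Kernel[m] Ω (EuclideanSpace ℝ (Fin d))} [IsMarkovKernel κ] [IsMarkovKernel ν]
  {v : Ω → ℚ → ℝ}

lemma gExp_mono {E : Type*} [MeasurableSpace E] {Q : Measure E} {f g : E → ℝ}
    (h : ∀ᵐ e ∂Q, f e ≤ g e) :
    gExp Q (fun e => ((f e : ℝ) : EReal)) ≤ gExp Q (fun e => ((g e : ℝ) : EReal)) := by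
  rw [gExp_coe, gExp_coe]
  refine EReal.sub_le_sub ?_ ?_
  · exact EReal.coe_ennreal_le_coe_ennreal_iff.2
      (lintegral_mono_ae (h.mono fun e he => ENNReal.ofReal_le_ofReal he))
  · exact EReal.coe_ennreal_le_coe_ennreal_iff.2
      (lintegral_mono_ae (h.mono fun e he => ENNReal.ofReal_le_ofReal (neg_le_neg he)))

/-- The value function dominates the conditional expected utility for random endowments. -/
lemma IsOneStep.gExp_le (h : IsOneStep m P U a k C Y e κ ν) (hv : IsValuePath m P κ v)
    {H : Ω → ℝ} {ξ : Ω → EuclideanSpace ℝ (Fin d)} (hξ : Measurable[m] ξ) :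
    ∀ᵐ ω ∂P, gExp (κ ω) (fun e => ((posUtil (H ω) (ξ ω) e : ℝ) : EReal)) ≤
      ((ratExt (v ω) (H ω) : ℝ) : EReal) := by
  filter_upwards [ae_all_iff.2 (hv.dominates ξ hξ), h.isRatPath hv, h.regular] with ω hd hr hreg
  have hc := (hr.isUtilityPath h.continuous).continuous
  have ht : Tendsto (fun x => ((ratExt (v ω) x : ℝ) : EReal)) (𝓝[>] (H ω))
      (𝓝 ((ratExt (v ω) (H ω) : ℝ) : EReal)) :=
    ((continuous_coe_real_ereal.comp hc).tendsto _).mono_left nhdsWithin_le_nhds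
  -- Domination holds at all rational endowments off one null set. The random endowment is bounded
  -- by a rational below x, and x then decreases to it.
  refine ge_of_tendsto ht (eventually_mem_nhdsWithin.mono fun x hx => ?_)
  obtain ⟨q, hq, hqx⟩ := exists_rat_btwn (show H ω < x from hx)
  refine ((gExp_mono ?_).trans (hd q)).trans (EReal.coe_le_coe_iff.2 (le_ratExt hr.monotone hqx))
  filter_upwards [hreg.path] with z hz
  exact hz.strictMono.monotone (by linarith)

/-- The value function is attained for random endowments. -/
lemma IsOneStep.exists_optimal (h : IsOneStep m P U a k C Y e κ ν) (hv : IsValuePath m P κ v)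
    {H : Ω → ℝ} (hH : Measurable[m] H) :
    ∃ ξ : Ω → EuclideanSpace ℝ (Fin d), Measurable[m] ξ ∧ (∀ᵐ ω ∂P, InEssSpan (ν ω) id (ξ ω)) ∧
      ∀ᵐ ω ∂P, Integrable (posUtil (H ω) (ξ ω)) (κ ω) ∧
        ∫ e, posUtil (H ω) (ξ ω) e ∂κ ω = ratExt (v ω) (H ω) ∧
        k * ∫ e, |posUtil (H ω) (ξ ω) e| ∂κ ω ≤
          ratExt (v ω) (H ω / 2) - a * ratExt (v ω) (H ω) + C := by
  choose ζ hζ hspan hopt using h.exists_optimal_rat hv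
  -- H is rounded down to a multiple of 1 / (n + 1). Optimizers for the countably many rational
  -- endowments can be inserted measurably, and by monotonicity they do no worse with endowment H.
  let q : ℕ → Ω → ℚ := fun n ω => ⌊((n : ℝ) + 1) * H ω⌋ / ((n : ℚ) + 1)
  have hq : ∀ n, Measurable[m] (q n) := fun n =>
    (measurable_from_top (f := fun i : ℤ => (i : ℚ) / ((n : ℚ) + 1))).comp
      (Int.measurable_floor.comp ((measurable_const_mul ((n : ℝ) + 1)).comp hH))
  have hqle : ∀ n ω, (q n ω : ℝ) ≤ H ω := fun n ω => by
    simp only [q]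
    push_cast
    rw [div_le_iff₀ (by positivity), mul_comm]
    exact Int.floor_le _
  have hqge : ∀ (n : ℕ) ω, H ω - 1 / ((n : ℝ) + 1) ≤ q n ω := fun n ω => by
    have hn : (0 : ℝ) < (n : ℝ) + 1 := by positivity
    simp only [q]
    push_cast
    rw [le_div_iff₀ hn, sub_mul, one_div_mul_cancel hn.ne', mul_comm]
    exact (Int.sub_one_lt_floor _).le
  have hqlim : ∀ ω, Tendsto (fun n => (q n ω : ℝ)) atTop (𝓝 (H ω)) := fun ω =>
    tendsto_of_tendsto_of_tendsto_of_le_of_le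
      (by simpa using tendsto_one_div_add_atTop_nhds_zero_nat.const_sub (H ω))
      tendsto_const_nhds (fun n => hqge n ω) fun n => hqle n ω
  have hξ : ∀ n, Measurable[m] fun ω => ζ (q n ω) ω := fun n =>
    (measurable_from_prod_countable_right (f := fun z : ℚ × Ω => ζ z.1 z.2) hζ).comp
      ((hq n).prodMk measurable_id)
  have hrat := h.isRatPath hv
  obtain ⟨ξ, hξm, hξs, hξo⟩ := h.exists_limit (H := H) hξ
    (fun n => (ae_all_iff.2 hspan).mono fun ω hω => hω _)
    (z := fun n ω => v ω (q n ω)) (z₀ := fun ω => ratExt (v ω) (H ω))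
    (by
      filter_upwards [hrat] with ω hr
      have hc := (hr.isUtilityPath h.continuous).continuous
      simpa only [Function.comp_def, hr.ratExt_cast] using (hc.tendsto _).comp (hqlim ω))
    (fun n => by
      filter_upwards [ae_all_iff.2 hopt, h.regular] with ω ho hreg
      obtain ⟨hi, hle⟩ := ho (q n ω)
      have hmono : ∀ᵐ z ∂κ ω, posUtil (q n ω) (ζ (q n ω) ω) z ≤ posUtil (H ω) (ζ (q n ω) ω) z := by
        filter_upwards [hreg.path] with z hz
        exact hz.strictMono.monotone (by linarith [hqle n ω])
      have hi' : Integrable (posUtil (H ω) (ζ (q n ω) ω)) (κ ω) := hreg.integrable_of_ge hi hmono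
      exact ⟨hi', hle.trans (integral_mono_ae hi hi' hmono)⟩)
  refine ⟨ξ, hξm, hξs, ?_⟩
  filter_upwards [hξo, h.gExp_le hv (H := H) hξm,
    h.gExp_le hv (H := fun ω => H ω / 2) (hξm.const_smul (1 / 2 : ℝ)), h.regular]
    with ω ho hle hhalf hreg
  have heq : ∫ e, posUtil (H ω) (ξ ω) e ∂κ ω = ratExt (v ω) (H ω) := by
    rw [gExp_of_integrable ho.1, EReal.coe_le_coe_iff] at hle
    exact le_antisymm hle ho.2
  refine ⟨ho.1, heq, ?_⟩
  have hi := ((ho.1.const_mul a).add (ho.1.abs.const_mul k)).sub (integrable_const C)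
  -- Comparing with the halved position bounds the conditional L¹ norm of the utility by the value
  -- function; the integrability of the optimal wealth's utility rests on this bound.
  have hsc : ∀ᵐ z ∂κ ω, a * posUtil (H ω) (ξ ω) z + k * |posUtil (H ω) (ξ ω) z| - C ≤
      posUtil (H ω / 2) ((1 / 2 : ℝ) • ξ ω) z := by
    filter_upwards [hreg.path] with z hz
    refine (hz.scaling (H ω + ⟪ξ ω, z.1⟫_ℝ)).trans (le_of_eq ?_)
    simp only [posUtil, real_inner_smul_left]
    ring_nf
  have hi' : Integrable (posUtil (H ω / 2) ((1 / 2 : ℝ) • ξ ω)) (κ ω) :=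
    hreg.integrable_of_ge hi hsc
  have h1 := integral_mono_ae hi hi' hsc
  rw [integral_sub' ((ho.1.const_mul a).add (ho.1.abs.const_mul k)) (integrable_const C),
    integral_add' (ho.1.const_mul a) (ho.1.abs.const_mul k), integral_const_mul,
    integral_const_mul, heq] at h1
  simp only [integral_const, probReal_univ, smul_eq_mul, one_mul] at h1
  have h2 : ∫ e, posUtil (H ω / 2) ((1 / 2 : ℝ) • ξ ω) e ∂κ ω ≤ ratExt (v ω) (H ω / 2) := by
    have h3 := hhalf
    rw [Pi.smul_apply, gExp_of_integrable hi', EReal.coe_le_coe_iff] at h3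
    exact h3
  linarith

lemma measurable_cons_one : Measurable fun y : EuclideanSpace ℝ (Fin d) =>
    (WithLp.toLp 2 (Fin.cons 1 y.ofLp) : EuclideanSpace ℝ (Fin (d + 1))) := by
  refine (WithLp.measurable_toLp 2 _).comp (measurable_pi_lambda _ fun i => ?_)
  refine Fin.cases ?_ (fun j => ?_) i
  · simp only [Fin.cons_zero]; exact measurable_const
  · simp only [Fin.cons_succ]; fun_prop

lemma measurable_tail : Measurable fun y : EuclideanSpace ℝ (Fin (d + 1)) =>
    (WithLp.toLp 2 (Fin.tail y.ofLp) : EuclideanSpace ℝ (Fin d)) := by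
  refine (WithLp.measurable_toLp 2 _).comp (measurable_pi_lambda _ fun i => ?_)
  simp only [Fin.tail]
  fun_prop

lemma inner_cons_one (r : EuclideanSpace ℝ (Fin (d + 1))) (y : EuclideanSpace ℝ (Fin d)) :
    ⟪r, (WithLp.toLp 2 (Fin.cons 1 y.ofLp) : EuclideanSpace ℝ (Fin (d + 1)))⟫_ℝ =
      r 0 + ⟪(WithLp.toLp 2 (Fin.tail r.ofLp) : EuclideanSpace ℝ (Fin d)), y⟫_ℝ := by
  rw [PiLp.inner_apply, PiLp.inner_apply, Fin.sum_univ_succ]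
  simp [Fin.tail]

/-- Absence of arbitrage forces the affine span of the conditional support to contain `0`. -/
lemma ae_inEssSpan_cons (hlaw : IsCondLaw m P Y ν)
    (hNA : ∀ ξ : Ω → EuclideanSpace ℝ (Fin d), Measurable[m] ξ → (∀ᵐ ω ∂P, 0 ≤ ⟪ξ ω, Y ω⟫_ℝ) →
      ∀ᵐ ω ∂P, ⟪ξ ω, Y ω⟫_ℝ = 0) :
    ∀ᵐ ω ∂P, InEssSpan (ν ω)
      (fun y => (WithLp.toLp 2 (Fin.cons 1 y.ofLp) : EuclideanSpace ℝ (Fin (d + 1))))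
      (EuclideanSpace.single 0 1) := by
  obtain ⟨p, hp, hspan, hort⟩ := exists_measurable_projection ν measurable_cons_one
    (v := fun _ => EuclideanSpace.single 0 1) (@measurable_const _ _ _ m _)
  -- The residual r of (1, 0) satisfies r₀ = ‖r‖² and is orthogonal to (1, Y), so minus its tail is
  -- a position that gains ‖r‖² for certain; no arbitrage gives r = 0.
  let r : Ω → EuclideanSpace ℝ (Fin (d + 1)) := fun ω => EuclideanSpace.single 0 1 - p ω
  have hr : Measurable[m] r := (measurable_id.const_sub (EuclideanSpace.single 0 1)).comp hp
  let ξ : Ω → EuclideanSpace ℝ (Fin d) := fun ω => -WithLp.toLp 2 (Fin.tail (r ω).ofLp)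
  have hξ : Measurable[m] ξ := (measurable_neg.comp measurable_tail).comp hr
  have hr0 : ∀ ω, r ω 0 = ‖r ω‖ ^ 2 := fun ω => by
    have h1 : ⟪r ω, p ω⟫_ℝ = 0 := hspan ω (r ω) (hort ω)
    have h2 : ⟪r ω, EuclideanSpace.single 0 (1 : ℝ)⟫_ℝ = r ω 0 := by
      rw [EuclideanSpace.inner_single_right]; simp
    have h3 : EuclideanSpace.single 0 (1 : ℝ) = r ω + p ω := by simp [r]
    rw [← h2, h3, inner_add_right, h1, add_zero, real_inner_self_eq_norm_sq]
  have hν : ∀ᵐ ω ∂P, ∀ᵐ y ∂ν ω, ⟪r ω, (WithLp.toLp 2 (Fin.cons 1 y.ofLp) :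
      EuclideanSpace ℝ (Fin (d + 1)))⟫_ℝ = 0 := Eventually.of_forall hort
  have hY : ∀ᵐ ω ∂P, ⟪ξ ω, Y ω⟫_ℝ = ‖r ω‖ ^ 2 := by
    have h1 := (hlaw.ae_iff (measurableSet_inner_fst hr measurable_cons_one
      (measurableSet_singleton 0))).2 hν
    filter_upwards [h1] with ω hω
    have h2 : r ω 0 + ⟪(WithLp.toLp 2 (Fin.tail (r ω).ofLp) : EuclideanSpace ℝ (Fin d)), Y ω⟫_ℝ = 0 :=
      (inner_cons_one _ _).symm.trans hω
    simp only [ξ, inner_neg_left]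
    rw [← hr0]
    linarith
  filter_upwards [hY, hNA ξ hξ (hY.mono fun ω hω => by rw [hω]; positivity)] with ω h1 h2
  have h3 : r ω = 0 := by
    rw [h2] at h1
    simpa using h1.symm
  have h4 : p ω = EuclideanSpace.single 0 1 := (sub_eq_zero.1 h3).symm
  rw [← h4]
  exact hspan ω

/-- The conditional laws are regular if all constant positions have finite positive utility. -/
lemma ae_isRegularLaw (hlaw : IsCondLaw m P (fun ω => (Y ω, e ω)) κ) (hU : Continuous U)
    (hrat : ∀ᵐ ω ∂P, IsRatPath U a k C (e ω))
    (hfin : ∀ (x : ℝ) (ξ : EuclideanSpace ℝ (Fin d)), ∀ᵐ ω ∂P,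
      ∫⁻ z, ENNReal.ofReal (posUtil x ξ z) ∂κ ω < ⊤) :
    ∀ᵐ ω ∂P, IsRegularLaw U a k C (κ ω) Prod.fst (fun z x => ratExt z.2 x) := by
  -- For the sign pattern s of y, ⟪θ s, y⟫ is the ℓ¹ norm of y, which dominates ‖y‖. Thus finitely
  -- many constant positions control the utility at n + n ‖y‖.
  let θ : (Fin d → Bool) → EuclideanSpace ℝ (Fin d) := fun s =>
    WithLp.toLp 2 fun i => if s i then 1 else -1
  have h1 : ∀ᵐ ω ∂P, ∀ᵐ z ∂κ ω, IsRatPath U a k C z.2 :=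
    (hlaw.ae_iff (B := {z | IsRatPath U a k C z.2.2}) ((measurable_snd.comp measurable_snd)
      (measurableSet_isRatPath U a k C))).1 hrat
  have h2 : ∀ᵐ ω ∂P, ∀ (n : ℕ) (s : Fin d → Bool),
      ∫⁻ z, ENNReal.ofReal (posUtil n ((n : ℝ) • θ s) z) ∂κ ω < ⊤ :=
    ae_all_iff.2 fun n => ae_all_iff.2 fun s => hfin _ _
  filter_upwards [h1, h2] with ω hω hω2
  have hmF : Measurable (Function.uncurry fun (z : EuclideanSpace ℝ (Fin d) × (ℚ → ℝ)) (x : ℝ) =>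
      ratExt z.2 x) :=
    measurable_ratExt.comp ((measurable_snd.comp measurable_fst).prodMk measurable_snd)
  refine ⟨measurable_fst, hmF, hω.mono fun z hz => hz.isUtilityPath hU, fun n => ?_⟩
  have hle : ∀ᵐ z ∂κ ω, ENNReal.ofReal (ratExt z.2 (n + n * ‖z.1‖)) ≤
      ∑ s, ENNReal.ofReal (posUtil n ((n : ℝ) • θ s) z) := by
    filter_upwards [hω] with z hz
    let s : Fin d → Bool := fun i => decide (0 ≤ z.1 i)
    have hs : ‖z.1‖ ≤ ⟪θ s, z.1⟫_ℝ := by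
      have e1 : ⟪θ s, z.1⟫_ℝ = ∑ i, |z.1 i| := by
        rw [PiLp.inner_apply]
        refine Finset.sum_congr rfl fun i _ => ?_
        by_cases h0 : 0 ≤ z.1 i
        · simp [θ, s, h0, abs_of_nonneg h0]
        · simp [θ, s, h0, abs_of_neg (not_le.1 h0)]
      have e2 : z.1 = ∑ i, EuclideanSpace.single i (z.1 i) := by
        ext j
        simp
      rw [e1]
      calc ‖z.1‖ = ‖∑ i, EuclideanSpace.single i (z.1 i)‖ := by rw [← e2]
        _ ≤ ∑ i, ‖EuclideanSpace.single i (z.1 i)‖ := norm_sum_le _ _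
        _ = ∑ i, |z.1 i| := by simp
    refine le_trans (ENNReal.ofReal_le_ofReal ?_) (Finset.single_le_sum
      (f := fun s => ENNReal.ofReal (posUtil n ((n : ℝ) • θ s) z)) (fun _ _ => zero_le) (Finset.mem_univ s))
    refine (hz.isUtilityPath hU).strictMono.monotone ?_
    rw [real_inner_smul_left]
    exact add_le_add le_rfl (mul_le_mul_of_nonneg_left hs (Nat.cast_nonneg n))
  refine lt_of_le_of_lt (lintegral_mono_ae hle) ?_
  rw [lintegral_finsetSum']
  · exact ENNReal.sum_lt_top.2 fun s _ => hω2 n s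
  · intro s _
    have : Measurable (posUtil n ((n : ℝ) • θ s) : EuclideanSpace ℝ (Fin d) × (ℚ → ℝ) → ℝ) := by
      unfold posUtil
      exact measurable_ratExt.comp (measurable_snd.prodMk (by fun_prop))
    exact this.ennreal_ofReal.aemeasurable

/-- The essential supremum of a family is almost surely the supremum of a sequence. -/
lemma IsEssSup.exists_seq {ι : Type*} [Nonempty ι] [IsFiniteMeasure P] (hm : m ≤ mΩ)
    {F : ι → Ω → EReal} {Z : Ω → EReal} (hF : ∀ i, Measurable[m] (F i)) (hZ : IsEssSup m P F Z) :
    ∃ u : ℕ → ι, ∀ᵐ ω ∂P, Z ω ≤ ⨆ n, F (u n) ω := by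
  have hF' : ∀ i, Measurable[mΩ] (F i) := fun i => (hF i).mono hm le_rfl
  -- At each rational level countably many members essentially exhaust all superlevel sets; the
  -- union over the levels gives the sequence.
  choose J hJc hJ using fun r : ℚ => exists_countable_essUnion P
    (fun i => {ω | ((r : ℝ) : EReal) < F i ω}) fun i => measurableSet_lt measurable_const (hF' i)
  obtain ⟨i₀⟩ := ‹Nonempty ι›
  obtain ⟨u, hu⟩ := ((countable_iUnion hJc).insert i₀).exists_eq_range (insert_nonempty _ _)
  refine ⟨u, hZ.2.2 _ (Measurable.iSup fun n => hF' (u n)) fun i => ?_⟩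
  have hnull : ∀ᵐ ω ∂P, ∀ r : ℚ,
      ω ∉ {ω | ((r : ℝ) : EReal) < F i ω} \ ⋃ j ∈ J r, {ω | ((r : ℝ) : EReal) < F j ω} :=
    ae_all_iff.2 fun r => measure_eq_zero_iff_ae_notMem.1 (hJ r i)
  filter_upwards [hnull] with ω hω
  by_contra hlt
  obtain ⟨r, h1, h2⟩ := EReal.exists_rat_btwn_of_lt (not_le.1 hlt)
  refine hω r ⟨h2, fun hmem => ?_⟩
  simp only [mem_iUnion, mem_ofPred_eq] at hmem
  obtain ⟨j, hj, hlt'⟩ := hmem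
  obtain ⟨n, rfl⟩ : j ∈ range u := hu ▸ mem_insert_of_mem _ (mem_iUnion.2 ⟨r, hj⟩)
  exact absurd (h1.trans hlt') (not_lt.2 (le_iSup (fun n => F (u n) ω) n))

end OneStepValue

/-! ### The one-period problem of the market -/

section MarketStep

variable {Ω : Type*} {mΩ : MeasurableSpace Ω} {P : Measure Ω} [IsProbabilityMeasure P] {d : ℕ}
  {ℱ : Filtration ℕ mΩ} {S : ℕ → Ω → EuclideanSpace ℝ (Fin d)} {t : ℕ}
  {U : ℝ → ℝ} {a k C : ℝ} {e : Ω → ℚ → ℝ} {V : ℝ → Ω → EReal}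

/-- The regular conditional law of `Θ` given `m`. -/
noncomputable def condLaw {E : Type*} [MeasurableSpace E] [StandardBorelSpace E] [Nonempty E]
    (m : MeasurableSpace Ω) {mΩ : MeasurableSpace Ω} (P : Measure Ω) [IsFiniteMeasure P]
    (Θ : Ω → E) : Kernel[m] Ω E :=
  @condDistrib Ω Ω E _ _ _ mΩ m Θ id P _

instance {E : Type*} [MeasurableSpace E] [StandardBorelSpace E] [Nonempty E]
    (m : MeasurableSpace Ω) {mΩ : MeasurableSpace Ω} (P : Measure Ω) [IsFiniteMeasure P]
    (Θ : Ω → E) : IsMarkovKernel (condLaw m P Θ) := by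
  unfold condLaw
  infer_instance

/-- `V` agrees with the extended path for all x at once off one null set, so it may be evaluated at
the random point x + ⟪ξ, ΔS⟫. -/
lemma stepFamily_ae_eq {κ : Kernel[ℱ t] Ω (EuclideanSpace ℝ (Fin d) × (ℚ → ℝ))} [IsMarkovKernel κ]
    (hκ : IsCondLaw (ℱ t) P (fun ω => (increment S t ω, e ω)) κ)
    (hV : ∀ᵐ ω ∂P, ∀ x, V x ω = ((ratExt (e ω) x : ℝ) : EReal)) (x : ℝ)
    {ξ : Ω → EuclideanSpace ℝ (Fin d)} (hξ : Measurable[ℱ t] ξ) :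
    (condLExp (ℱ t) P (positivePart fun ω => V (x + ⟪ξ ω, increment S t ω⟫_ℝ) ω) =ᵐ[P]
        fun ω => ∫⁻ z, ENNReal.ofReal (posUtil x (ξ ω) z) ∂κ ω) ∧
      stepFamily ℱ P S t V x ⟨ξ, hξ⟩ =ᵐ[P]
        fun ω => gExp (κ ω) (fun z => ((posUtil x (ξ ω) z : ℝ) : EReal)) :=
  hκ.gCondExp_ae_eq (f := fun z => posUtil x (ξ z.1) z.2)
    (measurable_posUtil (H := fun _ => x) (@measurable_const _ _ _ (ℱ t) _) hξ)
    (hV.mono fun _ h => h _)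

/-- The rational path of the value function one period earlier. -/
noncomputable def stepPath (ℱ : Filtration ℕ mΩ) (P : Measure Ω)
    (S : ℕ → Ω → EuclideanSpace ℝ (Fin d)) (t : ℕ) (V : ℝ → Ω → EReal) : Ω → ℚ → ℝ :=
  fun ω q => (stepEssSup ℱ P S t V q ω).toReal

lemma measurable_stepPath (V : ℝ → Ω → EReal) (q : ℚ) :
    Measurable[ℱ t] fun ω => stepPath ℱ P S t V ω q :=
  measurable_ereal_toReal.comp (isEssSup_stepEssSup ℱ P S t V q).1

/-- The dynamic programming step, in terms of conditional laws. -/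
lemma isOneStep_and_isValuePath (hY : Measurable (increment S t)) (he : Measurable e)
    (hrat : ∀ᵐ ω ∂P, IsRatPath U a k C (e ω)) (hU : Continuous U) (hU0 : U 0 = 0) (hk : 0 < k)
    (hak : 1 / 2 ≤ a + k) (hV : ∀ᵐ ω ∂P, ∀ x, V x ω = ((ratExt (e ω) x : ℝ) : EReal))
    (hwd : ∀ x : ℝ, ∀ ξ : Ω → EuclideanSpace ℝ (Fin d), Measurable[ℱ t] ξ →
      CondExpWellDefined (ℱ t) P (fun ω => V (x + ⟪ξ ω, increment S t ω⟫_ℝ) ω))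
    (hfin : ∀ x : ℝ, ∀ᵐ ω ∂P, stepEssSup ℱ P S t V x ω < ⊤)
    (hNA : ∀ ξ : Ω → EuclideanSpace ℝ (Fin d), Measurable[ℱ t] ξ →
      (∀ᵐ ω ∂P, 0 ≤ ⟪ξ ω, increment S t ω⟫_ℝ) → ∀ᵐ ω ∂P, ⟪ξ ω, increment S t ω⟫_ℝ = 0) :
    IsOneStep (ℱ t) P U a k C (increment S t) e
        (condLaw (ℱ t) P fun ω => (increment S t ω, e ω)) (condLaw (ℱ t) P (increment S t)) ∧
      IsValuePath (ℱ t) P (condLaw (ℱ t) P fun ω => (increment S t ω, e ω))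
        (stepPath ℱ P S t V) ∧
      ∀ᵐ ω ∂P, ∀ x, leftRegularization (stepEssSup ℱ P S t V) x ω =
        ((ratExt (stepPath ℱ P S t V ω) x : ℝ) : EReal) := by
  set κ := condLaw (ℱ t) P fun ω => (increment S t ω, e ω) with hκdef
  have hκ : IsCondLaw (ℱ t) P (fun ω => (increment S t ω, e ω)) κ :=
    isCondLaw_condDistrib (ℱ.le t) (hY.prodMk he)
  have hν : IsCondLaw (ℱ t) P (increment S t) (condLaw (ℱ t) P (increment S t)) :=
    isCondLaw_condDistrib (ℱ.le t) hY
  have hdom : ∀ (x : ℝ) (ξ : Ω → EuclideanSpace ℝ (Fin d)) (hξ : Measurable[ℱ t] ξ),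
      ∀ᵐ ω ∂P, gExp (κ ω) (fun z => ((posUtil x (ξ ω) z : ℝ) : EReal)) ≤
        stepEssSup ℱ P S t V x ω := fun x ξ hξ => by
    filter_upwards [(stepFamily_ae_eq hκ hV x hξ).2,
      (isEssSup_stepEssSup ℱ P S t V x).2.1 ⟨ξ, hξ⟩] with ω h1 h2
    rwa [← h1]
  have hreg : ∀ᵐ ω ∂P, IsRegularLaw U a k C (κ ω) Prod.fst (fun z x => ratExt z.2 x) := by
    refine ae_isRegularLaw hκ hU hrat fun x ξ => ?_
    have hξ : Measurable[ℱ t] fun _ : Ω => ξ := @measurable_const _ _ _ (ℱ t) _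
    filter_upwards [(stepFamily_ae_eq hκ hV x hξ).1, hwd x _ hξ, hfin x,
      (isEssSup_stepEssSup ℱ P S t V x).2.1 ⟨_, hξ⟩] with ω h1 h2 h3 h4
    rw [← h1]
    exact lt_top_of_coe_sub_lt_top h2 (lt_of_le_of_lt h4 h3)
  have hstep : IsOneStep (ℱ t) P U a k C (increment S t) e κ
      (condLaw (ℱ t) P (increment S t)) := ⟨hκ, hν, hNA, hreg, hU, hU0, hk, hak⟩
  set v : Ω → ℚ → ℝ := stepPath ℱ P S t V
  -- The essential supremum is finite above by `hfin`, and below because the zero position already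
  -- secures U q.
  have hcoe : ∀ᵐ ω ∂P, ∀ q : ℚ, ((v ω q : ℝ) : EReal) = stepEssSup ℱ P S t V q ω :=
    ae_all_iff.2 fun q => by
      filter_upwards [hfin q, hreg, hdom q (fun _ => 0) (@measurable_const _ _ _ (ℱ t) _)]
        with ω h1 h2 h3
      refine EReal.coe_toReal h1.ne (ne_of_gt (lt_of_lt_of_le (EReal.bot_lt_coe (U q)) ?_))
      refine le_trans ?_ h3
      have h4 := gExp_of_integrable (integrable_const (U q) (μ := κ ω))
      rw [integral_const, probReal_univ, one_smul] at h4
      rw [← h4]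
      refine gExp_mono (h2.path.mono fun z hz => ?_)
      simpa [posUtil] using hz.lower q
  have hval : IsValuePath (ℱ t) P κ v := by
    refine ⟨fun q => measurable_stepPath V q, fun ξ hξ q => ?_, fun q => ?_⟩
    · filter_upwards [hcoe, hdom q ξ hξ] with ω h1 h2
      rwa [h1]
    · have : Nonempty {ξ : Ω → EuclideanSpace ℝ (Fin d) // Measurable[ℱ t] ξ} :=
        ⟨⟨fun _ => 0, @measurable_const _ _ _ (ℱ t) _⟩⟩
      obtain ⟨u, hu⟩ := IsEssSup.exists_seq (ℱ.le t)
        (fun ξ => measurable_gCondExp _ _ _) (isEssSup_stepEssSup ℱ P S t V q)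
      refine ⟨fun n => (u n).1, fun n => (u n).2, ?_⟩
      filter_upwards [hcoe, hu,
        ae_all_iff.2 fun n => (stepFamily_ae_eq hκ hV q (u n).2).2] with ω h1 h2 h3
      rw [h1]
      exact h2.trans (iSup_mono fun n => (h3 n).le)
  refine ⟨hstep, hval, ?_⟩
  filter_upwards [hcoe, hstep.isRatPath hval] with ω h1 h2 x
  rw [coe_ratExt h2.monotone]
  simp only [leftRegularization, h1]

end MarketStep

/-! ### Scaling of the utility function -/

section Utility

variable {U : ℝ → ℝ}

/-- If U x = U y, strict concavity would lift the midpoint above U y, against monotonicity. -/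
lemma strictMono_of_strictConcaveOn (hU : StrictConcaveOn ℝ univ U) (hm : Monotone U) :
    StrictMono U := by
  intro x y hxy
  refine lt_of_le_of_ne (hm hxy.le) fun heq => ?_
  have h := hU.2 (mem_univ x) (mem_univ y) hxy.ne (show (0 : ℝ) < 1 / 2 by norm_num)
    (show (0 : ℝ) < 1 / 2 by norm_num) (by norm_num)
  have h2 := hm (show (1 / 2 : ℝ) • x + (1 / 2 : ℝ) • y ≤ y by simp only [smul_eq_mul]; linarith)
  simp only [smul_eq_mul] at h h2
  linarith

/-- The choice a = (p + r)/2, k = (p - r)/2 makes a U + k |U| equal to p U where U ≥ 0 and to r U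
where U ≤ 0; a gap between the two slopes is all that is needed. -/
lemma exists_scaling_of_le (hm : Monotone U) (h0 : U 0 = 0) {p r C : ℝ} (hp : 1 / 2 ≤ p)
    (hrp : r < p) (h1 : ∀ x, 0 ≤ x → p * U x - C ≤ U (x / 2))
    (h2 : ∀ x, x ≤ 0 → r * U x - C ≤ U (x / 2)) :
    ∃ a k C : ℝ, 0 < k ∧ 1 / 2 ≤ a + k ∧ ∀ x, a * U x + k * |U x| - C ≤ U (x / 2) := by
  refine ⟨(p + r) / 2, (p - r) / 2, C, by linarith, by linarith, fun x => ?_⟩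
  rcases le_total 0 x with hx | hx
  · have : 0 ≤ U x := h0 ▸ hm hx
    rw [abs_of_nonneg this]
    linarith [h1 x hx]
  · have : U x ≤ 0 := h0 ▸ hm hx
    rw [abs_of_nonpos this]
    linarith [h2 x hx]

/-- The elasticity conditions imply a scaling inequality. -/
lemma exists_scaling (hU : ElasticityAtTop U ∨ ElasticityAtBot U) :
    ∃ a k C : ℝ, 0 < k ∧ 1 / 2 ≤ a + k ∧ ∀ x, a * U x + k * |U x| - C ≤ U (x / 2) := by
  have hhalf : ConcaveOn ℝ univ U → U 0 = 0 → ∀ x, 1 / 2 * U x ≤ U (x / 2) := fun hc h0 x => by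
    have := concaveOn_apply_mul_le hc h0.ge one_le_two (x / 2)
    rw [mul_div_cancel₀ x two_ne_zero] at this
    linarith
  have hinv : ∀ s x : ℝ, U (2 * (x / 2)) ≤ 2 ^ s * U (x / 2) → 2 ^ (-s) * U x ≤ U (x / 2) :=
    fun s x hx => by
      rw [mul_div_cancel₀ x two_ne_zero] at hx
      rw [Real.rpow_neg zero_le_two, inv_mul_le_iff₀ (by positivity)]
      exact hx
  rcases hU with ⟨hc, hm, h0, x₀, hx₀, γ, hγ0, hγ1, h⟩ | ⟨hc, hm, h0, α, hα, x₀, hx₀, h⟩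
  -- Elasticity at the top raises the slope for gains from the 1/2 given by concavity to 2^(-γ); the
  -- constant U (2 x₀) covers 0 ≤ x ≤ 2 x₀.
  · have hq : (1 / 2 : ℝ) < 2 ^ (-γ) := by
      have := Real.rpow_lt_rpow_of_exponent_lt one_lt_two (neg_lt_neg hγ1)
      rwa [Real.rpow_neg_one, ← one_div] at this
    have hC : 0 ≤ U (2 * x₀) := h0 ▸ hm (by linarith)
    refine exists_scaling_of_le hm h0 (C := U (2 * x₀)) hq.le hq (fun x hx => ?_) fun x _ => ?_
    · rcases le_total (2 * x₀) x with hx2 | hx2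
      · linarith [hinv γ x (h (x / 2) (by linarith) 2 one_le_two)]
      · have hx0 : 0 ≤ U x := h0 ▸ hm hx
        have hx1 : 0 ≤ U (x / 2) := h0 ▸ hm (by linarith)
        have : (2 : ℝ) ^ (-γ) * U x ≤ 1 * U x :=
          mul_le_mul_of_nonneg_right (Real.rpow_le_one_of_one_le_of_nonpos one_le_two (by linarith)) hx0
        linarith [hm hx2]
    · linarith [hhalf hc h0 x]
  -- Elasticity at the bottom lowers the slope for losses below 1/2; the constant -U x₀ covers 2 x₀
  -- ≤ x ≤ 0.
  · have hq : (2 : ℝ) ^ (-(1 + α)) < 1 / 2 := by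
      have := Real.rpow_lt_rpow_of_exponent_lt one_lt_two (show -(1 + α) < -1 by linarith)
      rwa [Real.rpow_neg_one, ← one_div] at this
    have hC : U x₀ ≤ 0 := h0 ▸ hm hx₀
    refine exists_scaling_of_le hm h0 (C := -U x₀) le_rfl hq (fun x _ => ?_) fun x hx => ?_
    · linarith [hhalf hc h0 x]
    · rcases le_total x (2 * x₀) with hx2 | hx2
      · linarith [hinv (1 + α) x (h (x / 2) (by linarith) 2 one_le_two)]
      · have hx0 : U x ≤ 0 := h0 ▸ hm hx
        have : (2 : ℝ) ^ (-(1 + α)) * U x ≤ 0 :=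
          mul_nonpos_of_nonneg_of_nonpos (by positivity) hx0
        linarith [hm (show x₀ ≤ x / 2 by linarith)]

end Utility

/-! ### Wealth and absence of arbitrage -/

section Wealth

variable {Ω : Type*} {mΩ : MeasurableSpace Ω} {P : Measure Ω} {d T t : ℕ}
  {ℱ : Filtration ℕ mΩ} {S φ : ℕ → Ω → EuclideanSpace ℝ (Fin d)} {c : ℝ}

lemma wealth_zero (ω : Ω) : wealth S c φ 0 ω = c := by simp [wealth]

lemma wealth_succ (t : ℕ) (ω : Ω) :
    wealth S c φ (t + 1) ω = wealth S c φ t ω + ⟪φ (t + 1) ω, increment S t ω⟫_ℝ := by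
  simp [wealth, Finset.sum_range_succ, add_assoc]

lemma measurable_inner {m : MeasurableSpace Ω} {f g : Ω → EuclideanSpace ℝ (Fin d)}
    (hf : Measurable[m] f) (hg : Measurable[m] g) : Measurable[m] fun ω => ⟪f ω, g ω⟫_ℝ :=
  hf.inner hg

lemma measurable_add_real {m : MeasurableSpace Ω} {f g : Ω → ℝ}
    (hf : Measurable[m] f) (hg : Measurable[m] g) : Measurable[m] fun ω => f ω + g ω :=
  hf.add hg

lemma measurable_sub_euclidean {m : MeasurableSpace Ω} {f g : Ω → EuclideanSpace ℝ (Fin d)}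
    (hf : Measurable[m] f) (hg : Measurable[m] g) : Measurable[m] fun ω => f ω - g ω :=
  hf.sub hg

lemma measurable_indicator_euclidean {m : MeasurableSpace Ω} {f : Ω → EuclideanSpace ℝ (Fin d)}
    {B : Set Ω} (hf : Measurable[m] f) (hB : MeasurableSet[m] B) : Measurable[m] (B.indicator f) :=
  hf.indicator hB

lemma measurable_increment (hS : ∀ t ≤ T, Measurable[ℱ t] (S t)) (ht : t < T) :
    Measurable[ℱ (t + 1)] (increment S t) :=
  measurable_sub_euclidean (hS (t + 1) ht) ((hS t ht.le).mono (ℱ.mono t.le_succ) le_rfl)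

lemma IsStrategy.measurable_wealth (hφ : IsStrategy ℱ T φ)
    (hS : ∀ t ≤ T, Measurable[ℱ t] (S t)) (ht : t ≤ T) :
    Measurable[ℱ t] (wealth S c φ t) := by
  induction t with
  | zero =>
    rw [show wealth S c φ 0 = fun _ => c from funext fun ω => wealth_zero ω]
    exact @measurable_const _ _ _ (ℱ 0) _
  | succ t ih =>
    rw [show wealth S c φ (t + 1) = fun ω => wealth S c φ t ω + ⟪φ (t + 1) ω, increment S t ω⟫_ℝ
      from funext fun ω => wealth_succ t ω]
    exact measurable_add_real ((ih (by omega)).mono (ℱ.mono t.le_succ) le_rfl)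
      (measurable_inner ((hφ t ht).mono (ℱ.mono t.le_succ) le_rfl) (measurable_increment hS ht))

lemma NoArbitrage.one_step (hNA : NoArbitrage ℱ P T S) (ht : t < T)
    {ξ : Ω → EuclideanSpace ℝ (Fin d)} (hξ : Measurable[ℱ t] ξ)
    (h : ∀ᵐ ω ∂P, 0 ≤ ⟪ξ ω, increment S t ω⟫_ℝ) :
    ∀ᵐ ω ∂P, ⟪ξ ω, increment S t ω⟫_ℝ = 0 := by
  let φ : ℕ → Ω → EuclideanSpace ℝ (Fin d) := fun n => if n = t + 1 then ξ else fun _ => 0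
  have hφ : IsStrategy ℱ T φ := fun s _ => by
    by_cases hs : s = t
    · subst hs; simpa [φ] using hξ
    · simp only [φ, Nat.add_right_cancel_iff, hs, if_false]
      exact @measurable_const _ _ _ (ℱ s) _
  have hw : ∀ ω, wealth S 0 φ T ω = ⟪ξ ω, increment S t ω⟫_ℝ := fun ω => by
    rw [wealth, zero_add, Finset.sum_eq_single_of_mem t (Finset.mem_range.2 ht)]
    · simp [φ]
    · intro s _ hs
      simp [φ, hs]
  simpa only [hw] using hNA φ hφ (by simpa only [hw] using h)

/-- A strategy of terminal value `0` never has negative value, as it would be an arbitrage from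
that moment on. -/
lemma NoArbitrage.wealth_nonneg (hNA : NoArbitrage ℱ P T S)
    (hS : ∀ t ≤ T, Measurable[ℱ t] (S t)) (hφ : IsStrategy ℱ T φ)
    (h : ∀ᵐ ω ∂P, wealth S 0 φ T ω = 0) (ht : t ≤ T) : ∀ᵐ ω ∂P, 0 ≤ wealth S 0 φ t ω := by
  classical
  let B : Set Ω := {ω | wealth S 0 φ t ω < 0}
  have hB : MeasurableSet[ℱ t] B := (hφ.measurable_wealth hS ht) measurableSet_Iio
  -- Follow φ only after time t and only on B, where its wealth is negative: the terminal gain is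
  -- -V_t > 0 on B and 0 elsewhere.
  let ψ : ℕ → Ω → EuclideanSpace ℝ (Fin d) := fun n =>
    if n ≤ t then fun _ => 0 else B.indicator (φ n)
  have hψ : IsStrategy ℱ T ψ := fun s hs => by
    by_cases hst : s + 1 ≤ t
    · simp only [ψ, hst, if_true]
      exact @measurable_const _ _ _ (ℱ s) _
    · simp only [ψ, hst, if_false]
      exact measurable_indicator_euclidean (hφ s hs) (ℱ.mono (show t ≤ s by omega) B hB)
  have hw0 : ∀ s ≤ t, ∀ ω, wealth S 0 ψ s ω = 0 := fun s => by
    induction s with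
    | zero => exact fun _ ω => wealth_zero ω
    | succ s ih =>
      intro hs ω
      rw [wealth_succ, ih (by omega)]
      simp [ψ, hs]
  have hw : ∀ s, t ≤ s → ∀ ω, wealth S 0 ψ s ω =
      B.indicator (fun ω => wealth S 0 φ s ω - wealth S 0 φ t ω) ω := fun s hs => by
    induction s, hs using Nat.le_induction with
    | base => intro ω; simp [hw0 t le_rfl]
    | succ s hs ih =>
      intro ω
      rw [wealth_succ, ih]
      have : ¬ s + 1 ≤ t := by omega
      by_cases hω : ω ∈ B
      · simp only [ψ, this, if_false, indicator_of_mem hω, wealth_succ s]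
        ring
      · simp [ψ, this, indicator_of_notMem hω]
  have h1 : ∀ᵐ ω ∂P, wealth S 0 ψ T ω = B.indicator (fun ω => -wealth S 0 φ t ω) ω := by
    filter_upwards [h] with ω hω
    rw [hw T ht]
    by_cases hωB : ω ∈ B
    · rw [indicator_of_mem hωB, indicator_of_mem hωB, hω, zero_sub]
    · rw [indicator_of_notMem hωB, indicator_of_notMem hωB]
  have h2 := hNA ψ hψ (h1.mono fun ω hω => by
    rw [hω]
    exact indicator_nonneg (fun ω hω => neg_nonneg.2 (le_of_lt hω)) ω)
  filter_upwards [h1, h2] with ω e1 e2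
  by_contra hneg
  rw [e1, indicator_of_mem (show ω ∈ B from not_le.1 hneg), neg_eq_zero] at e2
  exact hneg e2.ge

/-- Both φ and -φ have nonnegative wealth at t and t + 1, so the wealth vanishes at both times. -/
lemma NoArbitrage.inner_eq_zero (hNA : NoArbitrage ℱ P T S)
    (hS : ∀ t ≤ T, Measurable[ℱ t] (S t)) (hφ : IsStrategy ℱ T φ)
    (h : ∀ᵐ ω ∂P, wealth S 0 φ T ω = 0) (ht : t < T) :
    ∀ᵐ ω ∂P, ⟪φ (t + 1) ω, increment S t ω⟫_ℝ = 0 := by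
  have hneg : ∀ s ω, wealth S 0 (fun n ω => -φ n ω) s ω = -wealth S 0 φ s ω := fun s ω => by
    simp [wealth]
  have hφ' : IsStrategy ℱ T fun n ω => -φ n ω := fun s hs => measurable_neg.comp (hφ s hs)
  have h' : ∀ᵐ ω ∂P, wealth S 0 (fun n ω => -φ n ω) T ω = 0 :=
    h.mono fun ω hω => by rw [hneg, hω, neg_zero]
  filter_upwards [hNA.wealth_nonneg hS hφ h ht.le, hNA.wealth_nonneg hS hφ' h' ht.le,
    hNA.wealth_nonneg hS hφ h ht, hNA.wealth_nonneg hS hφ' h' ht] with ω h1 h2 h3 h4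
  rw [hneg] at h2 h4
  have := wealth_succ (S := S) (c := 0) (φ := φ) t ω
  linarith

end Wealth

/-! ### Supermartingale and martingale inequalities for one period -/

section OneStepExpectation

/-- Free of differences, the inequality can be integrated term by term even where some terms are
infinite. -/
lemma add_le_add_of_coe_sub_le {p q : ℝ≥0∞} {x : ℝ} (h : (p : EReal) - (q : EReal) ≤ (x : EReal)) :
    p + ENNReal.ofReal (-x) ≤ ENNReal.ofReal x + q := by
  rcases eq_or_ne q ⊤ with rfl | hq
  · simp
  have hp : p ≠ ⊤ := (lt_top_of_coe_sub_lt_top (Or.inr hq.lt_top)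
    (lt_of_le_of_lt h (EReal.coe_lt_top x))).ne
  rw [coe_toReal_sub hp hq, EReal.coe_le_coe_iff] at h
  rw [← ENNReal.ofReal_toReal hp, ← ENNReal.ofReal_toReal hq]
  rcases le_total 0 x with hx | hx
  · rw [ENNReal.ofReal_of_nonpos (neg_nonpos.2 hx), add_zero,
      ← ENNReal.ofReal_add hx ENNReal.toReal_nonneg]
    exact ENNReal.ofReal_le_ofReal (by linarith)
  · rw [ENNReal.ofReal_of_nonpos hx, zero_add,
      ← ENNReal.ofReal_add ENNReal.toReal_nonneg (neg_nonneg.2 hx)]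
    exact ENNReal.ofReal_le_ofReal (by linarith)

lemma add_le_add_of_integral_eq {E : Type*} [MeasurableSpace E] {Q : Measure E} {f : E → ℝ}
    (hf : Integrable f Q) {x : ℝ} (h : ∫ e, f e ∂Q = x) :
    ENNReal.ofReal x + ∫⁻ e, ENNReal.ofReal (-f e) ∂Q ≤
      ∫⁻ e, ENNReal.ofReal (f e) ∂Q + ENNReal.ofReal (-x) := by
  have h1 : gExp Q (fun e => ((-f e : ℝ) : EReal)) ≤ ((-x : ℝ) : EReal) := by
    rw [gExp_of_integrable (f := fun e => -f e) hf.neg, integral_neg, h]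
  rw [gExp_coe] at h1
  simp only [neg_neg] at h1
  have := add_le_add_of_coe_sub_le h1
  rw [neg_neg] at this
  rw [add_comm, add_comm (∫⁻ e, ENNReal.ofReal (f e) ∂Q)]
  exact this

variable {Ω : Type*} {m mΩ : MeasurableSpace Ω} {P : Measure[mΩ] Ω} {d : ℕ}
  {U : ℝ → ℝ} {a k C : ℝ} {Y : Ω → EuclideanSpace ℝ (Fin d)} {e : Ω → ℚ → ℝ}
  {κ : Kernel[m] Ω (EuclideanSpace ℝ (Fin d) × (ℚ → ℝ))}
  {ν : Kernel[m] Ω (EuclideanSpace ℝ (Fin d))}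
  {v : Ω → ℚ → ℝ} {H : Ω → ℝ} {ξ : Ω → EuclideanSpace ℝ (Fin d)}

lemma measurable_ratExt_comp {m : MeasurableSpace Ω} {v : Ω → ℚ → ℝ} {H : Ω → ℝ}
    (hv : ∀ q, Measurable[m] fun ω => v ω q) (hH : Measurable[m] H) :
    Measurable[m] fun ω => ratExt (v ω) (H ω) :=
  measurable_ratExt.comp ((measurable_pi_iff.2 hv).prodMk hH)

lemma IsOneStep.lintegral_posUtil (h : IsOneStep m P U a k C Y e κ ν) (hH : Measurable[m] H)
    (hξ : Measurable[m] ξ) {g : ℝ → ℝ≥0∞} (hg : Measurable g) :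
    ∫⁻ ω, g (posUtil (H ω) (ξ ω) (Y ω, e ω)) ∂P =
      ∫⁻ ω, ∫⁻ z, g (posUtil (H ω) (ξ ω) z) ∂κ ω ∂P :=
  h.law.lintegral_eq (fun z => g (posUtil (H z.1) (ξ z.1) z.2))
    (hg.comp (measurable_posUtil hH hξ))

variable [IsMarkovKernel κ]

lemma IsOneStep.measurable_lintegral_posUtil (h : IsOneStep m P U a k C Y e κ ν)
    (hH : Measurable[m] H) (hξ : Measurable[m] ξ) {g : ℝ → ℝ≥0∞} (hg : Measurable g) :
    Measurable[mΩ] fun ω => ∫⁻ z, g (posUtil (H ω) (ξ ω) z) ∂κ ω :=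
  Measurable.mono (Measurable.lintegral_kernel_prod_right'
    (f := fun z => g (posUtil (H z.1) (ξ z.1) z.2)) (hg.comp (measurable_posUtil hH hξ)))
    h.law.le le_rfl

variable [IsMarkovKernel ν]

/-- The supermartingale property of the value process, in terms of positive and negative parts. -/
lemma IsOneStep.lintegral_le (h : IsOneStep m P U a k C Y e κ ν) (hv : IsValuePath m P κ v)
    (hH : Measurable[m] H) (hξ : Measurable[m] ξ) :
    ∫⁻ ω, ENNReal.ofReal (posUtil (H ω) (ξ ω) (Y ω, e ω)) ∂P +
        ∫⁻ ω, ENNReal.ofReal (-ratExt (v ω) (H ω)) ∂P ≤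
      ∫⁻ ω, ENNReal.ofReal (ratExt (v ω) (H ω)) ∂P +
        ∫⁻ ω, ENNReal.ofReal (-posUtil (H ω) (ξ ω) (Y ω, e ω)) ∂P ∧
    ∫⁻ ω, ENNReal.ofReal (-ratExt (v ω) (H ω)) ∂P ≤
      ∫⁻ ω, ENNReal.ofReal (-posUtil (H ω) (ξ ω) (Y ω, e ω)) ∂P := by
  have hg : Measurable fun x : ℝ => ENNReal.ofReal (-x) := measurable_neg.ennreal_ofReal
  have hX : Measurable[mΩ] fun ω => ratExt (v ω) (H ω) :=
    (measurable_ratExt_comp hv.measurable hH).mono h.law.le le_rfl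
  have key : ∀ᵐ ω ∂P, ∫⁻ z, ENNReal.ofReal (posUtil (H ω) (ξ ω) z) ∂κ ω +
      ENNReal.ofReal (-ratExt (v ω) (H ω)) ≤ ENNReal.ofReal (ratExt (v ω) (H ω)) +
        ∫⁻ z, ENNReal.ofReal (-posUtil (H ω) (ξ ω) z) ∂κ ω :=
    (h.gExp_le hv (H := H) hξ).mono fun ω hω => add_le_add_of_coe_sub_le hω
  rw [h.lintegral_posUtil hH hξ ENNReal.measurable_ofReal, h.lintegral_posUtil hH hξ hg]
  constructor
  · rw [← lintegral_add_left (h.measurable_lintegral_posUtil hH hξ ENNReal.measurable_ofReal),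
      ← lintegral_add_left hX.ennreal_ofReal]
    exact lintegral_mono_ae key
  · refine lintegral_mono_ae (key.mono fun ω hω => ?_)
    rcases le_total 0 (ratExt (v ω) (H ω)) with h0 | h0
    · rw [ENNReal.ofReal_of_nonpos (neg_nonpos.2 h0)]
      exact zero_le
    · rw [ENNReal.ofReal_of_nonpos h0, zero_add] at hω
      exact le_add_self.trans hω

/-- The martingale property of the value process along conditionally optimal positions. -/
lemma IsOneStep.integrable_and_le_integral (h : IsOneStep m P U a k C Y e κ ν)
    (hv : IsValuePath m P κ v)
    (hH : Measurable[m] H) (hξ : Measurable[m] ξ)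
    (hopt : ∀ᵐ ω ∂P, Integrable (posUtil (H ω) (ξ ω)) (κ ω) ∧
        ∫ e, posUtil (H ω) (ξ ω) e ∂κ ω = ratExt (v ω) (H ω) ∧
        k * ∫ e, |posUtil (H ω) (ξ ω) e| ∂κ ω ≤
          ratExt (v ω) (H ω / 2) - a * ratExt (v ω) (H ω) + C) [IsFiniteMeasure P]
    (hi : Integrable (fun ω => ratExt (v ω) (H ω)) P)
    (hi0 : Integrable (fun ω => ratExt (v ω) 0) P) :
    Integrable (fun ω => posUtil (H ω) (ξ ω) (Y ω, e ω)) P ∧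
      ∫ ω, ratExt (v ω) (H ω) ∂P ≤ ∫ ω, posUtil (H ω) (ξ ω) (Y ω, e ω) ∂P := by
  have hg : Measurable fun x : ℝ => ENNReal.ofReal (-x) := measurable_neg.ennreal_ofReal
  have hN : Measurable[mΩ] fun ω => posUtil (H ω) (ξ ω) (Y ω, e ω) :=
    (measurable_posUtil hH hξ).comp (measurable_graph h.law.le h.law.measurable)
  have hiN : Integrable (fun ω => posUtil (H ω) (ξ ω) (Y ω, e ω)) P := by
    refine ⟨hN.aestronglyMeasurable, ?_⟩
    rw [hasFiniteIntegral_iff_enorm, h.lintegral_posUtil hH hξ measurable_enorm]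
    -- Conditional integrability alone gives no integrability under P. The conditional L¹ bound
    -- does, once v (H/2) is estimated by |v H| + |v 0| through monotonicity.
    have hb : Integrable (fun ω => k⁻¹ * ((|ratExt (v ω) (H ω)| + |ratExt (v ω) 0|) +
        |a| * |ratExt (v ω) (H ω)| + |C|)) P :=
      ((((hi.abs.add hi0.abs).add (hi.abs.const_mul |a|)).add (integrable_const _)).const_mul _)
    refine lt_of_le_of_lt (lintegral_mono_ae ?_) hb.lintegral_lt_top
    filter_upwards [hopt, h.isRatPath hv] with ω ho hr
    have hp := hr.isUtilityPath h.continuous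
    rw [← ofReal_integral_norm_eq_lintegral_enorm ho.1]
    refine ENNReal.ofReal_le_ofReal ?_
    simp only [Real.norm_eq_abs]
    rw [le_inv_mul_iff₀ h.k_pos]
    refine ho.2.2.trans ?_
    have h1 : ratExt (v ω) (H ω / 2) ≤ |ratExt (v ω) (H ω)| + |ratExt (v ω) 0| := by
      rcases le_total 0 (H ω) with h0 | h0
      · have := hp.strictMono.monotone (show H ω / 2 ≤ H ω by linarith)
        linarith [le_abs_self (ratExt (v ω) (H ω)), abs_nonneg (ratExt (v ω) 0)]
      · have := hp.strictMono.monotone (show H ω / 2 ≤ 0 by linarith)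
        linarith [le_abs_self (ratExt (v ω) 0), abs_nonneg (ratExt (v ω) (H ω))]
    have h2 : -(a * ratExt (v ω) (H ω)) ≤ |a| * |ratExt (v ω) (H ω)| := by
      rw [← abs_mul]
      exact neg_le_abs _
    linarith [le_abs_self C]
  refine ⟨hiN, ?_⟩
  have key : ∀ᵐ ω ∂P, ENNReal.ofReal (ratExt (v ω) (H ω)) +
        ∫⁻ z, ENNReal.ofReal (-posUtil (H ω) (ξ ω) z) ∂κ ω ≤
      ∫⁻ z, ENNReal.ofReal (posUtil (H ω) (ξ ω) z) ∂κ ω +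
        ENNReal.ofReal (-ratExt (v ω) (H ω)) :=
    hopt.mono fun ω ho => add_le_add_of_integral_eq ho.1 ho.2.1
  have h1 := lintegral_mono_ae key
  have hX : Measurable[mΩ] fun ω => ratExt (v ω) (H ω) :=
    (measurable_ratExt_comp hv.measurable hH).mono h.law.le le_rfl
  rw [lintegral_add_left (h.measurable_lintegral_posUtil hH hξ ENNReal.measurable_ofReal),
      lintegral_add_left hX.ennreal_ofReal,
      ← h.lintegral_posUtil hH hξ ENNReal.measurable_ofReal, ← h.lintegral_posUtil hH hξ hg] at h1
  have h2 := coe_sub_le_coe_sub (lintegral_ofReal_ne_top hi.neg) (lintegral_ofReal_ne_top hiN.neg) h1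
  rw [← EReal.coe_le_coe_iff, ← gExp_of_integrable hi, ← gExp_of_integrable hiN]
  exact h2

end OneStepExpectation

/-! ### Dynamic programming -/

section DynamicProgram

lemma posUtil_wealth {Ω : Type*} {d : ℕ} {S φ : ℕ → Ω → EuclideanSpace ℝ (Fin d)} {c : ℝ} (t : ℕ)
    (ω : Ω) (r : ℚ → ℝ) : posUtil (wealth S c φ t ω) (φ (t + 1) ω) (increment S t ω, r) =
      ratExt r (wealth S c φ (t + 1) ω) := by
  rw [wealth_succ]; rfl

variable {Ω : Type*} {mΩ : MeasurableSpace Ω} {P : Measure Ω} [IsProbabilityMeasure P] {d T t : ℕ}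
  {ℱ : Filtration ℕ mΩ} {S : ℕ → Ω → EuclideanSpace ℝ (Fin d)} {U : ℝ → ℝ} {a k C c : ℝ}
  {e : ℕ → Ω → ℚ → ℝ} {φ : ℕ → Ω → EuclideanSpace ℝ (Fin d)}

/-- The rational paths `e t` of the value functions solve the dynamic programming equations. -/
structure IsDynamicProgram (ℱ : Filtration ℕ mΩ) (P : Measure Ω) [IsProbabilityMeasure P] (T : ℕ)
    (S : ℕ → Ω → EuclideanSpace ℝ (Fin d)) (U : ℝ → ℝ) (a k C : ℝ) (e : ℕ → Ω → ℚ → ℝ) :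
    Prop where
  price : ∀ t ≤ T, Measurable[ℱ t] (S t)
  utility : IsUtilityPath U a k C U
  measurable : ∀ t ≤ T, ∀ q, Measurable[ℱ t] fun ω => e t ω q
  terminal : ∀ ω q, e T ω q = U q
  path : ∀ t ≤ T, ∀ᵐ ω ∂P, IsRatPath U a k C (e t ω)
  step : ∀ t < T, IsOneStep (ℱ t) P U a k C (increment S t) (e (t + 1))
    (condLaw (ℱ t) P fun ω => (increment S t ω, e (t + 1) ω)) (condLaw (ℱ t) P (increment S t))
  value : ∀ t < T, IsValuePath (ℱ t) P
    (condLaw (ℱ t) P fun ω => (increment S t ω, e (t + 1) ω)) (e t)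
  initial : ∀ x, ∫⁻ ω, ENNReal.ofReal (ratExt (e 0 ω) x) ∂P < ⊤

/-- The rational paths of the value functions. -/
noncomputable def valuePath (ℱ : Filtration ℕ mΩ) (P : Measure Ω) (T : ℕ)
    (S : ℕ → Ω → EuclideanSpace ℝ (Fin d)) (U : ℝ → ℝ) (t : ℕ) : Ω → ℚ → ℝ :=
  if t < T then stepPath ℱ P S t (valueFn ℱ P T S U (t + 1)) else fun _ q => U q

lemma measurable_valuePath (t : ℕ) (q : ℚ) :
    Measurable[ℱ t] fun ω => valuePath ℱ P T S U t ω q := by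
  by_cases ht : t < T
  · simp only [valuePath, ht, if_true]
    exact measurable_stepPath _ q
  · simp only [valuePath, ht, if_false]
    exact @measurable_const _ _ _ (ℱ t) _

/-- Backward induction from U. A step needs both that the next path lies in the class and that
`valueFn` is its extension, so the two claims travel together. -/
lemma isDynamicProgram_valuePath (hS : ∀ t ≤ T, Measurable[ℱ t] (S t))
    (hNA : NoArbitrage ℱ P T S) (hfin : FiniteValues ℱ P T S U) (hU : IsUtilityPath U a k C U)
    (hU0 : U 0 = 0) (hk : 0 < k) (hak : 1 / 2 ≤ a + k) :
    IsDynamicProgram ℱ P T S U a k C (valuePath ℱ P T S U) := by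
  have hstep : ∀ t < T, (∀ᵐ ω ∂P, IsRatPath U a k C (valuePath ℱ P T S U (t + 1) ω)) →
      (∀ᵐ ω ∂P, ∀ x, valueFn ℱ P T S U (t + 1) x ω =
        ((ratExt (valuePath ℱ P T S U (t + 1) ω) x : ℝ) : EReal)) →
      _ := fun t ht hrat hV => isOneStep_and_isValuePath
    ((measurable_increment hS ht).mono (ℱ.le _) le_rfl)
    (measurable_pi_iff.2 fun q => (measurable_valuePath (t + 1) q).mono (ℱ.le _) le_rfl)
    hrat hU.continuous hU0 hk hak hV (hfin.wellDefined t ht) (hfin.finite t ht)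
    (fun ξ hξ => hNA.one_step ht hξ)
  have hpath : ∀ t < T, stepPath ℱ P S t (valueFn ℱ P T S U (t + 1)) = valuePath ℱ P T S U t :=
    fun t ht => by simp [valuePath, ht]
  have key : ∀ t ≤ T, (∀ᵐ ω ∂P, IsRatPath U a k C (valuePath ℱ P T S U t ω)) ∧
      ∀ᵐ ω ∂P, ∀ x, valueFn ℱ P T S U t x ω =
        ((ratExt (valuePath ℱ P T S U t ω) x : ℝ) : EReal) := fun t ht => by
    induction ht using Nat.decreasingInduction with
    | self =>
      have h : ∀ ω, valuePath ℱ P T S U T ω = fun q : ℚ => U q := fun ω => by simp [valuePath]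
      refine ⟨Eventually.of_forall fun ω => ?_, Eventually.of_forall fun ω x => ?_⟩
      · rw [h]; exact hU.isRatPath
      · rw [h, hU.ratExt_eq, valueFn_terminal]
    | of_succ t ht ih =>
      obtain ⟨h1, h2, h3⟩ := hstep t ht ih.1 ih.2
      rw [valueFn_of_lt _ _ _ _ _ ht, ← hpath t ht]
      exact ⟨h1.isRatPath h2, h3⟩
  have hs := fun t (ht : t < T) => hstep t ht (key (t + 1) ht).1 (key (t + 1) ht).2
  refine ⟨hS, hU, fun t _ q => measurable_valuePath t q, fun ω q => by simp [valuePath],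
    fun t ht => (key t ht).1, fun t ht => (hs t ht).1, fun t ht => hpath t ht ▸ (hs t ht).2.1,
    fun x => ?_⟩
  have h1 : ∫⁻ ω, ENNReal.ofReal (ratExt (valuePath ℱ P T S U 0 ω) x) ∂P =
      ∫⁻ ω, positivePart (valueFn ℱ P T S U 0 x) ω ∂P :=
    lintegral_congr_ae ((key 0 (Nat.zero_le T)).2.mono fun ω hω => by
      simp [positivePart, hω x])
  rw [h1]
  exact lt_top_of_coe_sub_lt_top (hfin.initial x).1 (hfin.initial x).2

namespace IsDynamicProgram

variable (h : IsDynamicProgram ℱ P T S U a k C e)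

include h

lemma ratExt_terminal (ω : Ω) (x : ℝ) : ratExt (e T ω) x = U x := by
  rw [show e T ω = fun q : ℚ => U q from funext (h.terminal ω), h.utility.ratExt_eq]

lemma measurable_ratExt {H : Ω → ℝ} (ht : t ≤ T) (hH : Measurable[ℱ t] H) :
    Measurable fun ω => ratExt (e t ω) (H ω) :=
  (measurable_ratExt_comp (h.measurable t ht) hH).mono (ℱ.le t) le_rfl

/-- The value process is a generalized supermartingale along strategies. -/
lemma gExp_le_of_lt_top (hφ : IsStrategy ℱ T φ)
    (hfin : ∫⁻ ω, ENNReal.ofReal (-U (wealth S c φ T ω)) ∂P < ⊤) (ht : t ≤ T) :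
    ∫⁻ ω, ENNReal.ofReal (-ratExt (e t ω) (wealth S c φ t ω)) ∂P < ⊤ ∧
      gExp P (fun ω => ((U (wealth S c φ T ω) : ℝ) : EReal)) ≤
        gExp P (fun ω => ((ratExt (e t ω) (wealth S c φ t ω) : ℝ) : EReal)) := by
  induction ht using Nat.decreasingInduction with
  | self => simp only [h.ratExt_terminal]; exact ⟨hfin, le_rfl⟩
  | of_succ t ht ih =>
    obtain ⟨h1, h2⟩ := (h.step t ht).lintegral_le (h.value t ht)
      (hφ.measurable_wealth (c := c) h.price ht.le) (hφ t ht)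
    simp only [posUtil_wealth] at h1 h2
    have h3 := h2.trans_lt ih.1
    refine ⟨h3, ih.2.trans ?_⟩
    rw [gExp_coe, gExp_coe]
    exact coe_sub_le_coe_sub ih.1.ne h3.ne h1

lemma gExp_le (hφ : IsStrategy ℱ T φ) : gExp P (terminalUtility T S U c φ) ≤
    gExp P (fun ω => ((ratExt (e 0 ω) c : ℝ) : EReal)) := by
  by_cases hfin : ∫⁻ ω, ENNReal.ofReal (-U (wealth S c φ T ω)) ∂P < ⊤
  · have := (h.gExp_le_of_lt_top hφ hfin (Nat.zero_le T)).2
    simp only [wealth_zero] at this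
    exact this
  -- Subtracting ⊤ in `EReal` gives ⊥, whatever the positive part is.
  · have : gExp P (terminalUtility T S U c φ) = ⊥ := by
      unfold terminalUtility
      rw [gExp_coe, not_lt_top_iff.1 hfin]
      simp
    rw [this]
    exact bot_le

lemma integrable_initial (x : ℝ) : Integrable (fun ω => ratExt (e 0 ω) x) P := by
  refine integrable_of_lintegral_ofReal (h.measurable_ratExt (Nat.zero_le T)
    (@measurable_const _ _ _ (ℱ 0) x)).aestronglyMeasurable (h.initial x).ne (ne_of_lt ?_)
  refine lt_of_le_of_lt (lintegral_mono_ae (g := fun _ => ENNReal.ofReal (-U x)) ?_) ?_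
  · filter_upwards [h.path 0 (Nat.zero_le T)] with ω hω
    exact ENNReal.ofReal_le_ofReal (neg_le_neg ((hω.isUtilityPath h.utility.continuous).lower x))
  · simp

/-- The value at 0 is nonnegative as U 0 = 0, and holding nothing is a competitor, so its mean at
time t + 1 is at most that at t; finiteness spreads forward from time 0. -/
lemma integrable_zero (hU0 : U 0 = 0) (ht : t ≤ T) : Integrable (fun ω => ratExt (e t ω) 0) P := by
  have hm : ∀ s ≤ T, ∫⁻ ω, ENNReal.ofReal (-ratExt (e s ω) 0) ∂P = 0 := fun s hs => by
    refine (lintegral_congr_ae (g := 0) ?_).trans lintegral_zero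
    filter_upwards [h.path s hs] with ω hω
    exact ENNReal.ofReal_of_nonpos
      (neg_nonpos.2 ((hω.isUtilityPath h.utility.continuous).zero_le hU0))
  refine integrable_of_lintegral_ofReal (h.measurable_ratExt ht
    (@measurable_const _ _ _ (ℱ t) 0)).aestronglyMeasurable (ne_of_lt ?_)
    (by rw [hm t ht]; exact ENNReal.zero_ne_top)
  induction t with
  | zero => exact h.initial 0
  | succ t ih =>
    have h1 := ((h.step t ht).lintegral_le (h.value t ht) (H := fun _ => 0) (ξ := fun _ => 0)
      (@measurable_const _ _ _ (ℱ t) 0) (@measurable_const _ _ _ (ℱ t) 0)).1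
    simp only [posUtil, inner_zero_left, add_zero] at h1
    rw [hm t (Nat.le_of_succ_le ht), hm (t + 1) ht, add_zero, add_zero] at h1
    exact h1.trans_lt (ih (Nat.le_of_succ_le ht))

/-- A strategy that is conditionally optimal in every period, and takes values in the affine spans
of the conditional supports. -/
lemma exists_strategy (c : ℝ) : ∃ φ : ℕ → Ω → EuclideanSpace ℝ (Fin d), IsStrategy ℱ T φ ∧
    ∀ t < T, (∀ᵐ ω ∂P, φ (t + 1) ω ∈ supportSpan ℱ P S t ω) ∧
      ∀ᵐ ω ∂P, Integrable (posUtil (wealth S c φ t ω) (φ (t + 1) ω))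
          (condLaw (ℱ t) P (fun ω => (increment S t ω, e (t + 1) ω)) ω) ∧
        ∫ z, posUtil (wealth S c φ t ω) (φ (t + 1) ω) z
          ∂condLaw (ℱ t) P (fun ω => (increment S t ω, e (t + 1) ω)) ω =
            ratExt (e t ω) (wealth S c φ t ω) ∧
        k * ∫ z, |posUtil (wealth S c φ t ω) (φ (t + 1) ω) z|
          ∂condLaw (ℱ t) P (fun ω => (increment S t ω, e (t + 1) ω)) ω ≤
            ratExt (e t ω) (wealth S c φ t ω / 2) - a * ratExt (e t ω) (wealth S c φ t ω) + C := by
  have hex : ∀ (t : ℕ) (H : Ω → ℝ), t < T → Measurable[ℱ t] H → _ := fun t H ht hH =>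
    (h.step t ht).exists_optimal (h.value t ht) hH
  choose! opt hopt using hex
  -- The optimal position depends on current wealth, so the wealth is built first by recursion. The
  -- shift n - 1 reflects that the nth position is chosen at time n - 1.
  let W : ℕ → Ω → ℝ := fun n =>
    Nat.rec (fun _ => c) (fun t w ω => w ω + ⟪opt t w ω, increment S t ω⟫_ℝ) n
  let φ : ℕ → Ω → EuclideanSpace ℝ (Fin d) := fun n => opt (n - 1) (W (n - 1))
  have hW : ∀ t, wealth S c φ t = W t := fun t => by
    induction t with
    | zero => exact funext fun ω => wealth_zero ω
    | succ t ih => exact funext fun ω => by rw [wealth_succ, ih]; rfl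
  have hWm : ∀ t ≤ T, Measurable[ℱ t] (W t) := fun t => by
    induction t with
    | zero => exact fun _ => @measurable_const _ _ _ (ℱ 0) c
    | succ t ih =>
      intro ht
      have h1 := ih (Nat.le_of_succ_le ht)
      exact measurable_add_real (h1.mono (ℱ.mono t.le_succ) le_rfl)
        (measurable_inner ((hopt t _ ht h1).1.mono (ℱ.mono t.le_succ) le_rfl)
          (measurable_increment h.price ht))
  have ho := fun t (ht : t < T) => hopt t (W t) ht (hWm t ht.le)
  refine ⟨φ, fun t ht => (ho t ht).1, fun t ht => ⟨?_, ?_⟩⟩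
  · filter_upwards [(ho t ht).2.1, ae_inEssSpan_cons (h.step t ht).lawY (h.step t ht).noArb]
      with ω h1 h2
    exact mem_affineSpan_support h2 h1
  · rw [hW]
    exact (ho t ht).2.2

/-- Existence of an optimal strategy. -/
lemma exists_isOptimal (hU0 : U 0 = 0) (c : ℝ) :
    ∃ φ : ℕ → Ω → EuclideanSpace ℝ (Fin d), IsOptimal ℱ P T S U c φ ∧
      ∀ t < T, ∀ᵐ ω ∂P, φ (t + 1) ω ∈ supportSpan ℱ P S t ω := by
  obtain ⟨φ, hφ, hopt⟩ := h.exists_strategy c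
  -- Integrability is carried along with the inequality, since the next step needs it.
  have key : ∀ t ≤ T, Integrable (fun ω => ratExt (e t ω) (wealth S c φ t ω)) P ∧
      ∫ ω, ratExt (e 0 ω) c ∂P ≤ ∫ ω, ratExt (e t ω) (wealth S c φ t ω) ∂P := fun t => by
    induction t with
    | zero =>
      simp only [wealth_zero]
      exact fun _ => ⟨h.integrable_initial c, le_rfl⟩
    | succ t ih =>
      intro ht
      obtain ⟨h1, h2⟩ := ih (Nat.le_of_succ_le ht)
      obtain ⟨h3, h4⟩ := (h.step t ht).integrable_and_le_integral (h.value t ht)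
        (hφ.measurable_wealth h.price (Nat.le_of_succ_le ht)) (hφ t ht) (hopt t ht).2 h1
        (h.integrable_zero hU0 (Nat.le_of_succ_le ht))
      simp only [posUtil_wealth] at h3 h4
      exact ⟨h3, h2.trans h4⟩
  obtain ⟨hi, hle⟩ := key T le_rfl
  simp only [h.ratExt_terminal] at hi hle
  have hadm : IsAdmissible ℱ P T S U c φ := ⟨hφ, Or.inl hi.lintegral_lt_top⟩
  have hub : optimalValue ℱ P T S U c ≤ ((∫ ω, ratExt (e 0 ω) c ∂P : ℝ) : EReal) := by
    rw [← gExp_of_integrable (h.integrable_initial c)]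
    exact iSup₂_le fun ψ hψ => h.gExp_le hψ.1
  have heq : gExp P (terminalUtility T S U c φ) =
      ((∫ ω, U (wealth S c φ T ω) ∂P : ℝ) : EReal) := gExp_of_integrable hi
  refine ⟨φ, ⟨hadm, le_antisymm (le_iSup₂ (f := fun ψ (_ : IsAdmissible ℱ P T S U c ψ) =>
    gExp P (terminalUtility T S U c ψ)) φ hadm) (hub.trans ?_),
    hub.trans_lt (EReal.coe_lt_top _)⟩, fun t ht => (hopt t ht).1⟩
  rw [heq]
  exact EReal.coe_le_coe_iff.2 hle

end IsDynamicProgram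

end DynamicProgram

/-! ### Uniqueness -/

section Uniqueness

variable {Ω : Type*} {mΩ : MeasurableSpace Ω} {P : Measure Ω} [IsProbabilityMeasure P] {d T t : ℕ}
  {ℱ : Filtration ℕ mΩ} {S : ℕ → Ω → EuclideanSpace ℝ (Fin d)} {U : ℝ → ℝ} {c : ℝ}
  {φ ψ : ℕ → Ω → EuclideanSpace ℝ (Fin d)}

/-- The zero strategy is admissible. Hence u(c) is not -∞, and optimal strategies have integrable
terminal utility. -/
lemma le_optimalValue (c : ℝ) : ((U c : ℝ) : EReal) ≤ optimalValue ℱ P T S U c := by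
  have hw : ∀ ω, wealth S c (fun _ _ => 0) T ω = c := fun ω => by simp [wealth]
  have hadm : IsAdmissible ℱ P T S U c fun _ _ => 0 :=
    ⟨fun s _ => @measurable_const _ _ _ (ℱ s) _, Or.inl (by
      simp [terminalUtility, hw, positivePart])⟩
  refine le_trans (le_of_eq ?_) (le_iSup₂ (f := fun ψ (_ : IsAdmissible ℱ P T S U c ψ) =>
    gExp P (terminalUtility T S U c ψ)) _ hadm)
  have h4 := gExp_of_integrable (integrable_const (U c) (μ := P))
  rw [integral_const, probReal_univ, one_smul] at h4
  rw [show terminalUtility T S U c (fun _ _ => 0) = fun _ : Ω => ((U c : ℝ) : EReal) from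
    funext fun ω => by rw [terminalUtility, hw], h4]

lemma IsStrategy.measurable_utility (hS : ∀ t ≤ T, Measurable[ℱ t] (S t)) (hU : Continuous U)
    (hφ : IsStrategy ℱ T φ) : Measurable fun ω => U (wealth S c φ T ω) :=
  hU.measurable.comp ((hφ.measurable_wealth hS le_rfl).mono (ℱ.le T) le_rfl)

lemma IsOptimal.integrable (hS : ∀ t ≤ T, Measurable[ℱ t] (S t)) (hU : Continuous U)
    (hφ : IsOptimal ℱ P T S U c φ) :
    Integrable (fun ω => U (wealth S c φ T ω)) P ∧
      ((∫ ω, U (wealth S c φ T ω) ∂P : ℝ) : EReal) = optimalValue ℱ P T S U c := by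
  have hlt : gExp P (terminalUtility T S U c φ) < ⊤ := hφ.2.1 ▸ hφ.2.2
  have hi := (integrable_and_le_of_le_gExp
    (hφ.1.1.measurable_utility (c := c) hS hU).aestronglyMeasurable
    (lt_top_of_coe_sub_lt_top hφ.1.2 hlt) ((le_optimalValue c).trans hφ.2.1.ge)).1
  exact ⟨hi, (gExp_of_integrable hi).symm.trans hφ.2.1⟩

/-- Optimal strategies have the same terminal value. -/
lemma IsOptimal.wealth_ae_eq (hS : ∀ t ≤ T, Measurable[ℱ t] (S t))
    (hU : StrictConcaveOn ℝ univ U) (hφ : IsOptimal ℱ P T S U c φ)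
    (hψ : IsOptimal ℱ P T S U c ψ) : ∀ᵐ ω ∂P, wealth S c φ T ω = wealth S c ψ T ω := by
  have hUc : Continuous U := continuousOn_univ.1 (hU.concaveOn.continuousOn isOpen_univ)
  obtain ⟨h1, e1⟩ := hφ.integrable hS hUc
  obtain ⟨h2, e2⟩ := hψ.integrable hS hUc
  have e3 : ∫ ω, U (wealth S c φ T ω) ∂P = ∫ ω, U (wealth S c ψ T ω) ∂P :=
    EReal.coe_eq_coe_iff.1 (e1.trans e2.symm)
  -- The midpoint strategy is admissible because concavity bounds its utility from below by an
  -- integrable average.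
  let χ : ℕ → Ω → EuclideanSpace ℝ (Fin d) := fun n ω =>
    (1 / 2 : ℝ) • φ n ω + (1 / 2 : ℝ) • ψ n ω
  have hχ : IsStrategy ℱ T χ := fun t ht =>
    ((measurable_fst.const_smul (1 / 2 : ℝ)).add (measurable_snd.const_smul (1 / 2 : ℝ))).comp
      (Measurable.prodMk (hφ.1.1 t ht) (hψ.1.1 t ht))
  have hw : ∀ ω, wealth S c χ T ω =
      (1 / 2 : ℝ) * wealth S c φ T ω + (1 / 2 : ℝ) * wealth S c ψ T ω := fun ω => by
    simp only [wealth, χ, inner_add_left, real_inner_smul_left, Finset.sum_add_distrib,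
      ← Finset.mul_sum]
    ring
  have hi : Integrable (fun ω => (1 / 2 : ℝ) * U (wealth S c φ T ω) +
      (1 / 2 : ℝ) * U (wealth S c ψ T ω)) P := (h1.const_mul (1 / 2)).add (h2.const_mul (1 / 2))
  have hle : ∀ ω, (1 / 2 : ℝ) * U (wealth S c φ T ω) + (1 / 2 : ℝ) * U (wealth S c ψ T ω) ≤
      U (wealth S c χ T ω) := fun ω => by
    have := hU.concaveOn.2 (mem_univ (wealth S c φ T ω)) (mem_univ (wealth S c ψ T ω))
      (show (0 : ℝ) ≤ 1 / 2 by norm_num) (show (0 : ℝ) ≤ 1 / 2 by norm_num) (by norm_num)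
    rw [hw]
    simpa only [smul_eq_mul] using this
  have hadm : IsAdmissible ℱ P T S U c χ :=
    ⟨hχ, Or.inr (lt_of_le_of_lt (lintegral_mono fun ω =>
      ENNReal.ofReal_le_ofReal (neg_le_neg (hle ω))) hi.neg.lintegral_lt_top)⟩
  have hub : gExp P (terminalUtility T S U c χ) ≤ optimalValue ℱ P T S U c :=
    le_iSup₂ (f := fun ψ (_ : IsAdmissible ℱ P T S U c ψ) =>
      gExp P (terminalUtility T S U c ψ)) χ hadm
  have hmean : ∫ ω, ((1 / 2 : ℝ) * U (wealth S c φ T ω) + (1 / 2 : ℝ) * U (wealth S c ψ T ω)) ∂P =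
      ∫ ω, U (wealth S c φ T ω) ∂P := by
    rw [integral_add (h1.const_mul _) (h2.const_mul _), integral_const_mul, integral_const_mul, ← e3]
    ring
  have hge : ((∫ ω, U (wealth S c φ T ω) ∂P : ℝ) : EReal) ≤
      gExp P (terminalUtility T S U c χ) := by
    rw [← hmean, ← gExp_of_integrable hi]
    exact gExp_mono (Eventually.of_forall hle)
  have hiχ := (integrable_and_le_of_le_gExp
    (hχ.measurable_utility (c := c) hS hUc).aestronglyMeasurable
    (lt_top_of_coe_sub_lt_top hadm.2 (hub.trans_lt hφ.2.2)) hge).1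
  have hintχ : ∫ ω, U (wealth S c χ T ω) ∂P ≤ ∫ ω, U (wealth S c φ T ω) ∂P := by
    rw [← EReal.coe_le_coe_iff, ← gExp_of_integrable hiχ, e1]
    exact hub
  -- Optimality squeezes the two integrals together, so the concavity inequality is almost surely an
  -- equality.
  have hae := (integral_eq_iff_of_ae_le hi hiχ (Eventually.of_forall hle)).1
    (le_antisymm (integral_mono hi hiχ hle) (hintχ.trans hmean.ge))
  filter_upwards [hae] with ω hω
  by_contra hne
  have h5 := hU.2 (mem_univ (wealth S c φ T ω)) (mem_univ (wealth S c ψ T ω)) hne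
      (show (0 : ℝ) < 1 / 2 by norm_num) (show (0 : ℝ) < 1 / 2 by norm_num) (by norm_num)
  simp only [smul_eq_mul, ← hw] at h5
  exact h5.ne hω

/-- Strategies in the affine spans of the conditional supports are determined by their
terminal value. -/
lemma NoArbitrage.ae_eq_of_wealth_eq (hNA : NoArbitrage ℱ P T S)
    (hS : ∀ t ≤ T, Measurable[ℱ t] (S t)) (hφ : IsStrategy ℱ T φ) (hψ : IsStrategy ℱ T ψ)
    (h : ∀ᵐ ω ∂P, wealth S c φ T ω = wealth S c ψ T ω) (ht : t < T)
    (hφD : ∀ᵐ ω ∂P, φ (t + 1) ω ∈ supportSpan ℱ P S t ω)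
    (hψD : ∀ᵐ ω ∂P, ψ (t + 1) ω ∈ supportSpan ℱ P S t ω) : φ (t + 1) =ᵐ[P] ψ (t + 1) := by
  have hχ : IsStrategy ℱ T fun n ω => φ n ω - ψ n ω := fun s hs =>
    measurable_sub_euclidean (hφ s hs) (hψ s hs)
  have h0 : ∀ᵐ ω ∂P, wealth S 0 (fun n ω => φ n ω - ψ n ω) T ω = 0 := by
    filter_upwards [h] with ω hω
    simp only [wealth, inner_sub_left, Finset.sum_sub_distrib] at hω ⊢
    linarith
  have hD : ∀ ω, supportSpan ℱ P S t ω =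
      affineSpan ℝ (condLaw (ℱ t) P (increment S t) ω).support := fun _ => rfl
  have hlaw : IsCondLaw (ℱ t) P (increment S t) (condLaw (ℱ t) P (increment S t)) :=
    isCondLaw_condDistrib (ℱ.le t) ((measurable_increment hS ht).mono (ℱ.le _) le_rfl)
  have hB : MeasurableSet[(ℱ t).prod _] {z : Ω × EuclideanSpace ℝ (Fin d) |
      ⟪φ (t + 1) z.1 - ψ (t + 1) z.1, z.2⟫_ℝ ∈ ({0} : Set ℝ)} :=
    measurableSet_inner_fst (hχ t ht) measurable_id (measurableSet_singleton 0)
  have h2 : ∀ᵐ ω ∂P, ⟪φ (t + 1) ω - ψ (t + 1) ω, increment S t ω⟫_ℝ = 0 :=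
    NoArbitrage.inner_eq_zero (φ := fun n ω => φ n ω - ψ n ω) hNA hS hχ h0 ht
  have h1 : ∀ᵐ ω ∂P, ∀ᵐ y ∂condLaw (ℱ t) P (increment S t) ω,
      ⟪φ (t + 1) ω - ψ (t + 1) ω, y⟫_ℝ = 0 :=
    (hlaw.ae_iff hB).1 h2
  filter_upwards [h1, hφD, hψD] with ω h2 h3 h4
  have h5 := inner_eq_zero_of_mem_affineSpan_support h2 (hD ω ▸ h3)
  have h6 := inner_eq_zero_of_mem_affineSpan_support h2 (hD ω ▸ h4)
  -- The difference is orthogonal to the affine span of the support, which contains both positions,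
  -- so it is orthogonal to itself.
  have h7 : ⟪φ (t + 1) ω - ψ (t + 1) ω, φ (t + 1) ω - ψ (t + 1) ω⟫_ℝ = 0 := by
    rw [inner_sub_right, h5, h6, sub_zero]
  exact sub_eq_zero.1 (inner_self_eq_zero.1 h7)

end Uniqueness

end DiscreteMarket

theorem theorem2p8 {Ω : Type*} {mΩ : MeasurableSpace Ω} (P : Measure Ω) [IsProbabilityMeasure P]
    (ℱ : Filtration ℕ mΩ) (T d : ℕ)
    (hnull : ∀ A : Set Ω, MeasurableSet A → P A = 0 → MeasurableSet[ℱ 0] A)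
    (S : ℕ → Ω → EuclideanSpace ℝ (Fin d)) (hS : ∀ t ≤ T, Measurable[ℱ t] (S t))
    (U : ℝ → ℝ) (hU : ElasticityAtTop U ∨ ElasticityAtBot U)
    (hNA : NoArbitrage ℱ P T S) (hfin : FiniteValues ℱ P T S U)
    (hstrict : StrictConcaveOn ℝ univ U) (c : ℝ) :
    (∃ φ : ℕ → Ω → EuclideanSpace ℝ (Fin d), IsOptimal ℱ P T S U c φ ∧
      ∀ t < T, ∀ᵐ ω ∂P, φ (t + 1) ω ∈ supportSpan ℱ P S t ω) ∧
    ∀ φ ψ : ℕ → Ω → EuclideanSpace ℝ (Fin d),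
      IsOptimal ℱ P T S U c φ → (∀ t < T, ∀ᵐ ω ∂P, φ (t + 1) ω ∈ supportSpan ℱ P S t ω) →
      IsOptimal ℱ P T S U c ψ → (∀ t < T, ∀ᵐ ω ∂P, ψ (t + 1) ω ∈ supportSpan ℱ P S t ω) →
      ∀ t < T, φ (t + 1) =ᵐ[P] ψ (t + 1) := by
  have hm : Monotone U := hU.elim (fun h => h.2.1) fun h => h.2.1
  have hU0 : U 0 = 0 := hU.elim (fun h => h.2.2.1) fun h => h.2.2.1
  obtain ⟨a, k, C, hk, hak, hsc⟩ := exists_scaling hU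
  have hpath : IsUtilityPath U a k C U :=
    ⟨hstrict.concaveOn, strictMono_of_strictConcaveOn hstrict hm, fun _ => le_rfl, hsc⟩
  exact ⟨(isDynamicProgram_valuePath hS hNA hfin hpath hU0 hk hak).exists_isOptimal hU0 c,
    fun φ ψ hφ hφD hψ hψD t ht => hNA.ae_eq_of_wealth_eq hS hφ.1.1 hψ.1.1
      (hφ.wealth_ae_eq hS hstrict hψ) ht (hφD t ht) (hψD t ht)⟩
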